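/- Let $(M,g)$ be a smooth Riemannian manifold of dimension $n\ge 4$ with Levi-Civita connection $\nabla$ and curvature $R(X,Y,Z,T)=g(\nabla_X\nabla_YZ-\nabla_Y\nabla_XZ-\nabla_{[X,Y]}Z,T)$; let $\mathrm{Ric}(X,Y)=\mathrm{trace}\{V\mapsto R_{V,X}Y\}$, $S=\mathrm{trace}\,\mathrm{Ric}$, $\mathfrak k=\frac1{n-2}\bigl(\mathrm{Ric}-\frac{S}{2(n-1)}g\bigr)$, and let $W=R-g\odot\mathfrak k$ be the Weyl tensor, where $(g\odot h)(X,Y,Z,T)=g(X,T)h(Y,Z)+g(Y,Z)h(X,T)-g(X,Z)h(Y,T)-g(Y,T)h(X,Z)$. Write $X^*=g(X,\cdot)$ and let $(e_j)$ denote a local $g$-orthonormal frame. Put $\delta_rA(X_1,\dots,X_s)=\sum_j(\nabla_{e_j}A)(X_1,\dots,X_{r-1},e_j,X_r,\dots,X_s)$, $\delta W=\delta_4W$, and $\delta W_Z(X,Y)=\delta W(X,Y,Z)$; for a symmetric $(0,2)$ tensor $b$ let $\mathrm d^\nabla b(X,Y,Z)=(\nabla_Xb)(Y,Z)-(\nabla_Yb)(X,Z)$;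 for a $(0,2)$ tensor $b$ let $\mathrm{sym}(b)(x,y)=b(x,y)+b(y,x)$. Let $\mathcal W$ be the endomorphism of $(0,2)$ tensors with $\mathcal W(X^*\otimes Y^*)(Z,T)=W(Y,Z,T,X)$, and, with $\alpha\wedge\beta=\alpha\otimes\beta-\beta\otimes\alpha$, let $\mathfrak w(\theta)=\sum_i e_i\lrcorner\,\mathcal W^2(e_i^*\wedge\theta)$ on covectors, with pointwise Moore–Penrose inverse $\mathfrak w^\#$ with respect to $g$. Let $\mathcal E=\{v\in TM: W(v,\cdot,\cdot,\cdot)=0\}$ and let $M_{\mathcal E}\subseteq M$ be the open set of points near which the rank of $\mathcal E$ is constant. On $M_{\mathcal E}$ define the vector field $\mathbb T$ and the tensors $C_{\mathbb T}$, $E_{\mathbb T}$, $\widehat B_{\mathbb T}$ by $$g(\mathbb T,\cdot)=\tfrac1{n-3}\,\mathfrak w^\#\Bigl(\sum_ie_i\lrcorner\,\mathcal W(\delta W_{e_i})\Bigr),\qquad C_{\mathbb T}=\mathrm d^\nabla\mathfrak k-W(\cdot,\cdot,\cdot,\mathbb T),$$ $$E_{\mathbb T}=\mathrm{Ric}-\tfrac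 Sn g+(n-2)\Bigl(\nabla\mathbb T^*+\mathbb T^*\otimes\mathbb T^*-\tfrac1n\bigl(\mathrm{div}\,\mathbb T+|\mathbb T|^2\bigr)g\Bigr),$$ $$\widehat B_{\mathbb T}=\delta_1\delta_4W+\tfrac{n-3}{n-2}\,\mathcal W(\mathrm{Ric})-(n-3)(n-4)\,W(\mathbb T,\cdot,\cdot,\mathbb T).$$ (1) If $C_{\mathbb T}=0$ on $M_{\mathcal E}$, then $\widehat B_{\mathbb T}$ and $\mathcal W(\mathrm{sym}(E_{\mathbb T}))$ are conformally invariant of weight $1$ on $M_{\mathcal E}$: for every open $U\subseteq M$, every smooth $\psi:U\to(0,\infty)$ and $\bar g=\psi^{-2}g$ on $U$, the corresponding tensors of $\bar g$ (marked by bars) satisfy, on $U\cap M_{\mathcal E}$, $$\overline{\widehat B}_{\overline{\mathbb T}}=\psi^2\,\widehat B_{\mathbb T},\qquad \overline{\mathcal W}\bigl(\mathrm{sym}(\overline E_{\overline{\mathbb T}})\bigr)=\psi^2\,\mathcal W\bigl(\mathrm{sym}(E_{\mathbb T})\bigr).$$ (2) Consequently, if $(M,g)$ is conformally Einstein, i.e.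 every point of $M$ has an open neighbourhood $U$ with a smooth $\psi:U\to(0,\infty)$ such that $\psi^{-2}g$ has vanishing traceless Ricci tensor on $U$, then $\widehat B_{\mathbb T}=0$ and $\mathcal W(\mathrm{sym}(E_{\mathbb T}))=0$ on $M_{\mathcal E}$. -/

import Mathlib

open scoped Manifold ContDiff Topology

noncomputable section

namespace ConfGeom

/-! ### Tensor calculus in local coordinates

A Riemannian metric on an open piece of `ℝⁿ` is given by its matrix of components `G y` at the
point `y`.  A covariant tensor field of degree `s` is given by its components with respect to the
coordinate frame `∂₀, …, ∂ₙ₋₁`: the component at `y` with indices `J : Fin s → Fin n` is `A y J`. -/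

/-- The coordinate space `ℝⁿ`. -/
abbrev Coord (n : ℕ) : Type := EuclideanSpace ℝ (Fin n)

/-- Components of a metric. -/
abbrev MetricComp (n : ℕ) : Type := Coord n → Matrix (Fin n) (Fin n) ℝ

/-- Components of a covariant tensor field of degree `s`. -/
abbrev Tensor (n s : ℕ) : Type := Coord n → (Fin s → Fin n) → ℝ

/-- Partial derivative in the `i`-th coordinate direction. -/
def pd {n : ℕ} (i : Fin n) (f : Coord n → ℝ) (y : Coord n) : ℝ :=
  fderiv ℝ f y (EuclideanSpace.single i 1)

variable {n : ℕ}

/-- `inv G y a b` is the component `g^{ab}` of the inverse metric. -/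
def inv (G : MetricComp n) (y : Coord n) : Matrix (Fin n) (Fin n) ℝ := (G y)⁻¹

/-- Christoffel symbols of the Levi-Civita connection:
`∇_{∂ᵢ} ∂ⱼ = ∑ k, christoffel G k i j • ∂ₖ`. -/
def christoffel (G : MetricComp n) (k i j : Fin n) (y : Coord n) : ℝ :=
  (1 / 2) * ∑ l, inv G y k l *
    (pd i (fun z => G z j l) y + pd j (fun z => G z i l) y - pd l (fun z => G z i j) y)

/-- Covariant derivative; index `0` of the result is the direction of differentiation. -/
def covDeriv (G : MetricComp n) {s : ℕ} (A : Tensor n s) : Tensor n (s + 1) := fun y J =>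
  pd (J 0) (fun z => A z (Fin.tail J)) y
    - ∑ r : Fin s, ∑ m, christoffel G m (J 0) (Fin.tail J r) y *
        A y (Function.update (Fin.tail J) r m)

/-- Divergence in the slot `r` (slots are numbered from `0`):
`∑ⱼ (∇_{eⱼ} A)(X₁, …, eⱼ, …, Xₛ)` with `eⱼ`, orthonormal, inserted in the slot `r`. -/
def divergence (G : MetricComp n) {s : ℕ} (r : Fin (s + 1)) (A : Tensor n (s + 1)) :
    Tensor n s := fun y J =>
  ∑ a, ∑ b, inv G y a b *
    covDeriv G A y (Fin.cons a (r.insertNth (α := fun _ => Fin n) b J))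

/-- The metric as a tensor field. -/
def metricTensor (G : MetricComp n) : Tensor n 2 := fun y J => G y (J 0) (J 1)

/-- Riemannian curvature tensor
`R(X,Y,Z,T) = g(∇_X ∇_Y Z - ∇_Y ∇_X Z - ∇_{[X,Y]} Z, T)`. -/
def riemann (G : MetricComp n) : Tensor n 4 := fun y J =>
  ∑ m, G y m (J 3) *
    (pd (J 0) (christoffel G m (J 1) (J 2)) y - pd (J 1) (christoffel G m (J 0) (J 2)) y
      + ∑ a, (christoffel G m (J 0) a y * christoffel G a (J 1) (J 2) y
        - christoffel G m (J 1) a y * christoffel G a (J 0) (J 2) y))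

/-- Trace of a tensor of degree two with respect to the metric. -/
def trace (G : MetricComp n) (b : Tensor n 2) (y : Coord n) : ℝ :=
  ∑ i, ∑ j, inv G y i j * b y ![i, j]

/-- Ricci tensor `Ric(X,Y) = trace (V ↦ R_{V,X} Y)`. -/
def ricci (G : MetricComp n) : Tensor n 2 := fun y J =>
  ∑ i, ∑ l, inv G y i l * riemann G y ![i, J 0, J 1, l]

/-- Scalar curvature. -/
def scalar (G : MetricComp n) (y : Coord n) : ℝ := trace G (ricci G) y

/-- Traceless Ricci tensor `Ric - (S / n) g`. -/
def tracelessRicci (G : MetricComp n) : Tensor n 2 := fun y J =>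
  ricci G y J - scalar G y / n * metricTensor G y J

/-- Schouten tensor `(Ric - S / (2 (n - 1)) g) / (n - 2)`. -/
def schouten (G : MetricComp n) : Tensor n 2 := fun y J =>
  1 / ((n : ℝ) - 2) * (ricci G y J - scalar G y / (2 * ((n : ℝ) - 1)) * metricTensor G y J)

/-- Kulkarni-Nomizu product. -/
def kulkarniNomizu (g h : Tensor n 2) : Tensor n 4 := fun y J =>
  g y ![J 0, J 3] * h y ![J 1, J 2] + g y ![J 1, J 2] * h y ![J 0, J 3]
    - g y ![J 0, J 2] * h y ![J 1, J 3] - g y ![J 1, J 3] * h y ![J 0, J 2]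

/-- Weyl tensor. -/
def weyl (G : MetricComp n) : Tensor n 4 := fun y J =>
  riemann G y J - kulkarniNomizu (metricTensor G) (schouten G) y J

/-- `δ W = δ₄ W`. -/
def divWeyl (G : MetricComp n) : Tensor n 3 := divergence G 3 (weyl G)

/-- The Weyl tensor as an endomorphism of tensors of degree two at the point `y`:
`𝒲(X* ⊗ Y*)(Z,T) = W(Y,Z,T,X)`. -/
def weylOp (G : MetricComp n) (y : Coord n) (b : (Fin 2 → Fin n) → ℝ) : (Fin 2 → Fin n) → ℝ :=
  fun J => ∑ i, ∑ j, b ![i, j] *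
    ∑ a, ∑ c, inv G y i a * inv G y j c * weyl G y ![c, J 0, J 1, a]

/-- Wedge product of covectors, `α ⊗ β - β ⊗ α`. -/
def wedge (α β : Fin n → ℝ) : (Fin 2 → Fin n) → ℝ := fun J =>
  α (J 0) * β (J 1) - β (J 0) * α (J 1)

/-- Negative Ricci contraction of `𝒲²`, as an endomorphism of covectors:
`𝔴(θ) = ∑ᵢ fᵢ ⌟ 𝒲²(ηᵢ ∧ θ)` for a basis `fᵢ` with dual basis `ηᵢ`. -/
def ricciW (G : MetricComp n) (y : Coord n) (θ : Fin n → ℝ) : Fin n → ℝ := fun k =>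
  ∑ i, weylOp G y (weylOp G y (wedge (Pi.single i 1) θ)) ![i, k]

/-- The matrix of `ricciW` with respect to the basis `dxᵐ`. -/
def ricciWMatrix (G : MetricComp n) (y : Coord n) : Matrix (Fin n) (Fin n) ℝ :=
  Matrix.of fun k m => ricciW G y (Pi.single m 1) k

/-- `P` is a Moore-Penrose inverse of `A` with respect to the inner product with matrix `H`. -/
structure IsMoorePenrose (H A P : Matrix (Fin n) (Fin n) ℝ) : Prop where
  mul_mul_left : A * P * A = A
  mul_mul_right : P * A * P = P
  symm_left : (A * P).transpose * H = H * (A * P)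
  symm_right : (P * A).transpose * H = H * (P * A)

open Classical in
/-- The Moore-Penrose inverse of `A` with respect to the inner product with matrix `H`. -/
def moorePenrose (H A : Matrix (Fin n) (Fin n) ℝ) : Matrix (Fin n) (Fin n) ℝ :=
  if h : ∃ P, IsMoorePenrose H A P then h.choose else 0

/-- The one-form `∑ᵢ eᵢ ⌟ 𝒲(δW_{eᵢ})`, where `δW_Z(X,Y) = δW(X,Y,Z)` and the `eᵢ` are
orthonormal. -/
def divWeylContraction (G : MetricComp n) (y : Coord n) : Fin n → ℝ := fun k =>
  ∑ a, ∑ b, inv G y a b * weylOp G y (fun J => divWeyl G y ![J 0, J 1, b]) ![a, k]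

/-- The one-form `𝕋* = g(𝕋, ·)`; the inner product on covectors is the inverse metric. -/
def tForm (G : MetricComp n) : Tensor n 1 := fun y J =>
  1 / ((n : ℝ) - 3) *
    (moorePenrose (inv G y) (ricciWMatrix G y)).mulVec (divWeylContraction G y) (J 0)

/-- The vector field `𝕋`. -/
def tVec (G : MetricComp n) (y : Coord n) : Fin n → ℝ := fun i =>
  ∑ k, inv G y i k * tForm G y ![k]

/-- Exterior derivative `(∇_X b)(Y,Z) - (∇_Y b)(X,Z)` of a tensor of degree two. -/
def dNabla (G : MetricComp n) (b : Tensor n 2) : Tensor n 3 := fun y J =>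
  covDeriv G b y ![J 0, J 1, J 2] - covDeriv G b y ![J 1, J 0, J 2]

/-- `C_𝕋 = d^∇ 𝔨 - W(·,·,·,𝕋)`. -/
def cTensor (G : MetricComp n) : Tensor n 3 := fun y J =>
  dNabla G (schouten G) y J - ∑ l, weyl G y ![J 0, J 1, J 2, l] * tVec G y l

/-- `E_𝕋 = Ric - (S / n) g + (n - 2) (∇𝕋* + 𝕋* ⊗ 𝕋* - (1 / n) (div 𝕋 + |𝕋|²) g)`. -/
def eTensor (G : MetricComp n) : Tensor n 2 := fun y J =>
  tracelessRicci G y J + ((n : ℝ) - 2) *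
    (covDeriv G (tForm G) y J + tForm G y ![J 0] * tForm G y ![J 1]
      - 1 / (n : ℝ) * (trace G (covDeriv G (tForm G)) y + ∑ k, tForm G y ![k] * tVec G y k)
        * metricTensor G y J)

/-- `sym b (x,y) = b(x,y) + b(y,x)`. -/
def sym (b : (Fin 2 → Fin n) → ℝ) : (Fin 2 → Fin n) → ℝ := fun J => b ![J 0, J 1] + b ![J 1, J 0]

/-- `B̂_𝕋 = δ₁ δ₄ W + (n-3)/(n-2) 𝒲(Ric) - (n-3)(n-4) W(𝕋,·,·,𝕋)`. -/
def bHat (G : MetricComp n) : Tensor n 2 := fun y J =>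
  divergence G 0 (divWeyl G) y J
    + ((n : ℝ) - 3) / ((n : ℝ) - 2) * weylOp G y (ricci G y) J
    - ((n : ℝ) - 3) * ((n : ℝ) - 4) *
        ∑ i, ∑ l, tVec G y i * tVec G y l * weyl G y ![i, J 0, J 1, l]

/-- `𝒲(sym E_𝕋)`. -/
def weylSymE (G : MetricComp n) : Tensor n 2 := fun y => weylOp G y (sym (eTensor G y))

/-- The fibre `{v | W(v,·,·,·) = 0}` of `ℰ` at `y`. -/
def weylNull (G : MetricComp n) (y : Coord n) : Submodule ℝ (Fin n → ℝ) where
  carrier := {v | ∀ j k l, ∑ i, v i * weyl G y ![i, j, k, l] = 0}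
  add_mem' {v w} hv hw j k l := by
    simp only [Set.mem_ofPred_eq] at hv hw
    simp [add_mul, Finset.sum_add_distrib, hv j k l, hw j k l]
  zero_mem' j k l := by simp
  smul_mem' c v hv j k l := by
    simp only [Set.mem_ofPred_eq] at hv
    simp [mul_assoc, ← Finset.mul_sum, hv j k l]

/-! ### Riemannian manifolds

All tensors above are natural, so a tensor field on a manifold is described by its components in
every chart of the maximal atlas, and it vanishes at a point if its components vanish there. -/

variable {M : Type*} [TopologicalSpace M] [ChartedSpace (Coord n) M]
  [IsManifold 𝓘(ℝ, Coord n) ∞ M]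

/-- Smooth Riemannian metrics on the `n`-dimensional smooth manifold `M`. -/
abbrev Metric (n : ℕ) (M : Type*) [TopologicalSpace M] [ChartedSpace (Coord n) M]
    [IsManifold 𝓘(ℝ, Coord n) ∞ M] : Type _ :=
  Bundle.ContMDiffRiemannianMetric 𝓘(ℝ, Coord n) ∞ (Coord n)
    (fun p : M => TangentSpace 𝓘(ℝ, Coord n) p)

/-- The coordinate vector `∂ᵢ` of the chart `e` at the point with coordinates `y`. -/
def coordVec (e : OpenPartialHomeomorph M (Coord n)) (i : Fin n) (y : Coord n) :
    TangentSpace 𝓘(ℝ, Coord n) (e.symm y) :=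
  mfderiv 𝓘(ℝ, Coord n) 𝓘(ℝ, Coord n) e.symm y (EuclideanSpace.single i (1 : ℝ) : Coord n)

/-- The components `g(∂ᵢ, ∂ⱼ)` of the metric in the chart `e`. -/
def comp (g : Metric n M) (e : OpenPartialHomeomorph M (Coord n)) : MetricComp n := fun y =>
  Matrix.of fun i j => g.inner (e.symm y) (coordVec e i y) (coordVec e j y)

/-- The components of the conformally related metric `ψ⁻² g` in the chart `e`. -/
def confComp (ψ : M → ℝ) (g : Metric n M) (e : OpenPartialHomeomorph M (Coord n)) :
    MetricComp n := fun y => ((ψ (e.symm y)) ^ 2)⁻¹ • comp g e y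

/-- The part of `M_ℰ` in the domain of the chart `e`: the points of the domain
near which the rank of `ℰ` is constant. -/
def regularPart (g : Metric n M) (e : OpenPartialHomeomorph M (Coord n)) : Set M :=
  {p | p ∈ e.source ∧ ∀ᶠ y in 𝓝 (e p),
    Module.finrank ℝ (weylNull (comp g e) y) = Module.finrank ℝ (weylNull (comp g e) (e p))}

/-- `C_𝕋` vanishes (on all of `M_ℰ`, the set where it is defined). -/
def CVanishes (g : Metric n M) : Prop :=
  ∀ e ∈ IsManifold.maximalAtlas 𝓘(ℝ, Coord n) ∞ M, ∀ p ∈ regularPart g e,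
    cTensor (comp g e) (e p) = 0

/-- The tensor `A`, determined by the metric, is on `M_ℰ` conformally invariant of weight `k` at
`g`: every local conformal change `ψ⁻² g`, given by a smooth positive function `ψ` on an
open set `U`, has `Ā = ψ^{2k} A` on `U ∩ M_ℰ`. -/
def ConformallyInvariantAt {s : ℕ} (A : MetricComp n → Tensor n s) (k : ℤ) (g : Metric n M) :
    Prop :=
  ∀ (U : Set M) (ψ : M → ℝ), IsOpen U → ContMDiffOn 𝓘(ℝ, Coord n) 𝓘(ℝ) ∞ ψ U →
    (∀ p ∈ U, 0 < ψ p) →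
    ∀ e ∈ IsManifold.maximalAtlas 𝓘(ℝ, Coord n) ∞ M, ∀ p ∈ U ∩ regularPart g e,
      A (confComp ψ g e) (e p) = ψ p ^ (2 * k) • A (comp g e) (e p)

/-- `g` is locally conformally related to an Einstein metric. -/
def IsConformallyEinstein (g : Metric n M) : Prop :=
  ∀ p : M, ∃ (U : Set M) (ψ : M → ℝ), IsOpen U ∧ p ∈ U ∧
    ContMDiffOn 𝓘(ℝ, Coord n) 𝓘(ℝ) ∞ ψ U ∧ (∀ q ∈ U, 0 < ψ q) ∧
    ∀ e ∈ IsManifold.maximalAtlas 𝓘(ℝ, Coord n) ∞ M, ∀ q ∈ U ∩ e.source,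
      tracelessRicci (confComp ψ g e) (e q) = 0

/-- The tensor `A`, determined by the metric `g`, vanishes on `M_ℰ`. -/
def VanishesOnRegular {s : ℕ} (A : MetricComp n → Tensor n s) (g : Metric n M) : Prop :=
  ∀ e ∈ IsManifold.maximalAtlas 𝓘(ℝ, Coord n) ∞ M, ∀ p ∈ regularPart g e,
    A (comp g e) (e p) = 0

end ConfGeom

end

/-! Write `φ = ψ⁻²` and `α = ½ d log φ`, and let `W(θ)` stand for `W(·,·,·,θ♯)`. The whole argument
rests on the linear equation `δW = (n-3) W(θ)` for a one-form `θ`. The contracted second Bianchi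
identity gives `δW = (n-3) d^∇ 𝔨` (`contracted_bianchi`), so `C_𝕋 = 0` says exactly that `𝕋*` is a
solution. Under `g ↦ φ g` one has `δW ↦ δW + (n-3) W(α)` (`divWeyl_conf`), while `W(θ)` with its
three lower slots does not change. Hence `θ + α` solves the equation of the new metric whenever `θ`
solves that of the old one.

Solutions are unique only modulo forms `ν` with `W(ν) = 0`, and `𝕋*` picks one of them. The reason
is the identity `⟨η, 𝔴θ⟩ = ½ ⟨W(η), W(θ)⟩` (`ricciW_pairing`): `𝔴` is a Gram operator, self-adjoint,
with kernel dual to `ℰ`. If `θ` is a solution, the one-form to which `𝔴^#` is applied is `(n-3) 𝔴θ`,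
so `𝕋* - θ` lies in that kernel. Constant rank of `ℰ` makes the Moore-Penrose inverse smooth
(`exists_smooth_moorePenrose`), so `𝕋*` can be differentiated (`tForm_regular`). Altogether `𝕋̄* =
𝕋* + α + ν` with `ν` smooth and `W(ν) = 0` near the point.

Next, `𝒲(E_𝕋)` is computed for both metrics. `𝒲` annihilates `g`, because `W` is trace-free, so all
multiples of `g` drop out. The terms in `α` cancel between the changes of `Ric`, of `∇` and of `𝕋* ⊗
𝕋*`. What remains is `∇ν` together with products having a factor `ν`. The products die because `W(ν)
= 0`; `𝒲(∇ν) = 0` follows by taking the divergence of `W(ν) = 0` (`weylOp_covDeriv_eq_zero`). As `𝒲`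
scales by `φ⁻¹ = ψ²`, so does `𝒲(E_𝕋)`. Both assertions of (1) follow: `𝒲` commutes with
transposition, which handles `sym`, and `B̂_𝕋` is `(n-3)/(n-2)` times the transpose of `𝒲(E_𝕋)`
where `C_𝕋 = 0` (`bHat_eq`).

For (2), an Einstein metric has parallel Schouten tensor, so `δW = 0`, `𝕋 = 0` and `𝒲(E_𝕋) = 0`. If
`φ g` is Einstein, then `-α` solves the equation for `g`; invariance therefore applies and carries
the vanishing back to `g`. For this reason `conformal_invariance` asks only for solvability of the
equation, not for `C_𝕋 = 0`. -/

noncomputable section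

namespace ConfGeom

/-! ### Partial derivatives -/

section PartialDerivatives

variable {n : ℕ} {f g : Coord n → ℝ} {y : Coord n}

theorem pd_add (i : Fin n) (hf : DifferentiableAt ℝ f y) (hg : DifferentiableAt ℝ g y) :
    pd i (fun z => f z + g z) y = pd i f y + pd i g y := by
  simp [pd, fderiv_fun_add hf hg]

theorem pd_sub (i : Fin n) (hf : DifferentiableAt ℝ f y) (hg : DifferentiableAt ℝ g y) :
    pd i (fun z => f z - g z) y = pd i f y - pd i g y := by
  simp [pd, fderiv_fun_sub hf hg]

theorem pd_mul (i : Fin n) (hf : DifferentiableAt ℝ f y) (hg : DifferentiableAt ℝ g y) :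
    pd i (fun z => f z * g z) y = pd i f y * g y + f y * pd i g y := by
  simp [pd, fderiv_fun_mul hf hg]
  ring

theorem pd_const (i : Fin n) (c : ℝ) : pd i (fun _ => c) y = 0 := by
  simp [pd]

theorem pd_const_mul (i : Fin n) (c : ℝ) (hf : DifferentiableAt ℝ f y) :
    pd i (fun z => c * f z) y = c * pd i f y := by
  rw [pd_mul i (differentiableAt_const c) hf, pd_const]; ring

theorem pd_sum {ι : Type*} (s : Finset ι) (i : Fin n) {F : ι → Coord n → ℝ}
    (hF : ∀ a ∈ s, DifferentiableAt ℝ (F a) y) :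
    pd i (fun z => ∑ a ∈ s, F a z) y = ∑ a ∈ s, pd i (F a) y := by
  simp [pd, fderiv_fun_sum hF]

theorem pd_congr (i : Fin n) (h : f =ᶠ[𝓝 y] g) : pd i f y = pd i g y := by
  simp [pd, h.fderiv_eq]

theorem _root_.ContDiffAt.pd (i : Fin n) (hf : ContDiffAt ℝ ∞ f y) :
    ContDiffAt ℝ ∞ (pd i f) y := by
  have h : ContDiffAt ℝ ∞ (fderiv ℝ f) y := hf.fderiv_right (by simp)
  exact h.clm_apply contDiffAt_const

theorem pd_comm (i j : Fin n) (hf : ContDiffAt ℝ ∞ f y) :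
    pd i (pd j f) y = pd j (pd i f) y := by
  have h : DifferentiableAt ℝ (fderiv ℝ f) y :=
    (hf.fderiv_right (m := ∞) (by simp)).differentiableAt (by simp)
  have key : ∀ k l : Fin n, pd k (pd l f) y =
      fderiv ℝ (fderiv ℝ f) y (EuclideanSpace.single k 1) (EuclideanSpace.single l 1) := by
    intro k l
    have e : pd l f = fun z => fderiv ℝ f z (EuclideanSpace.single l 1) := rfl
    simp only [pd] at e ⊢
    rw [e, fderiv_clm_apply h (differentiableAt_const _)]
    simp
  rw [key, key]
  exact (hf.isSymmSndFDerivAt (by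
    rw [minSmoothness_of_isRCLikeNormedField]; exact WithTop.coe_le_coe.2 le_top)) _ _

end PartialDerivatives

/-! ### Matrix-valued functions -/

section MatrixFields

variable {n : ℕ} {A B : Coord n → Matrix (Fin n) (Fin n) ℝ} {y : Coord n}

/-- Entrywise smoothness of a matrix-valued function at a point. -/
def SmoothEntriesAt (A : Coord n → Matrix (Fin n) (Fin n) ℝ) (y : Coord n) : Prop :=
  ∀ a b, ContDiffAt ℝ ∞ (fun z => A z a b) y

/-- Entrywise partial derivative of a matrix-valued function. -/
def pdMat (i : Fin n) (A : Coord n → Matrix (Fin n) (Fin n) ℝ) (y : Coord n) :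
    Matrix (Fin n) (Fin n) ℝ :=
  Matrix.of fun a b => pd i (fun z => A z a b) y

theorem SmoothEntriesAt.diff (hA : SmoothEntriesAt A y) (a b : Fin n) :
    DifferentiableAt ℝ (fun z => A z a b) y := (hA a b).differentiableAt (by simp)

theorem SmoothEntriesAt.add (hA : SmoothEntriesAt A y) (hB : SmoothEntriesAt B y) :
    SmoothEntriesAt (fun z => A z + B z) y := fun a b => (hA a b).add (hB a b)

theorem SmoothEntriesAt.sub (hA : SmoothEntriesAt A y) (hB : SmoothEntriesAt B y) :
    SmoothEntriesAt (fun z => A z - B z) y := fun a b => (hA a b).sub (hB a b)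

theorem SmoothEntriesAt.mul (hA : SmoothEntriesAt A y) (hB : SmoothEntriesAt B y) :
    SmoothEntriesAt (fun z => A z * B z) y := fun a b => by
  simp only [Matrix.mul_apply]
  exact ContDiffAt.sum fun c _ => (hA a c).mul (hB c b)

theorem SmoothEntriesAt.transpose (hA : SmoothEntriesAt A y) :
    SmoothEntriesAt (fun z => (A z).transpose) y := fun a b => hA b a

theorem SmoothEntriesAt.pdMat (i : Fin n) (hA : SmoothEntriesAt A y) :
    SmoothEntriesAt (pdMat i A) y := fun a b => (hA a b).pd i

theorem smoothEntriesAt_const (C : Matrix (Fin n) (Fin n) ℝ) :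
    SmoothEntriesAt (fun _ => C) y := fun _ _ => contDiffAt_const

theorem contDiffAt_det (hA : SmoothEntriesAt A y) : ContDiffAt ℝ ∞ (fun z => (A z).det) y := by
  simp only [Matrix.det_apply]
  exact ContDiffAt.sum fun σ _ => (contDiffAt_prod fun i _ => hA (σ i) i).const_smul _

/-- Cramer's rule: the entries are quotients of polynomials in the entries of the matrix. -/
theorem SmoothEntriesAt.inv (hA : SmoothEntriesAt A y) (h : IsUnit (A y).det) :
    SmoothEntriesAt (fun z => (A z)⁻¹) y := by
  intro a b
  simp only [Matrix.inv_def, Ring.inverse_eq_inv', Matrix.smul_apply, smul_eq_mul]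
  refine ((contDiffAt_det hA).inv h.ne_zero).mul ?_
  simp only [Matrix.adjugate_apply]
  refine contDiffAt_det fun c d => ?_
  -- An adjugate entry is the determinant with row `b` replaced by a constant basis vector.
  by_cases hc : c = b
  · subst hc; simp only [Matrix.updateRow_self]; exact contDiffAt_const
  · simp only [Matrix.updateRow_ne hc]; exact hA c d

theorem pdMat_add (i : Fin n) (hA : SmoothEntriesAt A y) (hB : SmoothEntriesAt B y) :
    pdMat i (fun z => A z + B z) y = pdMat i A y + pdMat i B y := by
  ext a b
  exact pd_add i (hA.diff a b) (hB.diff a b)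

theorem pdMat_sub (i : Fin n) (hA : SmoothEntriesAt A y) (hB : SmoothEntriesAt B y) :
    pdMat i (fun z => A z - B z) y = pdMat i A y - pdMat i B y := by
  ext a b
  exact pd_sub i (hA.diff a b) (hB.diff a b)

theorem pdMat_mul (i : Fin n) (hA : SmoothEntriesAt A y) (hB : SmoothEntriesAt B y) :
    pdMat i (fun z => A z * B z) y = pdMat i A y * B y + A y * pdMat i B y := by
  ext a b
  simp only [pdMat, Matrix.mul_apply, Matrix.of_apply, Matrix.add_apply]
  refine (pd_sum _ _ fun c _ => (hA.diff a c).fun_mul (hB.diff c b)).trans ?_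
  rw [← Finset.sum_add_distrib]
  exact Finset.sum_congr rfl fun c _ => pd_mul i (hA.diff a c) (hB.diff c b)

theorem pdMat_transpose (i : Fin n) :
    pdMat i (fun z => (A z).transpose) y = (pdMat i A y).transpose := rfl

theorem pdMat_comm (i j : Fin n) (hA : SmoothEntriesAt A y) :
    pdMat i (pdMat j A) y = pdMat j (pdMat i A) y := by
  ext a b
  exact pd_comm i j (hA a b)

theorem pdMat_congr (i : Fin n) (h : A =ᶠ[𝓝 y] B) : pdMat i A y = pdMat i B y := by
  ext a b
  exact pd_congr i (h.mono fun z hz => congrFun (congrFun hz a) b)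

theorem pdMat_const (i : Fin n) (C : Matrix (Fin n) (Fin n) ℝ) : pdMat i (fun _ => C) y = 0 := by
  ext a b
  exact pd_const i _

end MatrixFields

/-! ### Covariant derivatives in components -/

section CovDeriv

variable {n : ℕ} (G : MetricComp n) (y : Coord n)

theorem covDeriv_one (A : Tensor n 1) (h a : Fin n) :
    covDeriv G A y ![h, a] = pd h (fun z => A z ![a]) y
      - ∑ m, christoffel G m h a y * A y ![m] := by
  have h1 : Fin.tail ![h, a] = ![a] := rfl
  have u : ∀ m, Function.update ![a] 0 m = ![m] := fun m => by
    ext i; fin_cases i; simp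
  simp [covDeriv, h1, u]

theorem covDeriv_two (A : Tensor n 2) (h a b : Fin n) :
    covDeriv G A y ![h, a, b] = pd h (fun z => A z ![a, b]) y
      - ∑ m, christoffel G m h a y * A y ![m, b]
      - ∑ m, christoffel G m h b y * A y ![a, m] := by
  have h1 : Fin.tail ![h, a, b] = ![a, b] := rfl
  have u0 : ∀ m, Function.update ![a, b] 0 m = ![m, b] := fun m => by
    funext i; fin_cases i <;> rfl
  have u1 : ∀ m, Function.update ![a, b] 1 m = ![a, m] := fun m => by
    funext i; fin_cases i <;> rfl
  simp [covDeriv, h1, u0, u1, Fin.sum_univ_succ]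
  ring

theorem covDeriv_three (A : Tensor n 3) (h a b c : Fin n) :
    covDeriv G A y ![h, a, b, c] = pd h (fun z => A z ![a, b, c]) y
      - ∑ m, christoffel G m h a y * A y ![m, b, c]
      - ∑ m, christoffel G m h b y * A y ![a, m, c]
      - ∑ m, christoffel G m h c y * A y ![a, b, m] := by
  have h1 : Fin.tail ![h, a, b, c] = ![a, b, c] := rfl
  have u0 : ∀ m, Function.update ![a, b, c] 0 m = ![m, b, c] := fun m => by
    funext i; fin_cases i <;> rfl
  have u1 : ∀ m, Function.update ![a, b, c] 1 m = ![a, m, c] := fun m => by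
    funext i; fin_cases i <;> rfl
  have u2 : ∀ m, Function.update ![a, b, c] 2 m = ![a, b, m] := fun m => by
    funext i; fin_cases i <;> rfl
  simp only [covDeriv, h1, Fin.sum_univ_three, u0, u1, u2]
  simp
  ring

theorem covDeriv_four (A : Tensor n 4) (h a b c d : Fin n) :
    covDeriv G A y ![h, a, b, c, d] = pd h (fun z => A z ![a, b, c, d]) y
      - ∑ m, christoffel G m h a y * A y ![m, b, c, d]
      - ∑ m, christoffel G m h b y * A y ![a, m, c, d]
      - ∑ m, christoffel G m h c y * A y ![a, b, m, d]
      - ∑ m, christoffel G m h d y * A y ![a, b, c, m] := by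
  have h1 : Fin.tail ![h, a, b, c, d] = ![a, b, c, d] := rfl
  have u0 : ∀ m, Function.update ![a, b, c, d] 0 m = ![m, b, c, d] := fun m => by
    funext i; fin_cases i <;> rfl
  have u1 : ∀ m, Function.update ![a, b, c, d] 1 m = ![a, m, c, d] := fun m => by
    funext i; fin_cases i <;> rfl
  have u2 : ∀ m, Function.update ![a, b, c, d] 2 m = ![a, b, m, d] := fun m => by
    funext i; fin_cases i <;> rfl
  have u3 : ∀ m, Function.update ![a, b, c, d] 3 m = ![a, b, c, m] := fun m => by
    funext i; fin_cases i <;> rfl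
  simp only [covDeriv, h1, Fin.sum_univ_four, u0, u1, u2, u3]
  simp
  ring

theorem divergence_three_four (A : Tensor n 4) (i j k : Fin n) :
    divergence G 3 A y ![i, j, k] = ∑ a, ∑ b, inv G y a b * covDeriv G A y ![a, i, j, k, b] := by
  have u : ∀ a b : Fin n, (Fin.cons a (Fin.insertNth (α := fun _ => Fin n) 3 b ![i, j, k]) :
      Fin 5 → Fin n) = ![a, i, j, k, b] := fun a b => by
    funext r; fin_cases r <;> rfl
  simp only [divergence, u]

theorem divergence_zero_three (A : Tensor n 3) (i j : Fin n) :
    divergence G 0 A y ![i, j] = ∑ a, ∑ b, inv G y a b * covDeriv G A y ![a, b, i, j] := by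
  have u : ∀ a b : Fin n, (Fin.cons a (Fin.insertNth (α := fun _ => Fin n) 0 b ![i, j]) :
      Fin 4 → Fin n) = ![a, b, i, j] := fun a b => by
    funext r; fin_cases r <;> rfl
  simp only [divergence, u]

theorem covDeriv_congr {s : ℕ} {A B : Tensor n s} {y : Coord n} (h : A =ᶠ[𝓝 y] B) :
    covDeriv G A y = covDeriv G B y := by
  funext J
  simp only [covDeriv, h.eq_of_nhds]
  rw [pd_congr _ (h.mono fun z hz => by rw [hz])]

theorem divergence_congr {s : ℕ} {A B : Tensor n (s + 1)} {y : Coord n} (r : Fin (s + 1))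
    (h : A =ᶠ[𝓝 y] B) : divergence G r A y = divergence G r B y := by
  funext J
  simp only [divergence, covDeriv_congr G h]

theorem eta_two (J : Fin 2 → Fin n) : J = ![J 0, J 1] := by
  funext i; fin_cases i <;> rfl

theorem eta_three (J : Fin 3 → Fin n) : J = ![J 0, J 1, J 2] := by
  funext i; fin_cases i <;> rfl

end CovDeriv

/-! ### The Levi-Civita connection -/

section Connection

variable {n : ℕ}

/-- `G` is on the open set `Ω` the matrix of components of a smooth Riemannian metric. -/
structure SmoothMetricOn (G : MetricComp n) (Ω : Set (Coord n)) : Prop where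
  isOpen : IsOpen Ω
  smooth : ∀ y ∈ Ω, SmoothEntriesAt G y
  posDef : ∀ y ∈ Ω, (G y).PosDef

variable {G : MetricComp n} {Ω : Set (Coord n)} {y : Coord n}

namespace SmoothMetricOn

theorem mem_nhds (hG : SmoothMetricOn G Ω) (hy : y ∈ Ω) : Ω ∈ 𝓝 y := hG.isOpen.mem_nhds hy

theorem transpose (hG : SmoothMetricOn G Ω) (hy : y ∈ Ω) : (G y).transpose = G y := by
  have := (hG.posDef y hy).isHermitian
  rwa [Matrix.IsHermitian, Matrix.conjTranspose_eq_transpose_of_trivial] at this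

theorem symm (hG : SmoothMetricOn G Ω) (hy : y ∈ Ω) (a b : Fin n) : G y a b = G y b a :=
  congrFun (congrFun (hG.transpose hy) b) a

theorem isUnit_det (hG : SmoothMetricOn G Ω) (hy : y ∈ Ω) : IsUnit (G y).det :=
  (hG.posDef y hy).det_pos.ne'.isUnit

theorem mul_inv (hG : SmoothMetricOn G Ω) (hy : y ∈ Ω) : G y * inv G y = 1 :=
  Matrix.mul_nonsing_inv _ (hG.isUnit_det hy)

theorem inv_mul (hG : SmoothMetricOn G Ω) (hy : y ∈ Ω) : inv G y * G y = 1 :=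
  Matrix.nonsing_inv_mul _ (hG.isUnit_det hy)

theorem inv_posDef (hG : SmoothMetricOn G Ω) (hy : y ∈ Ω) : (inv G y).PosDef :=
  (hG.posDef y hy).inv

theorem inv_transpose (hG : SmoothMetricOn G Ω) (hy : y ∈ Ω) :
    (inv G y).transpose = inv G y := by
  rw [inv, Matrix.transpose_nonsing_inv, hG.transpose hy]

theorem inv_symm (hG : SmoothMetricOn G Ω) (hy : y ∈ Ω) (a b : Fin n) :
    inv G y a b = inv G y b a :=
  congrFun (congrFun (hG.inv_transpose hy) b) a

theorem smooth_inv (hG : SmoothMetricOn G Ω) (hy : y ∈ Ω) : SmoothEntriesAt (inv G) y :=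
  (hG.smooth y hy).inv (hG.isUnit_det hy)

theorem smooth_christoffel (hG : SmoothMetricOn G Ω) (hy : y ∈ Ω) (k i j : Fin n) :
    ContDiffAt ℝ ∞ (christoffel G k i j) y := by
  have hs := hG.smooth y hy
  exact contDiffAt_const.mul (ContDiffAt.sum fun l _ => (hG.smooth_inv hy k l).mul
    ((((hs j l).pd i).add ((hs i l).pd j)).sub ((hs i j).pd l)))

end SmoothMetricOn

/-- The matrix of the Christoffel symbols `christoffel G m i k` with row `m` and column `k`. -/
def connMat (G : MetricComp n) (i : Fin n) (y : Coord n) : Matrix (Fin n) (Fin n) ℝ :=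
  Matrix.of fun m k => christoffel G m i k y

theorem connMat_apply (i m k : Fin n) : connMat G i y m k = christoffel G m i k y := rfl

namespace SmoothMetricOn

theorem smooth_connMat (hG : SmoothMetricOn G Ω) (hy : y ∈ Ω) (i : Fin n) :
    SmoothEntriesAt (connMat G i) y := fun m k => hG.smooth_christoffel hy m i k

theorem christoffel_symm (hG : SmoothMetricOn G Ω) (hy : y ∈ Ω) (k i j : Fin n) :
    christoffel G k i j y = christoffel G k j i y := by
  have h : ∀ l, pd l (fun z => G z i j) y = pd l (fun z => G z j i) y := fun l =>
    pd_congr l (Filter.eventually_of_mem (hG.mem_nhds hy) fun z hz => hG.symm hz i j)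
  simp only [christoffel]
  congr 1
  refine Finset.sum_congr rfl fun l _ => ?_
  rw [h l]; ring

/-- Lowering the index removes the inverse metric and leaves the Christoffel symbols of the first
kind. -/
theorem mul_connMat (hG : SmoothMetricOn G Ω) (hy : y ∈ Ω) (i p j : Fin n) :
    (G y * connMat G i y) p j = 1 / 2 * (pd i (fun z => G z j p) y +
      pd j (fun z => G z i p) y - pd p (fun z => G z i j) y) := by
  set v : Fin n → ℝ := fun l => pd i (fun z => G z j l) y + pd j (fun z => G z i l) y -
    pd l (fun z => G z i j) y with hv
  have h1 : (G y * connMat G i y) p j = (1 / 2 : ℝ) * (G y).mulVec ((inv G y).mulVec v) p := by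
    simp only [Matrix.mul_apply, connMat_apply, christoffel, Matrix.mulVec, dotProduct,
      Finset.mul_sum]
    refine Finset.sum_congr rfl fun k _ => Finset.sum_congr rfl fun l _ => ?_
    simp only [hv]; ring
  rw [h1, Matrix.mulVec_mulVec, hG.mul_inv hy, Matrix.one_mulVec]

/-- Metric compatibility `∇g = 0` in matrix form: in the sum of two Christoffel symbols of the first
kind all but one derivative cancel. -/
theorem pdMat_metric (hG : SmoothMetricOn G Ω) (hy : y ∈ Ω) (i : Fin n) :
    pdMat i G y = (connMat G i y).transpose * G y + G y * connMat G i y := by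
  have e : (connMat G i y).transpose * G y = (G y * connMat G i y).transpose := by
    rw [Matrix.transpose_mul, hG.transpose hy]
  have h : ∀ l a b, pd l (fun z => G z a b) y = pd l (fun z => G z b a) y := fun l a b =>
    pd_congr l (Filter.eventually_of_mem (hG.mem_nhds hy) fun z hz => hG.symm hz a b)
  ext a b
  rw [e, Matrix.add_apply, Matrix.transpose_apply, hG.mul_connMat hy, hG.mul_connMat hy,
    h b i a, h a i b, h i b a]
  simp only [pdMat, Matrix.of_apply]
  ring

/-- Obtained by differentiating `g⁻¹ g = 1`; it says that the inverse metric is parallel too. -/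
theorem pdMat_inv (hG : SmoothMetricOn G Ω) (hy : y ∈ Ω) (i : Fin n) :
    pdMat i (inv G) y =
      -(connMat G i y * inv G y) - inv G y * (connMat G i y).transpose := by
  have h0 : pdMat i (fun z => inv G z * G z) y = 0 := by
    rw [pdMat_congr i (B := fun _ => 1)
      (Filter.eventually_of_mem (hG.mem_nhds hy) fun z hz => hG.inv_mul hz), pdMat_const]
  rw [pdMat_mul i (hG.smooth_inv hy) (hG.smooth y hy), hG.pdMat_metric hy] at h0
  have h1 : (pdMat i (inv G) y * G y + inv G y * ((connMat G i y).transpose * G y +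
      G y * connMat G i y)) * inv G y = 0 := by rw [h0, zero_mul]
  have h2 : pdMat i (inv G) y * (G y * inv G y)
      + inv G y * (connMat G i y).transpose * (G y * inv G y)
      + (inv G y * G y) * connMat G i y * inv G y = 0 := by
    rw [← h1]; noncomm_ring
  rw [hG.mul_inv hy, hG.inv_mul hy, mul_one, mul_one, one_mul] at h2
  rw [eq_sub_iff_add_eq, eq_neg_iff_add_eq_zero, h2]

end SmoothMetricOn

/-- The curvature endomorphism `R(∂ᵢ, ∂ⱼ)`. -/
def curvMat (G : MetricComp n) (i j : Fin n) (y : Coord n) : Matrix (Fin n) (Fin n) ℝ :=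
  pdMat i (connMat G j) y - pdMat j (connMat G i) y +
    (connMat G i y * connMat G j y - connMat G j y * connMat G i y)

namespace SmoothMetricOn

theorem smooth_curvMat (hG : SmoothMetricOn G Ω) (hy : y ∈ Ω) (i j : Fin n) :
    SmoothEntriesAt (curvMat G i j) y := by
  have hs := hG.smooth_connMat hy
  exact (((hs j).pdMat i).sub ((hs i).pdMat j)).add (((hs i).mul (hs j)).sub ((hs j).mul (hs i)))

theorem riemann_eq (hG : SmoothMetricOn G Ω) (hy : y ∈ Ω) (i j k l : Fin n) :
    riemann G y ![i, j, k, l] = (G y * curvMat G i j y) l k := by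
  simp only [riemann, Matrix.mul_apply, curvMat, Matrix.add_apply, Matrix.sub_apply, connMat_apply]
  refine Finset.sum_congr rfl fun m _ => ?_
  rw [hG.symm hy l m, ← Finset.sum_sub_distrib]
  rfl

theorem riemann_swap (i j k l : Fin n) :
    riemann G y ![j, i, k, l] = -riemann G y ![i, j, k, l] := by
  simp only [riemann, ← Finset.sum_neg_distrib]
  refine Finset.sum_congr rfl fun m _ => ?_
  simp only [Finset.sum_sub_distrib]
  simp
  ring

/-- Differentiating `∇g = 0` once more expresses the second partials of `g` through the connection;
their symmetry is the skewness of the curvature endomorphism. -/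
theorem curvMat_antisymm (hG : SmoothMetricOn G Ω) (hy : y ∈ Ω) (i j : Fin n) :
    (curvMat G i j y).transpose * G y + G y * curvMat G i j y = 0 := by
  have key : ∀ a b, pdMat a (pdMat b G) y =
      (pdMat a (connMat G b) y).transpose * G y
      + (connMat G b y).transpose * ((connMat G a y).transpose * G y + G y * connMat G a y)
      + (((connMat G a y).transpose * G y + G y * connMat G a y) * connMat G b y
      + G y * pdMat a (connMat G b) y) := by
    intro a b
    have hs := hG.smooth_connMat hy b
    have hg := hG.smooth y hy
    rw [pdMat_congr a (Filter.eventually_of_mem (hG.mem_nhds hy) fun z hz => hG.pdMat_metric hz b),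
      pdMat_add a (hs.transpose.mul hg) (hg.mul hs), pdMat_mul a hs.transpose hg,
      pdMat_mul a hg hs, hG.pdMat_metric hy a, pdMat_transpose]
  have h := pdMat_comm i j (hG.smooth y hy)
  rw [key, key, ← sub_eq_zero] at h
  rw [← h]
  simp only [curvMat, Matrix.transpose_add, Matrix.transpose_sub, Matrix.transpose_mul]
  noncomm_ring

theorem riemann_swap' (hG : SmoothMetricOn G Ω) (hy : y ∈ Ω) (i j k l : Fin n) :
    riemann G y ![i, j, l, k] = -riemann G y ![i, j, k, l] := by
  rw [hG.riemann_eq hy, hG.riemann_eq hy]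
  have h := congrFun (congrFun (hG.curvMat_antisymm hy i j) k) l
  have e : (curvMat G i j y).transpose * G y = (G y * curvMat G i j y).transpose := by
    rw [Matrix.transpose_mul, hG.transpose hy]
  rw [e, Matrix.add_apply, Matrix.transpose_apply, Matrix.zero_apply] at h
  linarith

/-- First Bianchi identity; only the symmetry of the Christoffel symbols in their lower indices is
used. -/
theorem curvMat_cyclic (hG : SmoothMetricOn G Ω) (hy : y ∈ Ω) (i j k m : Fin n) :
    curvMat G i j y m k + curvMat G j k y m i + curvMat G k i y m j = 0 := by
  have h1 : ∀ a b c, pdMat a (connMat G b) y m c = pdMat a (connMat G c) y m b := fun a b c =>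
    pd_congr a (Filter.eventually_of_mem (hG.mem_nhds hy) fun z hz => hG.christoffel_symm hz m b c)
  have h2 : ∀ a b c, (connMat G a y * connMat G b y) m c =
      (connMat G a y * connMat G c y) m b := fun a b c => by
    simp only [Matrix.mul_apply, connMat_apply]
    exact Finset.sum_congr rfl fun l _ => by rw [hG.christoffel_symm hy l b c]
  simp only [curvMat, Matrix.add_apply, Matrix.sub_apply]
  rw [h1 i j k, h1 j k i, h1 k i j, h2 i j k, h2 j k i, h2 k i j]
  ring

theorem riemann_cyclic (hG : SmoothMetricOn G Ω) (hy : y ∈ Ω) (i j k l : Fin n) :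
    riemann G y ![i, j, k, l] + riemann G y ![j, k, i, l] + riemann G y ![k, i, j, l] = 0 := by
  simp only [hG.riemann_eq hy, Matrix.mul_apply, ← Finset.sum_add_distrib, ← mul_add,
    hG.curvMat_cyclic hy, mul_zero, Finset.sum_const_zero]

/-- Second Bianchi identity for the curvature as a matrix-valued two-form. Mixed partials commute
and the remaining products cancel, so neither the metric nor the vanishing of torsion enters. -/
theorem curvMat_bianchi (hG : SmoothMetricOn G Ω) (hy : y ∈ Ω) (h i j : Fin n) :
    (pdMat h (curvMat G i j) y + connMat G h y * curvMat G i j y - curvMat G i j y * connMat G h y)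
    + (pdMat i (curvMat G j h) y + connMat G i y * curvMat G j h y
      - curvMat G j h y * connMat G i y)
    + (pdMat j (curvMat G h i) y + connMat G j y * curvMat G h i y
      - curvMat G h i y * connMat G j y) = 0 := by
  have hs := hG.smooth_connMat hy
  have key : ∀ a b c, pdMat a (curvMat G b c) y =
      pdMat a (pdMat b (connMat G c)) y - pdMat a (pdMat c (connMat G b)) y
      + (pdMat a (connMat G b) y * connMat G c y + connMat G b y * pdMat a (connMat G c) y
      - (pdMat a (connMat G c) y * connMat G b y + connMat G c y * pdMat a (connMat G b) y)) := by
    intro a b c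
    rw [← pdMat_mul a (hs b) (hs c), ← pdMat_mul a (hs c) (hs b),
      ← pdMat_sub a ((hs b).mul (hs c)) ((hs c).mul (hs b)),
      ← pdMat_sub a ((hs c).pdMat b) ((hs b).pdMat c), ← pdMat_add a
        (((hs c).pdMat b).sub ((hs b).pdMat c)) (((hs b).mul (hs c)).sub ((hs c).mul (hs b)))]
    rfl
  rw [key, key, key, pdMat_comm i h (hs j), pdMat_comm j i (hs h), pdMat_comm j h (hs i)]
  simp only [curvMat]
  noncomm_ring

theorem smooth_riemann (hG : SmoothMetricOn G Ω) (hy : y ∈ Ω) (i j k l : Fin n) :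
    ContDiffAt ℝ ∞ (fun z => riemann G z ![i, j, k, l]) y :=
  (((hG.smooth y hy).mul (hG.smooth_curvMat hy i j)) l k).congr_of_eventuallyEq
    (Filter.eventually_of_mem (hG.mem_nhds hy) fun _ hz => hG.riemann_eq hz i j k l)

/-- The Christoffel terms of the last two slots combine with the derivative of the metric into a
commutator; those of the first two slots remain. -/
theorem covDeriv_riemann (hG : SmoothMetricOn G Ω) (hy : y ∈ Ω) (h i j k l : Fin n) :
    covDeriv G (riemann G) y ![h, i, j, k, l] =
      (G y * (pdMat h (curvMat G i j) y + connMat G h y * curvMat G i j y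
        - curvMat G i j y * connMat G h y)) l k
      - ∑ m, christoffel G m h i y * riemann G y ![m, j, k, l]
      - ∑ m, christoffel G m h j y * riemann G y ![i, m, k, l] := by
  have e1 : pd h (fun z => riemann G z ![i, j, k, l]) y =
      pdMat h (fun z => G z * curvMat G i j z) y l k :=
    pd_congr h (Filter.eventually_of_mem (hG.mem_nhds hy) fun z hz => hG.riemann_eq hz i j k l)
  have e2 : ∑ m, christoffel G m h k y * riemann G y ![i, j, m, l] =
      (G y * (curvMat G i j y * connMat G h y)) l k := by
    rw [← mul_assoc, Matrix.mul_apply]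
    exact Finset.sum_congr rfl fun m _ => by rw [hG.riemann_eq hy, connMat_apply, mul_comm]
  have e3 : ∑ m, christoffel G m h l y * riemann G y ![i, j, k, m] =
      ((connMat G h y).transpose * (G y * curvMat G i j y)) l k := by
    rw [Matrix.mul_apply]
    exact Finset.sum_congr rfl fun m _ => by rw [hG.riemann_eq hy]; rfl
  rw [covDeriv_four, e1, e2, e3, pdMat_mul h (hG.smooth y hy) (hG.smooth_curvMat hy i j),
    hG.pdMat_metric hy]
  simp only [Matrix.add_mul, Matrix.mul_add, Matrix.mul_sub, Matrix.add_apply, Matrix.sub_apply,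
    mul_assoc]
  ring

/-- The matrix identity handles the commutator parts. The leftover Christoffel terms cancel in pairs
in the cyclic sum, as the connection is torsion-free and `R` is skew in its first two slots. -/
theorem riemann_bianchi (hG : SmoothMetricOn G Ω) (hy : y ∈ Ω) (h i j k l : Fin n) :
    covDeriv G (riemann G) y ![h, i, j, k, l] + covDeriv G (riemann G) y ![i, j, h, k, l]
      + covDeriv G (riemann G) y ![j, h, i, k, l] = 0 := by
  have b0 := hG.curvMat_bianchi hy h i j
  set X := pdMat h (curvMat G i j) y + connMat G h y * curvMat G i j y
    - curvMat G i j y * connMat G h y with hX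
  set Y := pdMat i (curvMat G j h) y + connMat G i y * curvMat G j h y
    - curvMat G j h y * connMat G i y with hY
  set Z := pdMat j (curvMat G h i) y + connMat G j y * curvMat G h i y
    - curvMat G h i y * connMat G j y with hZ
  have b : (G y * X) l k + (G y * Y) l k + (G y * Z) l k = 0 := by
    rw [← Matrix.add_apply, ← Matrix.add_apply, ← Matrix.mul_add, ← Matrix.mul_add, b0, mul_zero,
      Matrix.zero_apply]
  have c : ∀ a b p : Fin n, ∑ m, christoffel G m a b y * riemann G y ![p, m, k, l] =
      -∑ m, christoffel G m b a y * riemann G y ![m, p, k, l] := fun a b p => by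
    rw [← Finset.sum_neg_distrib]
    refine Finset.sum_congr rfl fun m _ => ?_
    rw [hG.christoffel_symm hy m a b, riemann_swap m p]; ring
  rw [hG.covDeriv_riemann hy, hG.covDeriv_riemann hy, hG.covDeriv_riemann hy,
    c h j i, c i h j, c j i h]
  linarith

end SmoothMetricOn

end Connection

/-! ### Algebraic curvature tensors -/

section Algebra

variable {n : ℕ}

/-- The symmetries of a curvature tensor at a point. -/
structure IsCurvatureLike (C : Fin n → Fin n → Fin n → Fin n → ℝ) : Prop where
  swap_left : ∀ i j k l, C j i k l = -C i j k l
  swap_right : ∀ i j k l, C i j l k = -C i j k l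
  cyclic : ∀ i j k l, C i j k l + C j k i l + C k i j l = 0

namespace IsCurvatureLike

variable {C D : Fin n → Fin n → Fin n → Fin n → ℝ}

/-- The classical octahedron argument: four cyclic identities combined with the two skew symmetries.
-/
theorem pair_symm (hC : IsCurvatureLike C) (i j k l : Fin n) : C k l i j = C i j k l := by
  have h1 := hC.cyclic i j k l
  have h2 := hC.cyclic j k l i
  have h3 := hC.cyclic k l i j
  have h4 := hC.cyclic l i j k
  have a := hC.swap_left
  have b := hC.swap_right
  linarith [a i j k l, a j k i l, a k i j l, a k l i j, a i l k j, a l j k i, a j l i k, b i j k l,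
    b j k i l, b k i j l, b k l i j, b j k l i, b l j k i, b i l k j, b l i j k, b i j l k,
    b i l j k, b k i l j, a i k l j, a l i j k, b j l i k, a j l k i, b j l k i, b l j i k]

theorem reverse (hC : IsCurvatureLike C) (i j k l : Fin n) : C l k j i = C i j k l := by
  rw [hC.pair_symm j i, hC.swap_left, hC.swap_right, neg_neg]

theorem sub (hC : IsCurvatureLike C) (hD : IsCurvatureLike D) :
    IsCurvatureLike fun i j k l => C i j k l - D i j k l where
  swap_left i j k l := by rw [hC.swap_left, hD.swap_left]; ring
  swap_right i j k l := by rw [hC.swap_right, hD.swap_right]; ring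
  cyclic i j k l := by linarith [hC.cyclic i j k l, hD.cyclic i j k l]

end IsCurvatureLike

/-- The components of the Kulkarni-Nomizu product at a point. -/
def knProd (g b : Fin n → Fin n → ℝ) (i j k l : Fin n) : ℝ :=
  g i l * b j k + g j k * b i l - g i k * b j l - g j l * b i k

theorem isCurvatureLike_knProd {g b : Fin n → Fin n → ℝ} (hg : ∀ i j, g i j = g j i)
    (hb : ∀ i j, b i j = b j i) : IsCurvatureLike (knProd g b) where
  swap_left i j k l := by simp only [knProd]; ring
  swap_right i j k l := by simp only [knProd]; ring
  cyclic i j k l := by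
    simp only [knProd]
    rw [hg k j, hg k i, hg j i, hb k j, hb k i, hb j i]; ring

theorem sum_inv_metric_left {g H : Matrix (Fin n) (Fin n) ℝ} (h : H * g = 1)
    (hH : ∀ i j, H i j = H j i) (f : Fin n → ℝ) (k : Fin n) :
    ∑ i, ∑ l, H i l * (g i k * f l) = f k := by
  have : ∀ l, ∑ i, H i l * (g i k * f l) = (1 : Matrix (Fin n) (Fin n) ℝ) l k * f l := fun l => by
    rw [← h, Matrix.mul_apply, Finset.sum_mul]
    exact Finset.sum_congr rfl fun i _ => by rw [hH i l, mul_assoc]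
  rw [Finset.sum_comm]
  simp [this, Matrix.one_apply]

theorem sum_inv_metric_right {g H : Matrix (Fin n) (Fin n) ℝ} (h : H * g = 1)
    (hH : ∀ i j, H i j = H j i) (f : Fin n → ℝ) (k : Fin n) :
    ∑ i, ∑ l, H i l * (g l k * f i) = f k := by
  rw [Finset.sum_comm, ← sum_inv_metric_left h hH f k]
  exact Finset.sum_congr rfl fun i _ => Finset.sum_congr rfl fun l _ => by rw [hH i l]

theorem sum_inv_metric_self {g H : Matrix (Fin n) (Fin n) ℝ} (h : H * g = 1)
    (hg : ∀ i j, g i j = g j i) : ∑ i, ∑ l, H i l * g i l = n := by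
  have : ∀ i, ∑ l, H i l * g i l = (1 : Matrix (Fin n) (Fin n) ℝ) i i := fun i => by
    rw [← h, Matrix.mul_apply]
    exact Finset.sum_congr rfl fun l _ => by rw [hg i l]
  simp [this]

/-- This trace dictates the normalisation of the Schouten tensor: with it, `g ⊙ 𝔨` has the same
Ricci trace as `R`. -/
theorem trace_knProd {g H b : Matrix (Fin n) (Fin n) ℝ} (h : H * g = 1)
    (hH : ∀ i j, H i j = H j i) (hg : ∀ i j, g i j = g j i) (j k : Fin n) :
    ∑ i, ∑ l, H i l * knProd g b i j k l =
      ((n : ℝ) - 2) * b j k + (∑ i, ∑ l, H i l * b i l) * g j k := by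
  have e : ∀ i l, H i l * knProd g b i j k l = H i l * g i l * b j k + g j k * (H i l * b i l)
      - H i l * (g i k * b j l) - H i l * (g l j * b i k) := fun i l => by
    simp only [knProd]; rw [hg j l]; ring
  simp only [e, Finset.sum_add_distrib, Finset.sum_sub_distrib, ← Finset.mul_sum, ← Finset.sum_mul]
  rw [sum_inv_metric_left h hH (fun l => b j l), sum_inv_metric_right h hH (fun i => b i k),
    sum_inv_metric_self h hg]
  ring

end Algebra

/-! ### The Weyl tensor -/

section Weyl

variable {n : ℕ} {G : MetricComp n} {Ω : Set (Coord n)} {y : Coord n}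

theorem weyl_apply (i j k l : Fin n) : weyl G y ![i, j, k, l] =
    riemann G y ![i, j, k, l] - knProd (G y) (fun a b => schouten G y ![a, b]) i j k l := rfl

theorem schouten_apply (i j : Fin n) : schouten G y ![i, j] =
    1 / ((n : ℝ) - 2) * (ricci G y ![i, j] - scalar G y / (2 * ((n : ℝ) - 1)) * G y i j) := rfl

theorem ricci_apply (i j : Fin n) : ricci G y ![i, j] =
    ∑ a, ∑ b, inv G y a b * riemann G y ![a, i, j, b] := rfl

namespace SmoothMetricOn

theorem isCurvatureLike_riemann (hG : SmoothMetricOn G Ω) (hy : y ∈ Ω) :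
    IsCurvatureLike fun i j k l => riemann G y ![i, j, k, l] where
  swap_left := riemann_swap
  swap_right := hG.riemann_swap' hy
  cyclic := hG.riemann_cyclic hy

theorem ricci_symm (hG : SmoothMetricOn G Ω) (hy : y ∈ Ω) (i j : Fin n) :
    ricci G y ![i, j] = ricci G y ![j, i] := by
  rw [ricci_apply, ricci_apply, Finset.sum_comm]
  refine Finset.sum_congr rfl fun a _ => Finset.sum_congr rfl fun b _ => ?_
  rw [hG.inv_symm hy b a, (hG.isCurvatureLike_riemann hy).reverse a j i b]

theorem schouten_symm (hG : SmoothMetricOn G Ω) (hy : y ∈ Ω) (i j : Fin n) :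
    schouten G y ![i, j] = schouten G y ![j, i] := by
  rw [schouten_apply, schouten_apply, hG.ricci_symm hy, hG.symm hy]

theorem isCurvatureLike_weyl (hG : SmoothMetricOn G Ω) (hy : y ∈ Ω) :
    IsCurvatureLike fun i j k l => weyl G y ![i, j, k, l] :=
  (hG.isCurvatureLike_riemann hy).sub
    (isCurvatureLike_knProd (hG.symm hy) (hG.schouten_symm hy))

theorem trace_schouten (hn : 4 ≤ n) (hG : SmoothMetricOn G Ω) (hy : y ∈ Ω) :
    ∑ i, ∑ l, inv G y i l * schouten G y ![i, l] = scalar G y / (2 * ((n : ℝ) - 1)) := by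
  have hn' : (4 : ℝ) ≤ n := by exact_mod_cast hn
  have e : ∀ i l, inv G y i l * schouten G y ![i, l] = 1 / ((n : ℝ) - 2) *
      (inv G y i l * ricci G y ![i, l]
        - scalar G y / (2 * ((n : ℝ) - 1)) * (inv G y i l * G y i l)) :=
    fun i l => by rw [schouten_apply]; ring
  simp only [e, ← Finset.mul_sum, Finset.sum_sub_distrib]
  rw [sum_inv_metric_self (hG.inv_mul hy) (hG.symm hy)]
  have : ∑ i, ∑ l, inv G y i l * ricci G y ![i, l] = scalar G y := rfl
  rw [this]
  have h1 : (n : ℝ) - 2 ≠ 0 := by linarith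
  have h2 : (n : ℝ) - 1 ≠ 0 := by linarith
  field_simp
  ring

theorem trace_weyl (hn : 4 ≤ n) (hG : SmoothMetricOn G Ω) (hy : y ∈ Ω) (j k : Fin n) :
    ∑ i, ∑ l, inv G y i l * weyl G y ![i, j, k, l] = 0 := by
  have hn' : (4 : ℝ) ≤ n := by exact_mod_cast hn
  simp only [weyl_apply, mul_sub, Finset.sum_sub_distrib]
  rw [trace_knProd (b := fun a b => schouten G y ![a, b]) (hG.inv_mul hy) (hG.inv_symm hy)
    (hG.symm hy), hG.trace_schouten hn hy,
    ← ricci_apply, schouten_apply]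
  have h1 : (n : ℝ) - 2 ≠ 0 := by linarith
  field_simp
  ring

/-! ### Smoothness, covariant derivative and traces of the Weyl tensor. -/

theorem smooth_ricci (hG : SmoothMetricOn G Ω) (hy : y ∈ Ω) (i j : Fin n) :
    ContDiffAt ℝ ∞ (fun z => ricci G z ![i, j]) y :=
  ContDiffAt.sum fun a _ => ContDiffAt.sum fun b _ =>
    (hG.smooth_inv hy a b).mul (hG.smooth_riemann hy a i j b)

theorem smooth_scalar (hG : SmoothMetricOn G Ω) (hy : y ∈ Ω) : ContDiffAt ℝ ∞ (scalar G) y := by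
  change ContDiffAt ℝ ∞ (fun z => ∑ i, ∑ j, inv G z i j * ricci G z ![i, j]) y
  exact
  ContDiffAt.sum fun a _ => ContDiffAt.sum fun b _ =>
    (hG.smooth_inv hy a b).mul (hG.smooth_ricci hy a b)

theorem smooth_schouten (hG : SmoothMetricOn G Ω) (hy : y ∈ Ω) (i j : Fin n) :
    ContDiffAt ℝ ∞ (fun z => schouten G z ![i, j]) y :=
  contDiffAt_const.mul ((hG.smooth_ricci hy i j).sub
    (((hG.smooth_scalar hy).div_const _).mul (hG.smooth y hy i j)))

theorem smooth_knProd (hG : SmoothMetricOn G Ω) (hy : y ∈ Ω) (i j k l : Fin n) :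
    ContDiffAt ℝ ∞ (fun z => knProd (G z) (fun a b => schouten G z ![a, b]) i j k l) y := by
  have s := hG.smooth_schouten hy
  have g := hG.smooth y hy
  exact ((((g i l).mul (s j k)).add ((g j k).mul (s i l))).sub ((g i k).mul (s j l))).sub
    ((g j l).mul (s i k))

theorem smooth_weyl (hG : SmoothMetricOn G Ω) (hy : y ∈ Ω) (i j k l : Fin n) :
    ContDiffAt ℝ ∞ (fun z => weyl G z ![i, j, k, l]) y :=
  (hG.smooth_riemann hy i j k l).sub (hG.smooth_knProd hy i j k l)

theorem pd_metric (hG : SmoothMetricOn G Ω) (hy : y ∈ Ω) (h a b : Fin n) :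
    pd h (fun z => G z a b) y =
      ∑ m, christoffel G m h a y * G y m b + ∑ m, christoffel G m h b y * G y a m := by
  have := congrFun (congrFun (hG.pdMat_metric hy h) a) b
  simp only [Matrix.add_apply, Matrix.mul_apply, Matrix.transpose_apply, connMat_apply] at this
  refine Eq.trans this ?_
  congr 1
  exact Finset.sum_congr rfl fun m _ => mul_comm _ _

/-- Leibniz rule with `∇g = 0`: only the second factor is differentiated. -/
theorem covDeriv_knProd (hG : SmoothMetricOn G Ω) (hy : y ∈ Ω) (h i j k l : Fin n) :
    covDeriv G (kulkarniNomizu (metricTensor G) (schouten G)) y ![h, i, j, k, l] =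
      knProd (G y) (fun a b => covDeriv G (schouten G) y ![h, a, b]) i j k l := by
  set b : Fin n → Fin n → ℝ := fun a c => schouten G y ![a, c] with hb
  have s := fun a c => (hG.smooth_schouten hy a c).differentiableAt (by simp)
  have g := fun a c => (hG.smooth y hy).diff a c
  have e : pd h (fun z => kulkarniNomizu (metricTensor G) (schouten G) z ![i, j, k, l]) y =
      pd h (fun z => G z i l * schouten G z ![j, k] + G z j k * schouten G z ![i, l]
        - G z i k * schouten G z ![j, l] - G z j l * schouten G z ![i, k]) y := rfl
  have hg := hG.pd_metric hy h
  rw [covDeriv_four, e, pd_sub _ ((((g i l).fun_mul (s j k)).fun_add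
      ((g j k).fun_mul (s i l))).fun_sub ((g i k).fun_mul (s j l))) ((g j l).fun_mul (s i k)),
    pd_sub _ (((g i l).fun_mul (s j k)).fun_add
      ((g j k).fun_mul (s i l))) ((g i k).fun_mul (s j l)),
    pd_add _ ((g i l).fun_mul (s j k)) ((g j k).fun_mul (s i l)),
    pd_mul _ (g i l) (s j k), pd_mul _ (g j k) (s i l), pd_mul _ (g i k) (s j l),
    pd_mul _ (g j l) (s i k), hg, hg, hg, hg]
  have t1 : ∑ m, christoffel G m h i y * kulkarniNomizu (metricTensor G) (schouten G) y
      ![m, j, k, l] = (∑ m, christoffel G m h i y * G y m l) * b j k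
      + (∑ m, christoffel G m h i y * b m l) * G y j k
      - (∑ m, christoffel G m h i y * G y m k) * b j l
      - (∑ m, christoffel G m h i y * b m k) * G y j l := by
    simp only [Finset.sum_mul, ← Finset.sum_add_distrib, ← Finset.sum_sub_distrib]
    refine Finset.sum_congr rfl fun m _ => ?_
    simp [kulkarniNomizu, metricTensor, hb]; ring
  have t2 : ∑ m, christoffel G m h j y * kulkarniNomizu (metricTensor G) (schouten G) y
      ![i, m, k, l] = (∑ m, christoffel G m h j y * b m k) * G y i l
      + (∑ m, christoffel G m h j y * G y m k) * b i l
      - (∑ m, christoffel G m h j y * b m l) * G y i k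
      - (∑ m, christoffel G m h j y * G y m l) * b i k := by
    simp only [Finset.sum_mul, ← Finset.sum_add_distrib, ← Finset.sum_sub_distrib]
    refine Finset.sum_congr rfl fun m _ => ?_
    simp [kulkarniNomizu, metricTensor, hb]; ring
  have t3 : ∑ m, christoffel G m h k y * kulkarniNomizu (metricTensor G) (schouten G) y
      ![i, j, m, l] = (∑ m, christoffel G m h k y * b j m) * G y i l
      + (∑ m, christoffel G m h k y * G y j m) * b i l
      - (∑ m, christoffel G m h k y * G y i m) * b j l
      - (∑ m, christoffel G m h k y * b i m) * G y j l := by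
    simp only [Finset.sum_mul, ← Finset.sum_add_distrib, ← Finset.sum_sub_distrib]
    refine Finset.sum_congr rfl fun m _ => ?_
    simp [kulkarniNomizu, metricTensor, hb]; ring
  have t4 : ∑ m, christoffel G m h l y * kulkarniNomizu (metricTensor G) (schouten G) y
      ![i, j, k, m] = (∑ m, christoffel G m h l y * G y i m) * b j k
      + (∑ m, christoffel G m h l y * b i m) * G y j k
      - (∑ m, christoffel G m h l y * b j m) * G y i k
      - (∑ m, christoffel G m h l y * G y j m) * b i k := by
    simp only [Finset.sum_mul, ← Finset.sum_add_distrib, ← Finset.sum_sub_distrib]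
    refine Finset.sum_congr rfl fun m _ => ?_
    simp [kulkarniNomizu, metricTensor, hb]; ring
  rw [t1, t2, t3, t4]
  simp only [knProd, covDeriv_two, hb]
  ring

theorem covDeriv_weyl (hG : SmoothMetricOn G Ω) (hy : y ∈ Ω) (h i j k l : Fin n) :
    covDeriv G (weyl G) y ![h, i, j, k, l] = covDeriv G (riemann G) y ![h, i, j, k, l]
      - knProd (G y) (fun a b => covDeriv G (schouten G) y ![h, a, b]) i j k l := by
  rw [← hG.covDeriv_knProd hy]
  have e : pd h (fun z => weyl G z ![i, j, k, l]) y = pd h (fun z => riemann G z ![i, j, k, l]) y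
      - pd h (fun z => kulkarniNomizu (metricTensor G) (schouten G) z ![i, j, k, l]) y :=
    pd_sub h ((hG.smooth_riemann hy i j k l).differentiableAt (by simp))
      ((hG.smooth_knProd hy i j k l).differentiableAt (by simp))
  simp only [covDeriv_four, e]
  simp only [weyl, mul_sub, Finset.sum_sub_distrib]
  ring

/-- The symmetries are linear identities holding on an open set, so they survive the partial
derivative as well as each Christoffel correction. -/
theorem isCurvatureLike_covDeriv_weyl (hG : SmoothMetricOn G Ω) (hy : y ∈ Ω) (h : Fin n) :
    IsCurvatureLike fun i j k l => covDeriv G (weyl G) y ![h, i, j, k, l] := by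
  have w := hG.isCurvatureLike_weyl hy
  have s := fun i j k l => (hG.smooth_weyl hy i j k l).differentiableAt (by simp)
  have pdneg : ∀ f : Coord n → ℝ, pd h (fun z => -f z) y = -pd h f y := fun f => by
    simp [pd]
  have c : ∀ (u : Fin n → ℝ) (A B : Fin n → ℝ), (∀ m, A m = -B m) →
      ∑ m, u m * A m = -∑ m, u m * B m := fun u A B hab => by
    simp only [hab, mul_neg, Finset.sum_neg_distrib]
  refine ⟨fun i j k l => ?_, fun i j k l => ?_, fun i j k l => ?_⟩
  · have e : pd h (fun z => weyl G z ![j, i, k, l]) y = -pd h (fun z => weyl G z ![i, j, k, l]) y :=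
      (pd_congr h (Filter.eventually_of_mem (hG.mem_nhds hy) fun z hz =>
        (hG.isCurvatureLike_weyl hz).swap_left i j k l)).trans (pdneg _)
    have c1 := c (fun m => christoffel G m h i y) _ _ fun m => w.swap_left m j k l
    have c2 := c (fun m => christoffel G m h j y) _ _ fun m => w.swap_left i m k l
    have c3 := c (fun m => christoffel G m h k y) _ _ fun m => w.swap_left i j m l
    have c4 := c (fun m => christoffel G m h l y) _ _ fun m => w.swap_left i j k m
    simp only [covDeriv_four]
    linarith
  · have e : pd h (fun z => weyl G z ![i, j, l, k]) y = -pd h (fun z => weyl G z ![i, j, k, l]) y :=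
      (pd_congr h (Filter.eventually_of_mem (hG.mem_nhds hy) fun z hz =>
        (hG.isCurvatureLike_weyl hz).swap_right i j k l)).trans (pdneg _)
    have c1 := c (fun m => christoffel G m h i y) _ _ fun m => w.swap_right m j k l
    have c2 := c (fun m => christoffel G m h j y) _ _ fun m => w.swap_right i m k l
    have c3 := c (fun m => christoffel G m h k y) _ _ fun m => w.swap_right i j m l
    have c4 := c (fun m => christoffel G m h l y) _ _ fun m => w.swap_right i j k m
    simp only [covDeriv_four]
    linarith
  · have e : pd h (fun z => weyl G z ![i, j, k, l]) y + pd h (fun z => weyl G z ![j, k, i, l]) y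
        + pd h (fun z => weyl G z ![k, i, j, l]) y = 0 := by
      rw [← pd_add h (s _ _ _ _) (s _ _ _ _),
        ← pd_add h ((s _ _ _ _).fun_add (s _ _ _ _)) (s _ _ _ _), ← pd_const h (0 : ℝ) (y := y)]
      exact pd_congr h (Filter.eventually_of_mem (hG.mem_nhds hy) fun z hz =>
        (hG.isCurvatureLike_weyl hz).cyclic i j k l)
    have c : ∀ (u : Fin n → ℝ) (A B C : Fin n → ℝ), (∀ m, A m + B m + C m = 0) →
        ∑ m, u m * A m + ∑ m, u m * B m + ∑ m, u m * C m = 0 := fun u A B C habc => by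
      simp only [← Finset.sum_add_distrib, ← mul_add, habc, mul_zero, Finset.sum_const_zero]
    have c1 := c (fun m => christoffel G m h i y) _ _ _ fun m => w.cyclic m j k l
    have c2 := c (fun m => christoffel G m h j y) _ _ _ fun m => w.cyclic i m k l
    have c3 := c (fun m => christoffel G m h k y) _ _ _ fun m => w.cyclic i j m l
    have c4 := c (fun m => christoffel G m h l y) _ _ _ fun m => w.cyclic i j k m
    simp only [covDeriv_four]
    linarith

/-- Since the inverse metric is parallel, its derivative supplies precisely the Christoffel
corrections of the two contracted slots. -/
theorem pd_trace (hG : SmoothMetricOn G Ω) (hy : y ∈ Ω) (h : Fin n)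
    {F : Fin n → Fin n → Coord n → ℝ} (hF : ∀ i l, DifferentiableAt ℝ (F i l) y) :
    pd h (fun z => ∑ i, ∑ l, inv G z i l * F i l z) y =
      ∑ i, ∑ l, inv G y i l * (pd h (F i l) y - ∑ m, christoffel G m h i y * F m l y
        - ∑ m, christoffel G m h l y * F i m y) := by
  have di := fun i l => (hG.smooth_inv hy).diff i l
  have e1 : pd h (fun z => ∑ i, ∑ l, inv G z i l * F i l z) y =
      ∑ i, ∑ l, (pd h (fun z => inv G z i l) y * F i l y + inv G y i l * pd h (F i l) y) := by
    rw [pd_sum _ _ fun i _ => DifferentiableAt.fun_sum fun l _ => (di i l).fun_mul (hF i l)]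
    refine Finset.sum_congr rfl fun i _ => ?_
    rw [pd_sum _ _ fun l _ => (di i l).fun_mul (hF i l)]
    exact Finset.sum_congr rfl fun l _ => pd_mul h (di i l) (hF i l)
  have e2 : ∀ i l, pd h (fun z => inv G z i l) y =
      -(∑ m, christoffel G i h m y * inv G y m l) - ∑ m, inv G y i m * christoffel G l h m y :=
    fun i l => by
      have := congrFun (congrFun (hG.pdMat_inv hy h) i) l
      simp only [Matrix.sub_apply, Matrix.neg_apply, Matrix.mul_apply, Matrix.transpose_apply,
        connMat_apply] at this
      exact this
  have s1 : ∑ i, ∑ l, (∑ m, christoffel G i h m y * inv G y m l) * F i l y =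
      ∑ i, ∑ l, inv G y i l * ∑ m, christoffel G m h i y * F m l y := by
    simp only [Finset.sum_mul, Finset.mul_sum]
    rw [Finset.sum_comm]
    conv_rhs => rw [Finset.sum_comm]
    refine Finset.sum_congr rfl fun l _ => ?_
    rw [Finset.sum_comm]
    exact Finset.sum_congr rfl fun _ _ => Finset.sum_congr rfl fun _ _ => by ring
  have s2 : ∑ i, ∑ l, (∑ m, inv G y i m * christoffel G l h m y) * F i l y =
      ∑ i, ∑ l, inv G y i l * ∑ m, christoffel G m h l y * F i m y := by
    simp only [Finset.sum_mul, Finset.mul_sum]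
    refine Finset.sum_congr rfl fun i _ => ?_
    rw [Finset.sum_comm]
    exact Finset.sum_congr rfl fun _ _ => Finset.sum_congr rfl fun _ _ => by ring
  rw [e1]
  simp only [e2, sub_mul, neg_mul, mul_sub, Finset.sum_add_distrib, Finset.sum_sub_distrib,
    Finset.sum_neg_distrib]
  rw [s1, s2]
  ring

/-- The derivative of the vanishing trace accounts for the contracted slots; the corrections of the
two free slots are themselves traces of `W`. -/
theorem trace_covDeriv_weyl (hn : 4 ≤ n) (hG : SmoothMetricOn G Ω) (hy : y ∈ Ω) (h j k : Fin n) :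
    ∑ i, ∑ l, inv G y i l * covDeriv G (weyl G) y ![h, i, j, k, l] = 0 := by
  have e := hG.pd_trace hy h (F := fun i l z => weyl G z ![i, j, k, l])
    fun i l => (hG.smooth_weyl hy i j k l).differentiableAt (by simp)
  rw [pd_congr h (g := fun _ => 0) (Filter.eventually_of_mem (hG.mem_nhds hy) fun z hz =>
    hG.trace_weyl hn hz j k), pd_const] at e
  have s : ∀ (a : Fin n), ∑ i, ∑ l, inv G y i l *
      ∑ m, christoffel G m h a y * weyl G y ![i, m, k, l] = 0 := fun a => by
    simp only [Finset.mul_sum]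
    rw [Finset.sum_congr rfl fun i _ => Finset.sum_comm, Finset.sum_comm]
    refine Finset.sum_eq_zero fun m _ => ?_
    simp only [mul_left_comm, ← Finset.mul_sum, hG.trace_weyl hn hy, mul_zero]
  have s' : ∀ (a : Fin n), ∑ i, ∑ l, inv G y i l *
      ∑ m, christoffel G m h a y * weyl G y ![i, j, m, l] = 0 := fun a => by
    simp only [Finset.mul_sum]
    rw [Finset.sum_congr rfl fun i _ => Finset.sum_comm, Finset.sum_comm]
    refine Finset.sum_eq_zero fun m _ => ?_
    simp only [mul_left_comm, ← Finset.mul_sum, hG.trace_weyl hn hy, mul_zero]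
  simp only [covDeriv_four]
  simp only [mul_sub, Finset.sum_sub_distrib, s, s'] at e ⊢
  linarith

/-- The trace of the covariant derivative of the Schouten tensor over its last two slots, minus the
divergence of the Schouten tensor, vanishes. -/
theorem contracted_bianchi (hn : 4 ≤ n) (hG : SmoothMetricOn G Ω) (hy : y ∈ Ω) :
    (∀ i, ∑ a, ∑ b, inv G y a b * covDeriv G (schouten G) y ![i, a, b] =
      ∑ a, ∑ b, inv G y a b * covDeriv G (schouten G) y ![a, i, b]) ∧
    (∀ i j k, divWeyl G y ![i, j, k] = ((n : ℝ) - 3) * dNabla G (schouten G) y ![i, j, k]) := by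
  have hn' : (4 : ℝ) ≤ n := by exact_mod_cast hn
  set K : Fin n → Matrix (Fin n) (Fin n) ℝ :=
    fun h => Matrix.of fun a b => covDeriv G (schouten G) y ![h, a, b] with hK
  set w : Fin n → Fin n → Fin n → Fin n → Fin n → ℝ :=
    fun h i j k l => covDeriv G (weyl G) y ![h, i, j, k, l] with hw
  set H := inv G y with hH
  set σ : Fin n → ℝ := fun i => ∑ a, ∑ b, H a b * K i a b with hσ
  set τ : Fin n → ℝ := fun i => ∑ a, ∑ b, H a b * K a i b with hτ
  have hHg := hG.inv_mul hy
  have hHs := hG.inv_symm hy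
  have hgs := hG.symm hy
  have hKs : ∀ h a b, K h a b = K h b a := by
    intro h a b
    simp only [hK, Matrix.of_apply, covDeriv_two]
    rw [pd_congr h (Filter.eventually_of_mem (hG.mem_nhds hy) fun z hz =>
      hG.schouten_symm hz a b)]
    simp only [fun m => hG.schouten_symm hy m b, fun m => hG.schouten_symm hy a m]
    ring
  have hcl : ∀ h, IsCurvatureLike (w h) := hG.isCurvatureLike_covDeriv_weyl hy
  -- The second Bianchi identity with `R = W + g ⊙ 𝔨` inserted.
  have B : ∀ h i j k l, w h i j k l + w i j h k l + w j h i k l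
      + knProd (G y) (K h) i j k l + knProd (G y) (K i) j h k l + knProd (G y) (K j) h i k l = 0 := by
    intro h i j k l
    have b := hG.riemann_bianchi hy h i j k l
    have c := hG.covDeriv_weyl hy
    have d : ∀ h i j k l, covDeriv G (riemann G) y ![h, i, j, k, l] =
        w h i j k l + knProd (G y) (K h) i j k l := fun h i j k l => by
      have := c h i j k l
      simp only [hw, this]
      exact (sub_add_cancel _ _).symm
    rw [d, d, d] at b
    linarith
  -- The identity `B` is contracted over the derivative index `h` and the last slot `l`; `T1`-`T3`
  -- treat the Weyl terms and `K1`-`K3` the Schouten terms.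
  have T1 : ∀ i j k, ∑ h, ∑ l, H h l * w h i j k l = divWeyl G y ![i, j, k] := fun i j k => by
    rw [divWeyl, divergence_three_four]
  have T2 : ∀ i j k, ∑ h, ∑ l, H h l * w i j h k l = 0 := fun i j k => by
    have : ∀ h l, H h l * w i j h k l = -(H h l * w i h j k l) := fun h l => by
      rw [(hcl i).swap_left h j]; ring
    simp only [this, Finset.sum_neg_distrib]
    rw [hG.trace_covDeriv_weyl hn hy, neg_zero]
  have T3 : ∀ i j k, ∑ h, ∑ l, H h l * w j h i k l = 0 := fun i j k =>
    hG.trace_covDeriv_weyl hn hy j i k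
  have K1 : ∀ i j k, ∑ h, ∑ l, H h l * knProd (G y) (K h) i j k l =
      K i j k - K j i k + G y j k * τ i - G y i k * τ j := fun i j k => by
    have e : ∀ h l, H h l * knProd (G y) (K h) i j k l = H h l * (G y l i * K h j k)
        + G y j k * (H h l * K h i l) - G y i k * (H h l * K h j l)
        - H h l * (G y l j * K h i k) := fun h l => by
      simp only [knProd]; rw [hgs l i, hgs l j]; ring
    simp only [e, Finset.sum_add_distrib, Finset.sum_sub_distrib, ← Finset.mul_sum]
    rw [sum_inv_metric_right hHg hHs (fun h => K h j k),
      sum_inv_metric_right hHg hHs (fun h => K h i k)]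
    ring
  have K3 : ∀ i j k, ∑ h, ∑ l, H h l * knProd (G y) (K j) h i k l =
      ((n : ℝ) - 2) * K j i k + σ j * G y i k := fun i j k =>
    trace_knProd hHg hHs hgs i k
  have K2 : ∀ i j k, ∑ h, ∑ l, H h l * knProd (G y) (K i) j h k l =
      -(((n : ℝ) - 2) * K i j k + σ i * G y j k) := fun i j k => by
    rw [← K3 j i k, ← Finset.sum_neg_distrib]
    refine Finset.sum_congr rfl fun h _ => ?_
    rw [← Finset.sum_neg_distrib]
    refine Finset.sum_congr rfl fun l _ => ?_
    rw [(isCurvatureLike_knProd hgs (hKs i)).swap_left h j]; ring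
  -- The contributions `1` from `K1` and `-(n-2)` from `K2` and `K3` add up to `-(n-3)`.
  have main : ∀ i j k, divWeyl G y ![i, j, k] = ((n : ℝ) - 3) * (K i j k - K j i k)
      - G y j k * (τ i - σ i) + G y i k * (τ j - σ j) := fun i j k => by
    have := Finset.sum_congr rfl fun h (_ : h ∈ Finset.univ) =>
      Finset.sum_congr rfl fun l (_ : l ∈ Finset.univ) => congrArg (H h l * ·) (B h i j k l)
    simp only [mul_add, Finset.sum_add_distrib, mul_zero, Finset.sum_const_zero] at this
    rw [T1, T2, T3, K1, K2, K3] at this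
    linarith
  -- Skewness in both pairs turns the trace over the second and third slots into one over the first
  -- and last, which vanishes.
  have tr : ∀ i, ∑ j, ∑ k, H j k * divWeyl G y ![i, j, k] = 0 := fun i => by
    simp only [← T1, Finset.mul_sum]
    rw [Finset.sum_congr rfl fun j _ => Finset.sum_comm, Finset.sum_comm]
    refine Finset.sum_eq_zero fun h _ => ?_
    rw [Finset.sum_congr rfl fun j _ => Finset.sum_comm, Finset.sum_comm]
    refine Finset.sum_eq_zero fun l _ => ?_
    have : ∀ j k, H j k * (H h l * w h i j k l) = H h l * (H j k * w h j i l k) := fun j k => by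
      rw [(hcl h).swap_left j i, (hcl h).swap_right j i]; ring
    simp only [this, ← Finset.mul_sum]
    rw [hG.trace_covDeriv_weyl hn hy, mul_zero]
  -- Tracing `main` over `j, k` gives `((n-3) + n - 1)(σ - τ) = 0`, where `2n - 4 ≠ 0`.
  have στ : ∀ i, σ i = τ i := fun i => by
    have t := tr i
    have e : ∀ j k, H j k * divWeyl G y ![i, j, k] = ((n : ℝ) - 3) * (H j k * K i j k)
        - ((n : ℝ) - 3) * (H j k * K j i k) - (τ i - σ i) * (H j k * G y j k)
        + H j k * (G y k i * (τ j - σ j)) := fun j k => by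
      rw [main, hgs k i]; ring
    simp only [e, Finset.sum_add_distrib, Finset.sum_sub_distrib, ← Finset.mul_sum] at t
    rw [sum_inv_metric_right hHg hHs (fun j => τ j - σ j), sum_inv_metric_self hHg hgs] at t
    have t' : (2 * (n : ℝ) - 4) * (σ i - τ i) = 0 := by
      rw [← t]; simp only [hσ, hτ]; ring
    rcases mul_eq_zero.1 t' with h | h
    · linarith
    · linarith
  refine ⟨στ, fun i j k => ?_⟩
  rw [main, στ, στ]
  simp only [dNabla, hK]
  simp

end SmoothMetricOn

end Weyl

/-! ### Conformal changes of the metric -/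

section Conformal

variable {n : ℕ}

/-- The conformally related metric `φ g`. -/
def confMetric (φ : Coord n → ℝ) (G : MetricComp n) : MetricComp n := fun y => φ y • G y

/-- `φ` is smooth and positive on `Ω`. -/
structure ConfFactorOn (φ : Coord n → ℝ) (Ω : Set (Coord n)) : Prop where
  smooth : ∀ y ∈ Ω, ContDiffAt ℝ ∞ φ y
  pos : ∀ y ∈ Ω, 0 < φ y

/-- The components of half the logarithmic differential of `φ`. -/
def halfDLog (φ : Coord n → ℝ) (i : Fin n) (y : Coord n) : ℝ := pd i φ y / (2 * φ y)

/-- The vector field dual to `halfDLog φ`. -/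
def halfGradLog (φ : Coord n → ℝ) (G : MetricComp n) (i : Fin n) (y : Coord n) : ℝ :=
  ∑ l, inv G y i l * halfDLog φ l y

/-- `|α|²` for `α = halfDLog φ`. -/
def halfDLogNormSq (φ : Coord n → ℝ) (G : MetricComp n) (y : Coord n) : ℝ :=
  ∑ m, halfDLog φ m y * halfGradLog φ G m y

/-- The covariant derivative of a one-form given by its components. -/
def covDerivForm (G : MetricComp n) (θ : Fin n → Coord n → ℝ) (i k : Fin n) (y : Coord n) : ℝ :=
  pd i (θ k) y - ∑ m, christoffel G m i k y * θ m y

/-- The change `∇α - α ⊗ α + ½ |α|² g` of the Schouten tensor. -/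
def schoutenChange (φ : Coord n → ℝ) (G : MetricComp n) (y : Coord n) :
    Matrix (Fin n) (Fin n) ℝ := Matrix.of fun i k =>
  covDerivForm G (halfDLog φ) i k y - halfDLog φ i y * halfDLog φ k y
    + 1 / 2 * halfDLogNormSq φ G y * G y i k

/-- The change of the connection. -/
def connChange (φ : Coord n → ℝ) (G : MetricComp n) (i : Fin n) (y : Coord n) :
    Matrix (Fin n) (Fin n) ℝ := Matrix.of fun m k =>
  (1 : Matrix (Fin n) (Fin n) ℝ) m i * halfDLog φ k y
    + halfDLog φ i y * (1 : Matrix (Fin n) (Fin n) ℝ) m k - halfGradLog φ G m y * G y i k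

/-- The change of the connection, with the upper index lowered. -/
def connChangeLow (φ : Coord n → ℝ) (G : MetricComp n) (i : Fin n) (y : Coord n) :
    Matrix (Fin n) (Fin n) ℝ := Matrix.of fun l k =>
  G y l i * halfDLog φ k y + halfDLog φ i y * G y l k - halfDLog φ l y * G y i k

variable {G : MetricComp n} {Ω : Set (Coord n)} {φ : Coord n → ℝ} {y : Coord n}

theorem confMetric_apply (i j : Fin n) : confMetric φ G y i j = φ y * G y i j := rfl

namespace SmoothMetricOn

theorem conf (hG : SmoothMetricOn G Ω) (hφ : ConfFactorOn φ Ω) :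
    SmoothMetricOn (confMetric φ G) Ω where
  isOpen := hG.isOpen
  smooth y hy a b := (hφ.smooth y hy).mul (hG.smooth y hy a b)
  posDef y hy := (hG.posDef y hy).smul (hφ.pos y hy)

theorem inv_conf (hG : SmoothMetricOn G Ω) (hφ : ConfFactorOn φ Ω) (hy : y ∈ Ω) :
    inv (confMetric φ G) y = (φ y)⁻¹ • inv G y := by
  refine Matrix.inv_eq_left_inv ?_
  rw [confMetric, Matrix.smul_mul, Matrix.mul_smul, hG.inv_mul hy, smul_smul,
    inv_mul_cancel₀ (hφ.pos y hy).ne', one_smul]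

theorem inv_conf_apply (hG : SmoothMetricOn G Ω) (hφ : ConfFactorOn φ Ω) (hy : y ∈ Ω)
    (i j : Fin n) : inv (confMetric φ G) y i j = (φ y)⁻¹ * inv G y i j := by
  rw [hG.inv_conf hφ hy]; rfl

end SmoothMetricOn

theorem ConfFactorOn.pd_eq (hφ : ConfFactorOn φ Ω) (hy : y ∈ Ω) (i : Fin n) :
    pd i φ y = 2 * φ y * halfDLog φ i y := by
  have := (hφ.pos y hy).ne'
  rw [halfDLog]; field_simp

theorem ConfFactorOn.smooth_halfDLog (hφ : ConfFactorOn φ Ω) (hy : y ∈ Ω) (i : Fin n) :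
    ContDiffAt ℝ ∞ (halfDLog φ i) y :=
  ((hφ.smooth y hy).pd i).div (contDiffAt_const.mul (hφ.smooth y hy))
    (mul_ne_zero two_ne_zero (hφ.pos y hy).ne')

/-- `α` is half a logarithmic differential, hence closed: differentiate `∂φ = 2φα` and compare mixed
partials. -/
theorem ConfFactorOn.pd_halfDLog_symm (hφ : ConfFactorOn φ Ω) (hy : y ∈ Ω) (i j : Fin n) :
    pd i (halfDLog φ j) y = pd j (halfDLog φ i) y := by
  have hp := (hφ.pos y hy).ne'
  have key : ∀ a b, pd a (pd b φ) y = 2 * (pd a φ y * halfDLog φ b y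
      + φ y * pd a (halfDLog φ b) y) := fun a b => by
    have e : pd b φ =ᶠ[𝓝 y] fun z => 2 * (φ z * halfDLog φ b z) := by
      filter_upwards [(hφ.smooth y hy).continuousAt.eventually_ne hp] with z hz
      simp only [halfDLog]; field_simp
    have d1 := (hφ.smooth y hy).differentiableAt (by simp)
    have d2 := (hφ.smooth_halfDLog hy b).differentiableAt (by simp)
    rw [pd_congr a e, pd_const_mul a 2 (d1.fun_mul d2), pd_mul a d1 d2]
  have h := pd_comm i j (hφ.smooth y hy)
  rw [key, key, hφ.pd_eq hy, hφ.pd_eq hy] at h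
  have : φ y * pd i (halfDLog φ j) y = φ y * pd j (halfDLog φ i) y := by linarith
  exact mul_left_cancel₀ hp this

namespace SmoothMetricOn

theorem sum_metric_halfGradLog (hG : SmoothMetricOn G Ω) (hy : y ∈ Ω) (l : Fin n) :
    ∑ m, G y l m * halfGradLog φ G m y = halfDLog φ l y := by
  have : (G y).mulVec ((inv G y).mulVec fun l => halfDLog φ l y) l = halfDLog φ l y := by
    rw [Matrix.mulVec_mulVec, hG.mul_inv hy, Matrix.one_mulVec]
  exact this

theorem sum_inv_metric (hG : SmoothMetricOn G Ω) (hy : y ∈ Ω) (k j : Fin n) :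
    ∑ l, inv G y k l * G y j l = (1 : Matrix (Fin n) (Fin n) ℝ) k j := by
  rw [← hG.inv_mul hy, Matrix.mul_apply]
  exact Finset.sum_congr rfl fun l _ => by rw [hG.symm hy j l]

theorem connMat_conf (hG : SmoothMetricOn G Ω) (hφ : ConfFactorOn φ Ω) (hy : y ∈ Ω) (i : Fin n) :
    connMat (confMetric φ G) i y = connMat G i y + connChange φ G i y := by
  have hp := (hφ.pos y hy).ne'
  have d : ∀ a b c, pd a (fun z => confMetric φ G z b c) y =
      2 * φ y * halfDLog φ a y * G y b c + φ y * pd a (fun z => G z b c) y := fun a b c => by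
    rw [← hφ.pd_eq hy]
    exact pd_mul a ((hφ.smooth y hy).differentiableAt (by simp)) ((hG.smooth y hy).diff b c)
  ext k j
  rw [Matrix.add_apply, connMat_apply, connMat_apply]
  simp only [christoffel, connChange, Matrix.of_apply, d, hG.inv_conf_apply hφ hy, halfGradLog]
  -- The Kronecker deltas are written as `g⁻¹ g`, so that the identity can be checked termwise under
  -- one sum.
  rw [← hG.sum_inv_metric hy k i, ← hG.sum_inv_metric hy k j]
  simp only [Finset.mul_sum, Finset.sum_mul, ← Finset.sum_add_distrib, ← Finset.sum_sub_distrib]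
  refine Finset.sum_congr rfl fun l _ => ?_
  field_simp
  ring

theorem christoffel_conf (hG : SmoothMetricOn G Ω) (hφ : ConfFactorOn φ Ω) (hy : y ∈ Ω)
    (m i k : Fin n) : christoffel (confMetric φ G) m i k y = christoffel G m i k y +
      ((1 : Matrix (Fin n) (Fin n) ℝ) m i * halfDLog φ k y
        + halfDLog φ i y * (1 : Matrix (Fin n) (Fin n) ℝ) m k
        - halfGradLog φ G m y * G y i k) :=
  congrFun (congrFun (hG.connMat_conf hφ hy i) m) k

/-- Summing the change of the Christoffel symbols against a covector. -/
theorem sum_christoffel_conf (hG : SmoothMetricOn G Ω) (hφ : ConfFactorOn φ Ω) (hy : y ∈ Ω)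
    (i k : Fin n) (f : Fin n → ℝ) : ∑ m, christoffel (confMetric φ G) m i k y * f m =
      ∑ m, christoffel G m i k y * f m + halfDLog φ k y * f i + halfDLog φ i y * f k
        - G y i k * ∑ m, halfGradLog φ G m y * f m := by
  have e : ∀ m, christoffel (confMetric φ G) m i k y * f m = christoffel G m i k y * f m
      + halfDLog φ k y * ((1 : Matrix (Fin n) (Fin n) ℝ) m i * f m)
      + halfDLog φ i y * ((1 : Matrix (Fin n) (Fin n) ℝ) m k * f m)
      - G y i k * (halfGradLog φ G m y * f m) := fun m => by
    rw [hG.christoffel_conf hφ hy]; ring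
  simp only [e, Finset.sum_add_distrib, Finset.sum_sub_distrib, ← Finset.mul_sum]
  simp [Matrix.one_apply]

theorem mul_connChange (hG : SmoothMetricOn G Ω) (hy : y ∈ Ω) (i : Fin n) :
    G y * connChange φ G i y = connChangeLow φ G i y := by
  ext l k
  have e : ∀ m, G y l m * connChange φ G i y m k =
      G y l m * (1 : Matrix (Fin n) (Fin n) ℝ) m i * halfDLog φ k y
      + halfDLog φ i y * (G y l m * (1 : Matrix (Fin n) (Fin n) ℝ) m k)
      - G y l m * halfGradLog φ G m y * G y i k := fun m => by
    simp only [connChange, Matrix.of_apply]; ring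
  rw [Matrix.mul_apply]
  simp only [e, Finset.sum_add_distrib, Finset.sum_sub_distrib, ← Finset.mul_sum, ← Finset.sum_mul]
  rw [hG.sum_metric_halfGradLog hy]
  simp [Matrix.one_apply, connChangeLow]

theorem smooth_connChange (hG : SmoothMetricOn G Ω) (hφ : ConfFactorOn φ Ω) (hy : y ∈ Ω)
    (i : Fin n) : SmoothEntriesAt (connChange φ G i) y := fun m k => by
  have a := hφ.smooth_halfDLog hy
  have b : ContDiffAt ℝ ∞ (halfGradLog φ G m) y :=
    ContDiffAt.sum fun l _ => (hG.smooth_inv hy m l).mul (a l)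
  exact ((contDiffAt_const.mul (a k)).add ((a i).mul contDiffAt_const)).sub
    (b.mul (hG.smooth y hy i k))

/-- The antisymmetrized covariant derivative of the change of the connection. -/
theorem connChange_deriv (hG : SmoothMetricOn G Ω) (hφ : ConfFactorOn φ Ω) (hy : y ∈ Ω)
    (i j k l : Fin n) :
    (G y * (pdMat i (connChange φ G j) y + connMat G i y * connChange φ G j y
        - connChange φ G j y * connMat G i y)) l k
      - (G y * (pdMat j (connChange φ G i) y + connMat G j y * connChange φ G i y
        - connChange φ G i y * connMat G j y)) l k =
    -knProd (G y) (fun a b => covDerivForm G (halfDLog φ) a b y) i j k l := by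
  -- By `∇g = 0`, lowering the index commutes with the covariant derivative.
  have A : ∀ a b, G y * (pdMat a (connChange φ G b) y + connMat G a y * connChange φ G b y
        - connChange φ G b y * connMat G a y) = pdMat a (connChangeLow φ G b) y
        - (connMat G a y).transpose * connChangeLow φ G b y
        - connChangeLow φ G b y * connMat G a y := fun a b => by
    have e : pdMat a (connChangeLow φ G b) y = pdMat a (fun z => G z * connChange φ G b z) y :=
      pdMat_congr a (Filter.eventually_of_mem (hG.mem_nhds hy) fun z hz =>
        (hG.mul_connChange hz b).symm)
    rw [e, pdMat_mul a (hG.smooth y hy) (hG.smooth_connChange hφ hy b), hG.pdMat_metric hy,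
      ← hG.mul_connChange hy]
    noncomm_ring
  have d := fun a => (hφ.smooth_halfDLog hy a).differentiableAt (by simp)
  have g := (hG.smooth y hy).diff
  have B : ∀ a b, (pdMat a (connChangeLow φ G b) y
        - (connMat G a y).transpose * connChangeLow φ G b y
        - connChangeLow φ G b y * connMat G a y) l k =
      (∑ m, christoffel G m a b y * G y l m) * halfDLog φ k y
      + G y l b * covDerivForm G (halfDLog φ) a k y + pd a (halfDLog φ b) y * G y l k
      - covDerivForm G (halfDLog φ) a l y * G y b k
      - halfDLog φ l y * ∑ m, christoffel G m a b y * G y m k := fun a b => by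
    have e0 : pdMat a (connChangeLow φ G b) y l k = pd a (fun z => G z l b * halfDLog φ k z
        + halfDLog φ b z * G z l k - halfDLog φ l z * G z b k) y := rfl
    have e1 : ((connMat G a y).transpose * connChangeLow φ G b y) l k =
        (∑ m, christoffel G m a l y * G y m b) * halfDLog φ k y
        + halfDLog φ b y * (∑ m, christoffel G m a l y * G y m k)
        - (∑ m, christoffel G m a l y * halfDLog φ m y) * G y b k := by
      simp only [Matrix.mul_apply, Finset.mul_sum, Finset.sum_mul, ← Finset.sum_add_distrib,
        ← Finset.sum_sub_distrib]
      refine Finset.sum_congr rfl fun m _ => ?_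
      simp only [connChangeLow, Matrix.of_apply, Matrix.transpose_apply, connMat_apply]
      ring
    have e2 : (connChangeLow φ G b y * connMat G a y) l k =
        G y l b * (∑ m, christoffel G m a k y * halfDLog φ m y)
        + halfDLog φ b y * (∑ m, christoffel G m a k y * G y l m)
        - halfDLog φ l y * (∑ m, christoffel G m a k y * G y b m) := by
      simp only [Matrix.mul_apply, Finset.mul_sum, ← Finset.sum_add_distrib,
        ← Finset.sum_sub_distrib]
      refine Finset.sum_congr rfl fun m _ => ?_
      simp only [connChangeLow, Matrix.of_apply, connMat_apply]
      ring
    rw [Matrix.sub_apply, Matrix.sub_apply, e0, e1, e2, pd_sub a (((g l b).fun_mul (d k)).fun_add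
      ((d b).fun_mul (g l k))) ((d l).fun_mul (g b k)), pd_add a ((g l b).fun_mul (d k))
      ((d b).fun_mul (g l k)), pd_mul a (g l b) (d k), pd_mul a (d b) (g l k),
      pd_mul a (d l) (g b k), hG.pd_metric hy, hG.pd_metric hy, hG.pd_metric hy]
    simp only [covDerivForm]
    ring
  -- Closedness of `α` cancels the terms with `G y l k`; symmetry of the Christoffel symbols cancels
  -- the uncontracted connection terms.
  rw [A, A, B, B, hφ.pd_halfDLog_symm hy j i]
  have s : ∀ m, christoffel G m j i y = christoffel G m i j y := fun m =>
    hG.christoffel_symm hy m j i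
  simp only [s, knProd]
  rw [hG.symm hy l i, hG.symm hy l j]
  ring

theorem connChange_mul (hG : SmoothMetricOn G Ω) (hy : y ∈ Ω) (i j k l : Fin n) :
    (connChangeLow φ G i y * connChange φ G j y) l k =
      (G y l i * halfDLog φ j y + halfDLog φ i y * G y l j - halfDLog φ l y * G y i j)
        * halfDLog φ k y
      + halfDLog φ j y *
        (G y l i * halfDLog φ k y + halfDLog φ i y * G y l k - halfDLog φ l y * G y i k)
      - G y l i * halfDLogNormSq φ G y * G y j k := by
  have e : ∀ m, connChangeLow φ G i y l m * connChange φ G j y m k =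
      connChangeLow φ G i y l m * (1 : Matrix (Fin n) (Fin n) ℝ) m j * halfDLog φ k y
      + halfDLog φ j y * (connChangeLow φ G i y l m * (1 : Matrix (Fin n) (Fin n) ℝ) m k)
      - (G y l i * (halfDLog φ m y * halfGradLog φ G m y)
        + halfDLog φ i y * (G y l m * halfGradLog φ G m y)
        - halfDLog φ l y * (G y i m * halfGradLog φ G m y)) * G y j k := fun m => by
    simp only [connChange, connChangeLow, Matrix.of_apply]; ring
  rw [Matrix.mul_apply]
  simp only [e, Finset.sum_add_distrib, Finset.sum_sub_distrib, ← Finset.mul_sum, ← Finset.sum_mul]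
  rw [hG.sum_metric_halfGradLog hy, hG.sum_metric_halfGradLog hy]
  simp only [Matrix.one_apply, mul_ite, mul_one, mul_zero, Finset.sum_ite_eq', Finset.mem_univ,
    if_true, connChangeLow, Matrix.of_apply, halfDLogNormSq]
  ring

/-- The curvature of `∇ + A` is that of `∇` plus `d^∇ A + A ∧ A`. The derivative part gives `-g ⊙
∇α`, and the quadratic part supplies the terms `-α ⊗ α + ½ |α|² g` in the Kulkarni-Nomizu factor. -/
theorem riemann_conf (hG : SmoothMetricOn G Ω) (hφ : ConfFactorOn φ Ω) (hy : y ∈ Ω)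
    (i j k l : Fin n) : riemann (confMetric φ G) y ![i, j, k, l] =
      φ y * (riemann G y ![i, j, k, l] - knProd (G y) (schoutenChange φ G y) i j k l) := by
  have hc : ∀ a, pdMat i (connMat (confMetric φ G) a) y =
      pdMat i (connMat G a) y + pdMat i (connChange φ G a) y ∧
      pdMat j (connMat (confMetric φ G) a) y =
      pdMat j (connMat G a) y + pdMat j (connChange φ G a) y := fun a => by
    have e := Filter.eventually_of_mem (hG.mem_nhds hy) fun z hz => hG.connMat_conf hφ hz a
    rw [pdMat_congr i e, pdMat_congr j e]
    exact ⟨pdMat_add i (hG.smooth_connMat hy a) (hG.smooth_connChange hφ hy a),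
      pdMat_add j (hG.smooth_connMat hy a) (hG.smooth_connChange hφ hy a)⟩
  have e : G y * curvMat (confMetric φ G) i j y = G y * curvMat G i j y
      + (G y * (pdMat i (connChange φ G j) y + connMat G i y * connChange φ G j y
        - connChange φ G j y * connMat G i y)
      - G y * (pdMat j (connChange φ G i) y + connMat G j y * connChange φ G i y
        - connChange φ G i y * connMat G j y))
      + (connChangeLow φ G i y * connChange φ G j y
        - connChangeLow φ G j y * connChange φ G i y) := by
    rw [← hG.mul_connChange hy, ← hG.mul_connChange hy]
    simp only [curvMat, hG.connMat_conf hφ hy, (hc j).1, (hc i).2]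
    noncomm_ring
  have e' : (confMetric φ G y * curvMat (confMetric φ G) i j y) l k =
      φ y * (G y * curvMat (confMetric φ G) i j y) l k := by
    rw [confMetric, Matrix.smul_mul]; rfl
  rw [(hG.conf hφ).riemann_eq hy, e', e, Matrix.add_apply, Matrix.add_apply, Matrix.sub_apply,
    Matrix.sub_apply, hG.connChange_deriv hφ hy, hG.connChange_mul hy, hG.connChange_mul hy,
    hG.riemann_eq hy]
  congr 1
  simp only [knProd, schoutenChange, Matrix.of_apply]
  rw [hG.symm hy l i, hG.symm hy l j, hG.symm hy j i]
  ring

end SmoothMetricOn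

end Conformal

/-! ### Conformal changes of the Ricci, Schouten and Weyl tensors -/

section ConformalWeyl

variable {n : ℕ} {G : MetricComp n} {Ω : Set (Coord n)} {φ : Coord n → ℝ} {y : Coord n}

/-- `halfDLog φ` as a tensor field. -/
def dlogForm (φ : Coord n → ℝ) : Tensor n 1 := fun y J => halfDLog φ (J 0) y

/-- `W(·,·,·,θ♯)`. -/
def weylContr (G : MetricComp n) (θ : Tensor n 1) : Tensor n 3 := fun y J =>
  ∑ l, ∑ k, inv G y l k * (weyl G y ![J 0, J 1, J 2, l] * θ y ![k])

theorem weylContr_apply (θ : Tensor n 1) (i j k : Fin n) : weylContr G θ y ![i, j, k] =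
    ∑ l, ∑ m, inv G y l m * (weyl G y ![i, j, k, l] * θ y ![m]) := rfl

theorem weylContr_add (θ η : Tensor n 1) (J : Fin 3 → Fin n) :
    weylContr G (fun z K => θ z K + η z K) y J = weylContr G θ y J + weylContr G η y J := by
  simp only [weylContr, mul_add, Finset.sum_add_distrib]

theorem weylContr_sub (θ η : Tensor n 1) (J : Fin 3 → Fin n) :
    weylContr G (fun z K => θ z K - η z K) y J = weylContr G θ y J - weylContr G η y J := by
  simp only [weylContr, mul_sub, Finset.sum_sub_distrib]

theorem weylContr_halfGradLog (i j k : Fin n) : weylContr G (dlogForm φ) y ![i, j, k] =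
    ∑ l, halfGradLog φ G l y * weyl G y ![i, j, k, l] := by
  simp only [weylContr_apply, halfGradLog, Finset.sum_mul]
  exact Finset.sum_congr rfl fun l _ => Finset.sum_congr rfl fun m _ => by
    simp [dlogForm]; ring

namespace SmoothMetricOn

theorem ricci_conf (hG : SmoothMetricOn G Ω) (hφ : ConfFactorOn φ Ω) (hy : y ∈ Ω) (i j : Fin n) :
    ricci (confMetric φ G) y ![i, j] = ricci G y ![i, j] - (((n : ℝ) - 2) * schoutenChange φ G y i j
      + (∑ a, ∑ b, inv G y a b * schoutenChange φ G y a b) * G y i j) := by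
  have hp := (hφ.pos y hy).ne'
  rw [← trace_knProd (hG.inv_mul hy) (hG.inv_symm hy) (hG.symm hy), ricci_apply, ricci_apply]
  simp only [← Finset.sum_sub_distrib]
  refine Finset.sum_congr rfl fun a _ => Finset.sum_congr rfl fun b _ => ?_
  rw [hG.inv_conf_apply hφ hy, hG.riemann_conf hφ hy]
  field_simp

theorem scalar_conf (hG : SmoothMetricOn G Ω) (hφ : ConfFactorOn φ Ω) (hy : y ∈ Ω) :
    scalar (confMetric φ G) y = (φ y)⁻¹ * (scalar G y
      - 2 * ((n : ℝ) - 1) * ∑ a, ∑ b, inv G y a b * schoutenChange φ G y a b) := by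
  set t := ∑ a, ∑ b, inv G y a b * schoutenChange φ G y a b with ht
  have e : ∀ a b, inv (confMetric φ G) y a b * ricci (confMetric φ G) y ![a, b] =
      (φ y)⁻¹ * (inv G y a b * ricci G y ![a, b]
        - ((n : ℝ) - 2) * (inv G y a b * schoutenChange φ G y a b)
        - t * (inv G y a b * G y a b)) := fun a b => by
    rw [hG.inv_conf_apply hφ hy, hG.ricci_conf hφ hy, ← ht]; ring
  simp only [scalar, trace, e, ← Finset.mul_sum, Finset.sum_sub_distrib]
  rw [sum_inv_metric_self (hG.inv_mul hy) (hG.symm hy), ← ht]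
  ring

theorem schouten_conf (hn : 4 ≤ n) (hG : SmoothMetricOn G Ω) (hφ : ConfFactorOn φ Ω) (hy : y ∈ Ω)
    (i j : Fin n) :
    schouten (confMetric φ G) y ![i, j] = schouten G y ![i, j] - schoutenChange φ G y i j := by
  have hn' : (4 : ℝ) ≤ n := by exact_mod_cast hn
  have hp := (hφ.pos y hy).ne'
  have h1 : (n : ℝ) - 2 ≠ 0 := by linarith
  have h2 : (n : ℝ) - 1 ≠ 0 := by linarith
  rw [schouten_apply, schouten_apply, hG.ricci_conf hφ hy, hG.scalar_conf hφ hy, confMetric_apply]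
  field_simp
  ring

/-- The Schouten tensor changes by exactly the tensor subtracted in `riemann_conf`, so the two
corrections cancel. -/
theorem weyl_conf (hn : 4 ≤ n) (hG : SmoothMetricOn G Ω) (hφ : ConfFactorOn φ Ω) (hy : y ∈ Ω)
    (i j k l : Fin n) : weyl (confMetric φ G) y ![i, j, k, l] = φ y * weyl G y ![i, j, k, l] := by
  rw [weyl_apply, weyl_apply, hG.riemann_conf hφ hy]
  simp only [knProd, hG.schouten_conf hn hφ hy, confMetric_apply]
  ring

/-- Ensures that both metrics have the same regular points. -/
theorem weylNull_conf (hn : 4 ≤ n) (hG : SmoothMetricOn G Ω) (hφ : ConfFactorOn φ Ω) (hy : y ∈ Ω) :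
    weylNull (confMetric φ G) y = weylNull G y := by
  have hp := (hφ.pos y hy).ne'
  ext v
  change (∀ j k l, ∑ i, v i * weyl (confMetric φ G) y ![i, j, k, l] = 0) ↔
    (∀ j k l, ∑ i, v i * weyl G y ![i, j, k, l] = 0)
  simp only [hG.weyl_conf hn hφ hy, mul_left_comm _ (φ y), ← Finset.mul_sum, mul_eq_zero, hp,
    false_or]

theorem weylContr_conf (hn : 4 ≤ n) (hG : SmoothMetricOn G Ω) (hφ : ConfFactorOn φ Ω) (hy : y ∈ Ω)
    (θ : Tensor n 1) : weylContr (confMetric φ G) θ y = weylContr G θ y := by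
  have hp := (hφ.pos y hy).ne'
  funext J
  refine Finset.sum_congr rfl fun l _ => Finset.sum_congr rfl fun k _ => ?_
  rw [hG.weyl_conf hn hφ hy, hG.inv_conf_apply hφ hy]
  field_simp

/-- One factor `φ` from `W` against two factors `φ⁻¹` from the inverse metrics: this is the source
of the weight. -/
theorem weylOp_conf (hn : 4 ≤ n) (hG : SmoothMetricOn G Ω) (hφ : ConfFactorOn φ Ω) (hy : y ∈ Ω)
    (b : (Fin 2 → Fin n) → ℝ) (J : Fin 2 → Fin n) :
    weylOp (confMetric φ G) y b J = (φ y)⁻¹ * weylOp G y b J := by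
  have hp := (hφ.pos y hy).ne'
  simp only [weylOp, Finset.mul_sum]
  refine Finset.sum_congr rfl fun i _ => Finset.sum_congr rfl fun j _ =>
    Finset.sum_congr rfl fun a _ => Finset.sum_congr rfl fun c _ => ?_
  rw [hG.weyl_conf hn hφ hy, hG.inv_conf_apply hφ hy, hG.inv_conf_apply hφ hy]
  field_simp

/-- The coefficient of `α_h W` is `2`, from differentiating `φ`, minus `1` for each of the four
slots. -/
theorem covDeriv_weyl_conf (hn : 4 ≤ n) (hG : SmoothMetricOn G Ω) (hφ : ConfFactorOn φ Ω)
    (hy : y ∈ Ω) (h i j k l : Fin n) :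
    covDeriv (confMetric φ G) (weyl (confMetric φ G)) y ![h, i, j, k, l] =
      φ y * (covDeriv G (weyl G) y ![h, i, j, k, l] - 2 * halfDLog φ h y * weyl G y ![i, j, k, l]
        - halfDLog φ i y * weyl G y ![h, j, k, l] - halfDLog φ j y * weyl G y ![i, h, k, l]
        - halfDLog φ k y * weyl G y ![i, j, h, l] - halfDLog φ l y * weyl G y ![i, j, k, h]
        + G y h i * (∑ m, halfGradLog φ G m y * weyl G y ![m, j, k, l])
        + G y h j * (∑ m, halfGradLog φ G m y * weyl G y ![i, m, k, l])
        + G y h k * (∑ m, halfGradLog φ G m y * weyl G y ![i, j, m, l])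
        + G y h l * (∑ m, halfGradLog φ G m y * weyl G y ![i, j, k, m])) := by
  have e : pd h (fun z => weyl (confMetric φ G) z ![i, j, k, l]) y =
      2 * φ y * halfDLog φ h y * weyl G y ![i, j, k, l]
        + φ y * pd h (fun z => weyl G z ![i, j, k, l]) y := by
    rw [pd_congr h (Filter.eventually_of_mem (hG.mem_nhds hy) fun z hz =>
      hG.weyl_conf hn hφ hz i j k l), pd_mul h ((hφ.smooth y hy).differentiableAt (by simp))
      ((hG.smooth_weyl hy i j k l).differentiableAt (by simp)), hφ.pd_eq hy]
  have s : ∀ (a : Fin n) (f : Fin n → ℝ), ∑ m, christoffel (confMetric φ G) m h a y * (φ y * f m) =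
      φ y * (∑ m, christoffel G m h a y * f m + halfDLog φ a y * f h + halfDLog φ h y * f a
        - G y h a * ∑ m, halfGradLog φ G m y * f m) := fun a f => by
    rw [← hG.sum_christoffel_conf hφ hy, Finset.mul_sum]
    exact Finset.sum_congr rfl fun m _ => by ring
  rw [covDeriv_four, e]
  simp only [hG.weyl_conf hn hφ hy]
  rw [s i fun m => weyl G y ![m, j, k, l], s j fun m => weyl G y ![i, m, k, l],
    s k fun m => weyl G y ![i, j, m, l], s l fun m => weyl G y ![i, j, k, m], covDeriv_four]
  ring

/-- Contraction leaves multiples of `W(α)` only: `n` from the metric trace, `-2` from the term `α_h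
W`, and `-1` from the last slot. All else is a trace of `W` or cancels by the first Bianchi
identity. -/
theorem divWeyl_conf (hn : 4 ≤ n) (hG : SmoothMetricOn G Ω) (hφ : ConfFactorOn φ Ω)
    (hy : y ∈ Ω) (i j k : Fin n) : divWeyl (confMetric φ G) y ![i, j, k] =
      divWeyl G y ![i, j, k] + ((n : ℝ) - 3) * weylContr G (dlogForm φ) y ![i, j, k] := by
  have hp := (hφ.pos y hy).ne'
  have w := hG.isCurvatureLike_weyl hy
  have hH := hG.inv_symm hy
  have hHg := hG.inv_mul hy
  rw [weylContr_halfGradLog]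
  set V1 : Fin n → ℝ := fun l => ∑ m, halfGradLog φ G m y * weyl G y ![m, j, k, l] with hV1
  set V2 : Fin n → ℝ := fun l => ∑ m, halfGradLog φ G m y * weyl G y ![i, m, k, l] with hV2
  set V3 : Fin n → ℝ := fun l => ∑ m, halfGradLog φ G m y * weyl G y ![i, j, m, l] with hV3
  set V4 := ∑ m, halfGradLog φ G m y * weyl G y ![i, j, k, m] with hV4
  have e : ∀ h l, inv (confMetric φ G) y h l *
      covDeriv (confMetric φ G) (weyl (confMetric φ G)) y ![h, i, j, k, l] =
      inv G y h l * covDeriv G (weyl G) y ![h, i, j, k, l]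
      - 2 * (inv G y h l * (halfDLog φ h y * weyl G y ![i, j, k, l]))
      - halfDLog φ i y * (inv G y h l * weyl G y ![h, j, k, l])
      + halfDLog φ j y * (inv G y h l * weyl G y ![h, i, k, l])
      - halfDLog φ k y * (inv G y h l * weyl G y ![i, j, h, l])
      - inv G y h l * (halfDLog φ l y * weyl G y ![i, j, k, h])
      + inv G y h l * (G y h i * V1 l) + inv G y h l * (G y h j * V2 l)
      + inv G y h l * (G y h k * V3 l) + inv G y h l * G y h l * V4 := fun h l => by
    rw [hG.inv_conf_apply hφ hy, hG.covDeriv_weyl_conf hn hφ hy, w.swap_left i h k l]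
    simp only [hV1, hV2, hV3, hV4]
    field_simp
    ring
  rw [divWeyl, divergence_three_four]
  simp only [e, Finset.sum_add_distrib, Finset.sum_sub_distrib, ← Finset.mul_sum, ← Finset.sum_mul]
  rw [hG.trace_weyl hn hy, hG.trace_weyl hn hy, sum_inv_metric_left hHg hH V1,
    sum_inv_metric_left hHg hH V2, sum_inv_metric_left hHg hH V3,
    sum_inv_metric_self hHg (hG.symm hy)]
  have a1 : ∑ h, ∑ l, inv G y h l * (halfDLog φ h y * weyl G y ![i, j, k, l]) = V4 := by
    rw [hV4, Finset.sum_comm]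
    refine Finset.sum_congr rfl fun l _ => ?_
    rw [halfGradLog, Finset.sum_mul]
    exact Finset.sum_congr rfl fun h _ => by rw [hH h l]; ring
  have a2 : ∑ h, ∑ l, inv G y h l * (halfDLog φ l y * weyl G y ![i, j, k, h]) = V4 := by
    rw [hV4]
    refine Finset.sum_congr rfl fun l _ => ?_
    rw [halfGradLog, Finset.sum_mul]
    exact Finset.sum_congr rfl fun h _ => by ring
  -- `W` is skew in its last two slots and the inverse metric is symmetric.
  have a3 : ∑ h, ∑ l, inv G y h l * weyl G y ![i, j, h, l] = 0 := by
    have : ∑ h, ∑ l, inv G y h l * weyl G y ![i, j, h, l] =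
        -∑ h, ∑ l, inv G y h l * weyl G y ![i, j, h, l] := by
      conv_lhs => rw [Finset.sum_comm]
      simp only [← Finset.sum_neg_distrib]
      refine Finset.sum_congr rfl fun l _ => Finset.sum_congr rfl fun h _ => ?_
      rw [hH, w.swap_right i j l h]; ring
    linarith
  -- After rearrangement by the symmetries of `W`, this is the first Bianchi identity.
  have a4 : V1 i + V2 j + V3 k = 0 := by
    simp only [hV1, hV2, hV3, ← Finset.sum_add_distrib]
    refine Finset.sum_eq_zero fun m _ => ?_
    rw [← mul_add, ← mul_add]
    have c := w.cyclic i j k m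
    have s1 := w.pair_symm k i m j
    have s2 := w.swap_right k i m j
    have s3 := w.pair_symm i m k j
    have s4 := w.swap_left j k i m
    have s5 := w.swap_right i j k m
    have : weyl G y ![m, j, k, i] + weyl G y ![i, m, k, j] + weyl G y ![i, j, m, k] = 0 := by
      linarith
    rw [this, mul_zero]
  have a5 : ∑ h, ∑ l, inv G y h l * covDeriv G (weyl G) y ![h, i, j, k, l] =
      divWeyl G y ![i, j, k] := by
    rw [divWeyl, divergence_three_four]
  rw [a1, a2, a3, a5]
  linear_combination a4

end SmoothMetricOn

end ConformalWeyl

/-! ### The Weyl operator -/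

section WeylOp

variable {n : ℕ} {G : MetricComp n} {Ω : Set (Coord n)} {y : Coord n}

theorem weylOp_add (b c : (Fin 2 → Fin n) → ℝ) (J : Fin 2 → Fin n) :
    weylOp G y (fun K => b K + c K) J = weylOp G y b J + weylOp G y c J := by
  simp only [weylOp, add_mul, Finset.sum_add_distrib]

theorem weylOp_const_mul (r : ℝ) (b : (Fin 2 → Fin n) → ℝ) (J : Fin 2 → Fin n) :
    weylOp G y (fun K => r * b K) J = r * weylOp G y b J := by
  simp only [weylOp, mul_assoc, ← Finset.mul_sum]

theorem weylOp_zero (J : Fin 2 → Fin n) : weylOp G y (fun _ => 0) J = 0 := by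
  simp [weylOp]

theorem weylOp_apply (b : (Fin 2 → Fin n) → ℝ) (p q : Fin n) : weylOp G y b ![p, q] =
    ∑ i, ∑ j, b ![i, j] * ∑ a, ∑ c, inv G y i a * inv G y j c * weyl G y ![c, p, q, a] := rfl

namespace SmoothMetricOn

/-- This is the reversal symmetry `W(X,Y,Z,T) = W(T,Z,Y,X)`. -/
theorem weylOp_transpose (hG : SmoothMetricOn G Ω) (hy : y ∈ Ω) (b : (Fin 2 → Fin n) → ℝ)
    (p q : Fin n) : weylOp G y (fun K => b ![K 1, K 0]) ![p, q] = weylOp G y b ![q, p] := by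
  rw [weylOp_apply, weylOp_apply, Finset.sum_comm]
  refine Finset.sum_congr rfl fun i _ => Finset.sum_congr rfl fun j _ => ?_
  congr 1
  rw [Finset.sum_comm]
  refine Finset.sum_congr rfl fun a _ => Finset.sum_congr rfl fun c _ => ?_
  rw [(hG.isCurvatureLike_weyl hy).reverse c q p a]
  ring

/-- `𝒲(g)` is a trace of `W`. Consequently every multiple of `g` may be dropped under `𝒲`. -/
theorem weylOp_metric (hn : 4 ≤ n) (hG : SmoothMetricOn G Ω) (hy : y ∈ Ω) (J : Fin 2 → Fin n) :
    weylOp G y (metricTensor G y) J = 0 := by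
  have e : ∀ j, ∑ i, metricTensor G y ![i, j] * ∑ a, ∑ c,
      inv G y i a * inv G y j c * weyl G y ![c, J 0, J 1, a] =
      ∑ c, inv G y j c * weyl G y ![c, J 0, J 1, j] := fun j => by
    have := sum_inv_metric_left (hG.inv_mul hy) (hG.inv_symm hy)
      (fun a => ∑ c, inv G y j c * weyl G y ![c, J 0, J 1, a]) j
    rw [← this]
    refine Finset.sum_congr rfl fun i _ => ?_
    rw [Finset.mul_sum]
    refine Finset.sum_congr rfl fun a _ => ?_
    rw [Finset.mul_sum, Finset.mul_sum, Finset.mul_sum]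
    refine Finset.sum_congr rfl fun c _ => ?_
    simp [metricTensor]
    ring
  rw [weylOp, Finset.sum_comm]
  simp only [e]
  rw [← hG.trace_weyl hn hy (J 0) (J 1), Finset.sum_comm]
  exact Finset.sum_congr rfl fun c _ => Finset.sum_congr rfl fun j _ => by rw [hG.inv_symm hy]

/-- It makes `𝒲(θ ⊗ η)` depend on `η` through `W(η)` alone, so that products with a factor from the
kernel vanish. -/
theorem weylOp_prod_left (θ : Fin n → ℝ) (η : Tensor n 1) (hG : SmoothMetricOn G Ω) (hy : y ∈ Ω)
    (p q : Fin n) : weylOp G y (fun K => θ (K 0) * η y ![K 1]) ![p, q] =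
      ∑ i, ∑ a, inv G y i a * (θ i * weylContr G η y ![a, q, p]) := by
  rw [weylOp_apply]
  refine Finset.sum_congr rfl fun i _ => ?_
  simp only [weylContr_apply, Finset.mul_sum]
  rw [Finset.sum_comm]
  refine Finset.sum_congr rfl fun a _ => ?_
  rw [Finset.sum_comm]
  refine Finset.sum_congr rfl fun c _ => Finset.sum_congr rfl fun j _ => ?_
  rw [(hG.isCurvatureLike_weyl hy).reverse c p q a, hG.inv_symm hy j c]
  simp
  ring

theorem weylOp_prod_right_eq_zero (hG : SmoothMetricOn G Ω) (hy : y ∈ Ω) (θ : Fin n → ℝ)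
    {η : Tensor n 1} (hη : weylContr G η y = 0) (J : Fin 2 → Fin n) :
    weylOp G y (fun K => θ (K 0) * η y ![K 1]) J = 0 := by
  rw [eta_two J, weylOp_prod_left θ η hG hy]
  simp [hη]

theorem weylOp_prod_left_eq_zero (hG : SmoothMetricOn G Ω) (hy : y ∈ Ω) (θ : Fin n → ℝ)
    {η : Tensor n 1} (hη : weylContr G η y = 0) (J : Fin 2 → Fin n) :
    weylOp G y (fun K => η y ![K 0] * θ (K 1)) J = 0 := by
  rw [eta_two J, ← hG.weylOp_prod_right_eq_zero hy θ hη ![J 1, J 0], ← hG.weylOp_transpose hy]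
  congr 1
  funext K
  simp [mul_comm]

/-- Leibniz rule for a contraction with the parallel inverse metric. -/
theorem covDeriv_weylContr (hG : SmoothMetricOn G Ω) (hy : y ∈ Ω) {θ : Tensor n 1}
    (hθ : ∀ k, DifferentiableAt ℝ (fun z => θ z ![k]) y) (h a b c : Fin n) :
    covDeriv G (weylContr G θ) y ![h, a, b, c] = ∑ l, ∑ k, inv G y l k *
      (covDeriv G (weyl G) y ![h, a, b, c, l] * θ y ![k]
        + weyl G y ![a, b, c, l] * covDeriv G θ y ![h, k]) := by
  have dw := fun i j k l => (hG.smooth_weyl hy i j k l).differentiableAt (n := ∞) (by simp)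
  have e : pd h (fun z => weylContr G θ z ![a, b, c]) y = _ :=
    hG.pd_trace hy h (F := fun l k z => weyl G z ![a, b, c, l] * θ z ![k])
      fun l k => (dw a b c l).fun_mul (hθ k)
  have s : ∀ (u : Fin n → ℝ) (A : Fin n → Fin n → ℝ),
      ∑ m, u m * (∑ l, ∑ k, inv G y l k * (A m l * θ y ![k])) =
      ∑ l, ∑ k, inv G y l k * ((∑ m, u m * A m l) * θ y ![k]) := fun u A => by
    simp only [Finset.mul_sum, Finset.sum_mul]
    rw [Finset.sum_comm]
    refine Finset.sum_congr rfl fun l _ => ?_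
    rw [Finset.sum_comm]
    exact Finset.sum_congr rfl fun k _ => Finset.sum_congr rfl fun m _ => by ring
  rw [covDeriv_three, e]
  simp only [weylContr_apply]
  rw [s (fun m => christoffel G m h a y) fun m l => weyl G y ![m, b, c, l],
    s (fun m => christoffel G m h b y) fun m l => weyl G y ![a, m, c, l],
    s (fun m => christoffel G m h c y) fun m l => weyl G y ![a, b, m, l]]
  simp only [← Finset.sum_sub_distrib]
  refine Finset.sum_congr rfl fun l _ => Finset.sum_congr rfl fun k _ => ?_
  rw [pd_mul h (dw a b c l) (hθ k), covDeriv_four, covDeriv_one]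
  have s1 : ∑ m, christoffel G m h l y * (weyl G y ![a, b, c, m] * θ y ![k]) =
      (∑ m, christoffel G m h l y * weyl G y ![a, b, c, m]) * θ y ![k] := by
    rw [Finset.sum_mul]; exact Finset.sum_congr rfl fun _ _ => by ring
  have s2 : ∑ m, christoffel G m h k y * (weyl G y ![a, b, c, l] * θ y ![m]) =
      weyl G y ![a, b, c, l] * ∑ m, christoffel G m h k y * θ y ![m] := by
    rw [Finset.mul_sum]; exact Finset.sum_congr rfl fun _ _ => by ring
  rw [s1, s2]
  ring

/-- The divergence falls either on `W`, which by reversal symmetry gives `δW` contracted with `θ`,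
or on `θ`, which gives the transpose of `𝒲(∇θ)`. It is applied to `(n-3) 𝕋*` to compute `B̂_𝕋`, and
to `ν` to show `𝒲(∇ν) = 0`. -/
theorem divergence_weylContr (hG : SmoothMetricOn G Ω) (hy : y ∈ Ω) {θ : Tensor n 1}
    (hθ : ∀ k, DifferentiableAt ℝ (fun z => θ z ![k]) y) (b c : Fin n) :
    divergence G 0 (weylContr G θ) y ![b, c] =
      ∑ l, ∑ k, inv G y l k * (divWeyl G y ![l, c, b] * θ y ![k])
        + weylOp G y (covDeriv G θ y) ![c, b] := by
  have e1 : ∑ h, ∑ a, inv G y h a * ∑ l, ∑ k, inv G y l k *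
      (covDeriv G (weyl G) y ![h, a, b, c, l] * θ y ![k]) =
      ∑ l, ∑ k, inv G y l k * (divWeyl G y ![l, c, b] * θ y ![k]) := by
    simp only [divWeyl, divergence_three_four, Finset.mul_sum, Finset.sum_mul]
    rw [Finset.sum_congr rfl fun h _ => Finset.sum_comm, Finset.sum_comm]
    refine Finset.sum_congr rfl fun l _ => ?_
    rw [Finset.sum_congr rfl fun h _ => Finset.sum_comm, Finset.sum_comm]
    refine Finset.sum_congr rfl fun k _ => Finset.sum_congr rfl fun h _ =>
      Finset.sum_congr rfl fun a _ => ?_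
    rw [(hG.isCurvatureLike_covDeriv_weyl hy h).reverse a b c l]
    ring
  have e2 : ∑ h, ∑ a, inv G y h a * ∑ l, ∑ k, inv G y l k *
      (weyl G y ![a, b, c, l] * covDeriv G θ y ![h, k]) =
      weylOp G y (covDeriv G θ y) ![c, b] := by
    rw [weylOp_apply]
    refine Finset.sum_congr rfl fun h _ => ?_
    simp only [Finset.mul_sum]
    conv_rhs => rw [Finset.sum_comm]
    refine Finset.sum_congr rfl fun a _ => ?_
    conv_rhs => rw [Finset.sum_comm]
    refine Finset.sum_congr rfl fun l _ => Finset.sum_congr rfl fun k _ => ?_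
    rw [(hG.isCurvatureLike_weyl hy).reverse a b c l, hG.inv_symm hy k l]
    ring
  rw [divergence_zero_three, ← e1, ← e2]
  simp only [hG.covDeriv_weylContr hy hθ, mul_add, Finset.sum_add_distrib]

end SmoothMetricOn

end WeylOp

/-! ### Moore-Penrose inverses of constant rank -/

section MoorePenrose

variable {n : ℕ} {H A P N D : Matrix (Fin n) (Fin n) ℝ}

theorem eq_zero_of_dotProduct_mulVec (hH : H.PosDef) {x : Fin n → ℝ}
    (hx : x ⬝ᵥ H.mulVec x = 0) : x = 0 := by
  by_contra h
  have := hH.dotProduct_mulVec_pos h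
  rw [star_trivial] at this
  exact this.ne' hx

theorem transpose_eq_of_posDef (hH : H.PosDef) : H.transpose = H := by
  have := hH.isHermitian
  rwa [Matrix.IsHermitian, Matrix.conjTranspose_eq_transpose_of_trivial] at this

/-- Uniqueness of the Moore-Penrose inverse, which frees the definition from its choice. For two
such inverses, `AP` and `AQ` are `H`-orthogonal projections onto the same range, and likewise for
`PA` and `QA`. -/
theorem moorePenrose_eq (hH : H.PosDef) (hP : IsMoorePenrose H A P) : moorePenrose H A = P := by
  have hex : ∃ P, IsMoorePenrose H A P := ⟨P, hP⟩
  rw [moorePenrose, dif_pos hex]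
  have hQ := hex.choose_spec
  set Q := hex.choose with hQdef
  have hu : IsUnit H := hH.isUnit
  have e1 : H * (A * Q) = H * (A * P) := by
    have : A * Q = A * P * (A * Q) := by rw [← mul_assoc, hP.mul_mul_left]
    calc H * (A * Q) = H * (A * P) * (A * Q) := by rw [mul_assoc, ← this]
      _ = (A * P).transpose * (H * (A * Q)) := by rw [← hP.symm_left, mul_assoc]
      _ = (A * Q * (A * P)).transpose * H := by
          rw [← hQ.symm_left, Matrix.transpose_mul (A * Q), mul_assoc]
      _ = (A * P).transpose * H := by rw [← mul_assoc (A * Q), hQ.mul_mul_left]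
      _ = H * (A * P) := hP.symm_left
  have e2 : H * (Q * A) = H * (P * A) := by
    calc H * (Q * A) = (Q * A).transpose * H := hQ.symm_right.symm
      _ = (Q * A * (P * A)).transpose * H := by
          rw [mul_assoc Q, ← mul_assoc A, hP.mul_mul_left]
      _ = (P * A).transpose * ((Q * A).transpose * H) := by rw [Matrix.transpose_mul, mul_assoc]
      _ = (P * A).transpose * H * (Q * A) := by rw [hQ.symm_right, mul_assoc]
      _ = H * (P * A * (Q * A)) := by rw [hP.symm_right, mul_assoc]
      _ = H * (P * A) := by rw [mul_assoc P, ← mul_assoc A, hQ.mul_mul_left]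
  have f1 := hu.mul_left_cancel e1
  have f2 := hu.mul_left_cancel e2
  calc Q = Q * A * Q := hQ.mul_mul_right.symm
    _ = P * A * Q := by rw [f2]
    _ = P * A * P := by rw [mul_assoc, f1, ← mul_assoc]
    _ = P := hP.mul_mul_right

theorem isUnit_det_of_mulVec (h : ∀ x, A.mulVec x = 0 → x = 0) : IsUnit A.det := by
  rw [isUnit_iff_ne_zero]
  intro h0
  obtain ⟨v, hv, hv'⟩ := Matrix.exists_mulVec_eq_zero_iff.2 h0
  exact hv (h v hv')

/-- A self-adjoint endomorphism becomes invertible after adding a suitable endomorphism with values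
in its kernel. -/
theorem exists_add_isUnit_det (hH : H.PosDef) (hA : A.transpose * H = H * A) :
    ∃ D : Matrix (Fin n) (Fin n) ℝ, IsUnit (A + D).det ∧
      Module.finrank ℝ D.mulVecLin.range ≤ Module.finrank ℝ A.mulVecLin.ker := by
  -- The endomorphism to add is a linear projection onto the kernel of `A`.
  obtain ⟨p, hp⟩ := LinearMap.exists_leftInverse_of_injective A.mulVecLin.ker.subtype
    (Submodule.ker_subtype _)
  have hp' : ∀ x (hx : A.mulVec x = 0), (p x : Fin n → ℝ) = x := fun x hx =>
    congrArg Subtype.val (LinearMap.congr_fun hp ⟨x, hx⟩)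
  set d : (Fin n → ℝ) →ₗ[ℝ] (Fin n → ℝ) := A.mulVecLin.ker.subtype ∘ₗ p with hd
  have hD : (LinearMap.toMatrix' d).mulVecLin = d := by
    rw [← Matrix.toLin'_apply', Matrix.toLin'_toMatrix']
  refine ⟨LinearMap.toMatrix' d, isUnit_det_of_mulVec fun x hx => ?_, ?_⟩
  · have hdx : (LinearMap.toMatrix' d).mulVec x = p x := LinearMap.congr_fun hD x
    have hpx : A.mulVec (p x) = 0 := (p x).2
    rw [Matrix.add_mulVec, hdx] at hx
    -- From `Ax = -px` one gets `A²x = 0`; self-adjointness then forces `Ax = 0`, and finally `x =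
    -- px = 0`.
    have hAA : A.mulVec (A.mulVec x) = 0 := by
      rw [eq_neg_of_add_eq_zero_left hx, Matrix.mulVec_neg, hpx, neg_zero]
    have hAx : A.mulVec x = 0 := by
      refine eq_zero_of_dotProduct_mulVec hH ?_
      have : A.mulVec x ⬝ᵥ H.mulVec (A.mulVec x) = x ⬝ᵥ H.mulVec (A.mulVec (A.mulVec x)) := by
        rw [Matrix.mulVec_mulVec (A.mulVec x) H A, ← hA, ← Matrix.mulVec_mulVec _ _ H,
          Matrix.dotProduct_mulVec x A.transpose, Matrix.vecMul_transpose]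
      rw [this, hAA, Matrix.mulVec_zero, dotProduct_zero]
    rw [hAx, zero_add, hp' x hAx] at hx
    exact hx
  · rw [hD]
    refine Submodule.finrank_mono ?_
    rintro _ ⟨x, rfl⟩
    exact (p x).2

/-- On `ker A` one has `(A + D)x = Dx`, so `N = (A + D)⁻¹ D` fixes `ker A` pointwise; the rank bound
forces the range of `N` to be no larger. With `D` fixed, `N` describes the kernel by a rational
expression in `A`. -/
theorem kernel_of_add_isUnit_det (hu : IsUnit (A + D).det)
    (hr : Module.finrank ℝ D.mulVecLin.range ≤ Module.finrank ℝ A.mulVecLin.ker) :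
    A * ((A + D)⁻¹ * D) = 0 ∧ ∀ x, A.mulVec x = 0 → ∃ z, ((A + D)⁻¹ * D).mulVec z = x := by
  set N := (A + D)⁻¹ * D with hN
  have hsub : A.mulVecLin.ker ≤ N.mulVecLin.range := fun x hx => by
    have hx' : A.mulVec x = 0 := hx
    refine ⟨x, ?_⟩
    have : (A + D).mulVec x = D.mulVec x := by rw [Matrix.add_mulVec, hx', zero_add]
    change N.mulVec x = x
    rw [hN, ← Matrix.mulVec_mulVec, ← this, Matrix.mulVec_mulVec, Matrix.nonsing_inv_mul _ hu,
      Matrix.one_mulVec]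
  have hle : Module.finrank ℝ N.mulVecLin.range ≤ Module.finrank ℝ A.mulVecLin.ker := by
    refine le_trans ?_ hr
    rw [hN, Matrix.mulVecLin_mul, LinearMap.range_comp]
    exact Submodule.finrank_map_le _ _
  have heq := Submodule.eq_of_le_of_finrank_le hsub hle
  refine ⟨?_, fun x hx => ?_⟩
  · refine Matrix.ext_of_mulVec_single fun i => ?_
    have : N.mulVec (Pi.single i 1) ∈ A.mulVecLin.ker := by rw [heq]; exact ⟨_, rfl⟩
    rw [← Matrix.mulVec_mulVec, Matrix.zero_mulVec]
    exact this
  · have : x ∈ N.mulVecLin.range := hsub hx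
    exact this

/-- The range of `A` is the `H`-orthogonal complement of `ker A`, and `N Nᵀ H` is invertible on `ker
A` and zero on that complement. So `Q = A + N Nᵀ H` is invertible and commutes with `A`, `QA = A²`,
and `Q⁻² A` inverts `A` off its kernel. -/
theorem isMoorePenrose_of_kernel (hH : H.PosDef) (hA : A.transpose * H = H * A) (hAN : A * N = 0)
    (hN : ∀ x, A.mulVec x = 0 → ∃ z, N.mulVec z = x) :
    IsUnit (A + N * N.transpose * H).det ∧ IsMoorePenrose H A
      ((A + N * N.transpose * H)⁻¹ * (A + N * N.transpose * H)⁻¹ * A) := by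
  have hHt := transpose_eq_of_posDef hH
  have hNHA : N.transpose * H * A = 0 := by
    rw [mul_assoc, ← hA, ← mul_assoc, ← Matrix.transpose_mul, hAN, Matrix.transpose_zero, zero_mul]
  set Q := A + N * N.transpose * H with hQ
  have norm : ∀ z, N.mulVec z ⬝ᵥ H.mulVec (N.mulVec z) =
      z ⬝ᵥ (N.transpose * H).mulVec (N.mulVec z) := fun z => by
    rw [← Matrix.mulVec_mulVec, Matrix.dotProduct_mulVec z, Matrix.vecMul_transpose]
  -- Applying `Nᵀ H` to `Qx = 0` removes `Ax` and gives `Nu = 0` for `u = Nᵀ H x`. Thus `x = Nz`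
  -- lies in the kernel, and `u ⬝ᵥ u = 0` makes its `H`-norm vanish.
  have hu : IsUnit Q.det := isUnit_det_of_mulVec fun x hx => by
    set u := (N.transpose * H).mulVec x with hu
    have h1 : A.mulVec x + N.mulVec u = 0 := by
      rw [← hx, hQ, Matrix.add_mulVec, hu, Matrix.mulVec_mulVec, mul_assoc]
    have h2 : (N.transpose * H).mulVec (N.mulVec u) = 0 := by
      have := congrArg (N.transpose * H).mulVec h1
      rwa [Matrix.mulVec_add, Matrix.mulVec_mulVec, hNHA, Matrix.zero_mulVec, zero_add,
        Matrix.mulVec_zero] at this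
    have h3 : N.mulVec u = 0 := eq_zero_of_dotProduct_mulVec hH (by
      rw [norm, h2, dotProduct_zero])
    rw [h3, add_zero] at h1
    obtain ⟨z, rfl⟩ := hN x h1
    have h4 : u ⬝ᵥ u = 0 := by
      have hu' : u = Matrix.vecMul (H.mulVec (N.mulVec z)) N := by
        rw [hu, ← Matrix.mulVec_mulVec, Matrix.mulVec_transpose]
      have : u ⬝ᵥ u = H.mulVec (N.mulVec z) ⬝ᵥ N.mulVec u := by
        rw [Matrix.dotProduct_mulVec (H.mulVec (N.mulVec z)), ← hu']
      rw [this, h3, dotProduct_zero]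
    have h5 : u = 0 := dotProduct_self_eq_zero.1 h4
    exact eq_zero_of_dotProduct_mulVec hH (by rw [norm, ← hu, h5, dotProduct_zero])
  refine ⟨hu, ?_⟩
  have hAQ : A * Q = A * A := by
    rw [hQ, mul_add, mul_assoc N, ← mul_assoc, hAN, zero_mul, add_zero]
  have hQA : Q * A = A * A := by
    rw [hQ, add_mul, mul_assoc N, mul_assoc N, hNHA, mul_zero, add_zero]
  have hHQ : Q.transpose * H = H * Q := by
    rw [hQ, Matrix.transpose_add, add_mul, hA, mul_add]
    simp only [Matrix.transpose_mul, hHt, Matrix.transpose_transpose, mul_assoc]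
  set R := Q⁻¹ with hR
  have hRQ : R * Q = 1 := Matrix.nonsing_inv_mul _ hu
  have hQR : Q * R = 1 := Matrix.mul_nonsing_inv _ hu
  have c : A * R = R * A := by
    calc A * R = R * Q * (A * R) := by rw [hRQ, one_mul]
      _ = R * (Q * A) * R := by simp only [mul_assoc]
      _ = R * (A * Q) * R := by rw [hQA, hAQ]
      _ = R * A * (Q * R) := by simp only [mul_assoc]
      _ = R * A := by rw [hQR, mul_one]
  have hRAA : R * (A * A) = A := by rw [← hQA, ← mul_assoc, hRQ, one_mul]
  have hHR : R.transpose * H = H * R := by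
    have h1 : R.transpose * Q.transpose = 1 := by
      rw [← Matrix.transpose_mul, hQR, Matrix.transpose_one]
    calc R.transpose * H = R.transpose * (H * Q) * R := by
          rw [mul_assoc, mul_assoc, hQR, mul_one]
      _ = H * R := by rw [← hHQ, ← mul_assoc, h1, one_mul]
  have e1 : A * (R * R * A) = R * A := by
    calc A * (R * R * A) = (A * R) * R * A := by simp only [mul_assoc]
      _ = R * A * R * A := by rw [c]
      _ = R * (A * R) * A := by simp only [mul_assoc]
      _ = R * (R * A) * A := by rw [c]
      _ = R * (R * (A * A)) := by simp only [mul_assoc]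
      _ = R * A := by rw [hRAA]
  have e2 : R * R * A * A = R * A := by
    rw [mul_assoc, mul_assoc, hRAA]
  have e3 : (R * A).transpose * H = H * (R * A) := by
    rw [Matrix.transpose_mul, mul_assoc, hHR, ← mul_assoc, hA, mul_assoc, c]
  refine ⟨?_, ?_, ?_, ?_⟩
  · rw [e1, mul_assoc, hRAA]
  · rw [e2, mul_assoc R A, e1, mul_assoc]
  · rw [e1, e3]
  · rw [e2, e3]

/-- `D` is chosen at `y` and kept fixed. Invertibility of `A + D` is an open condition, and
constancy of the kernel dimension keeps the rank bound valid nearby, so one rational formula serves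
on a neighbourhood. -/
theorem exists_smooth_moorePenrose {A H : Coord n → Matrix (Fin n) (Fin n) ℝ} {y : Coord n}
    (hA : SmoothEntriesAt A y) (hH : SmoothEntriesAt H y) (hpd : ∀ᶠ z in 𝓝 y, (H z).PosDef)
    (hsa : ∀ᶠ z in 𝓝 y, (A z).transpose * H z = H z * A z)
    (hr : ∀ᶠ z in 𝓝 y, Module.finrank ℝ (A z).mulVecLin.ker =
      Module.finrank ℝ (A y).mulVecLin.ker) :
    ∃ P : Coord n → Matrix (Fin n) (Fin n) ℝ, SmoothEntriesAt P y ∧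
      ∀ᶠ z in 𝓝 y, IsMoorePenrose (H z) (A z) (P z) := by
  obtain ⟨D, hD, hDr⟩ := exists_add_isUnit_det hpd.self_of_nhds hsa.self_of_nhds
  have hAD : SmoothEntriesAt (fun z => A z + D) y := hA.add (smoothEntriesAt_const D)
  have hN : SmoothEntriesAt (fun z => (A z + D)⁻¹ * D) y :=
    (hAD.inv hD).mul (smoothEntriesAt_const D)
  have hQ : SmoothEntriesAt (fun z => A z + ((A z + D)⁻¹ * D) * ((A z + D)⁻¹ * D).transpose * H z)
      y := hA.add ((hN.mul hN.transpose).mul hH)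
  have hev : ∀ᶠ z in 𝓝 y, IsUnit (A z + D).det := by
    filter_upwards [(contDiffAt_det hAD).continuousAt.eventually_ne hD.ne_zero] with z hz
    exact hz.isUnit
  have key : ∀ᶠ z in 𝓝 y,
      IsUnit (A z + ((A z + D)⁻¹ * D) * ((A z + D)⁻¹ * D).transpose * H z).det ∧
      IsMoorePenrose (H z) (A z)
      ((A z + ((A z + D)⁻¹ * D) * ((A z + D)⁻¹ * D).transpose * H z)⁻¹ *
        (A z + ((A z + D)⁻¹ * D) * ((A z + D)⁻¹ * D).transpose * H z)⁻¹ * A z) := by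
    filter_upwards [hpd, hsa, hr, hev] with z h1 h2 h3 h4
    obtain ⟨k1, k2⟩ := kernel_of_add_isUnit_det h4 (h3 ▸ hDr)
    exact isMoorePenrose_of_kernel h1 h2 k1 k2
  have hQi := hQ.inv key.self_of_nhds.1
  exact ⟨_, (hQi.mul hQi).mul hA, key.mono fun z hz => hz.2⟩

end MoorePenrose

/-! ### The Ricci contraction of the squared Weyl operator -/

section RicciW

open scoped Kronecker

variable {n : ℕ} {G : MetricComp n} {Ω : Set (Coord n)} {y : Coord n}

/-- The tensor field of degree one with constant components `θ`. -/
def constForm (θ : Fin n → ℝ) : Tensor n 1 := fun _ J => θ (J 0)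

theorem weylContr_constForm (θ : Tensor n 1) :
    weylContr G (constForm fun k => θ y ![k]) y = weylContr G θ y := rfl

theorem weylOp_sum {ι : Type*} (s : Finset ι) (b : ι → (Fin 2 → Fin n) → ℝ) (J : Fin 2 → Fin n) :
    weylOp G y (fun K => ∑ a ∈ s, b a K) J = ∑ a ∈ s, weylOp G y (b a) J := by
  induction s using Finset.cons_induction with
  | empty => simpa using weylOp_zero J
  | cons a s ha ih => simp only [Finset.sum_cons, weylOp_add, ih]

theorem ricciW_add (θ η : Fin n → ℝ) : ricciW G y (θ + η) = ricciW G y θ + ricciW G y η := by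
  funext k
  have e : ∀ i : Fin n, wedge (Pi.single i 1) (θ + η) =
      fun K => wedge (Pi.single i 1) θ K + wedge (Pi.single i 1) η K := fun i => by
    funext K; simp only [wedge, Pi.add_apply]; ring
  have e' : ∀ i : Fin n, weylOp G y (wedge (Pi.single i 1) (θ + η)) =
      fun K => weylOp G y (wedge (Pi.single i 1) θ) K
        + weylOp G y (wedge (Pi.single i 1) η) K := fun i => by
    funext K; rw [e, weylOp_add]
  simp only [ricciW, e', weylOp_add, Finset.sum_add_distrib, Pi.add_apply]

theorem ricciW_smul (r : ℝ) (θ : Fin n → ℝ) : ricciW G y (r • θ) = r • ricciW G y θ := by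
  funext k
  have e : ∀ i : Fin n, wedge (Pi.single i 1) (r • θ) =
      fun K => r * wedge (Pi.single i 1) θ K := fun i => by
    funext K; simp only [wedge, Pi.smul_apply, smul_eq_mul]; ring
  have e' : ∀ i : Fin n, weylOp G y (wedge (Pi.single i 1) (r • θ)) =
      fun K => r * weylOp G y (wedge (Pi.single i 1) θ) K := fun i => by
    funext K; rw [e, weylOp_const_mul]
  simp only [ricciW, e', weylOp_const_mul, ← Finset.mul_sum, Pi.smul_apply, smul_eq_mul]

theorem ricciWMatrix_mulVec (θ : Fin n → ℝ) : (ricciWMatrix G y).mulVec θ = ricciW G y θ := by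
  let f : (Fin n → ℝ) →ₗ[ℝ] (Fin n → ℝ) :=
    { toFun := ricciW G y, map_add' := ricciW_add, map_smul' := ricciW_smul }
  have : ricciWMatrix G y = LinearMap.toMatrix' f := by
    ext k m
    rw [LinearMap.toMatrix'_apply]
    rfl
  rw [this, LinearMap.toMatrix'_mulVec]
  rfl

namespace SmoothMetricOn

/-- On two-forms the first Bianchi identity merges the two terms into `W(·,·,η_i♯,θ♯)`. -/
theorem weylOp_wedge_single (hG : SmoothMetricOn G Ω) (hy : y ∈ Ω) (i : Fin n) (θ : Fin n → ℝ)
    (p q : Fin n) : weylOp G y (wedge (Pi.single i 1) θ) ![p, q] =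
      ∑ a, inv G y i a * weylContr G (constForm θ) y ![p, q, a] := by
  have w := hG.isCurvatureLike_weyl hy
  have e1 : wedge (Pi.single i 1) θ =
      fun K => (Pi.single i (1 : ℝ) : Fin n → ℝ) (K 0) * θ (K 1)
        + (-1) * (θ (K 0) * (Pi.single i (1 : ℝ) : Fin n → ℝ) (K 1)) := by
    funext K; simp only [wedge]; ring
  have e2 : weylOp G y (fun K => (Pi.single i (1 : ℝ) : Fin n → ℝ) (K 0) * θ (K 1)) ![p, q] =
      ∑ a, ∑ c, ∑ m, inv G y i a * (inv G y c m * (weyl G y ![c, p, q, a] * θ m)) := by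
    rw [weylOp_apply, Finset.sum_eq_single i]
    · simp only [Finset.mul_sum]
      rw [Finset.sum_comm]
      refine Finset.sum_congr rfl fun a _ => ?_
      rw [Finset.sum_comm]
      refine Finset.sum_congr rfl fun c _ => Finset.sum_congr rfl fun m _ => ?_
      rw [hG.inv_symm hy m c]
      simp
      ring
    · intro j _ hj
      simp [Pi.single_eq_of_ne hj]
    · simp
  have e3 : weylOp G y (fun K => θ (K 0) * (Pi.single i (1 : ℝ) : Fin n → ℝ) (K 1)) ![p, q] =
      ∑ a, ∑ c, ∑ m, inv G y i a * (inv G y c m * (weyl G y ![a, p, q, c] * θ m)) := by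
    rw [weylOp_apply, Finset.sum_comm, Finset.sum_eq_single i]
    · simp only [Finset.mul_sum]
      rw [Finset.sum_congr rfl fun m _ => Finset.sum_comm, Finset.sum_comm]
      refine Finset.sum_congr rfl fun a _ => ?_
      rw [Finset.sum_comm]
      refine Finset.sum_congr rfl fun c _ => Finset.sum_congr rfl fun m _ => ?_
      rw [hG.inv_symm hy m c]
      simp
      ring
    · intro j _ hj
      simp [Pi.single_eq_of_ne hj]
    · simp
  rw [e1, weylOp_add, weylOp_const_mul, e2, e3]
  simp only [weylContr_apply, constForm, Finset.mul_sum, ← Finset.sum_add_distrib]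
  refine Finset.sum_congr rfl fun a _ => Finset.sum_congr rfl fun c _ =>
    Finset.sum_congr rfl fun m _ => ?_
  have : weyl G y ![p, q, a, c] = weyl G y ![c, p, q, a] - weyl G y ![a, p, q, c] := by
    have c1 := w.cyclic p q a c
    have s1 := w.pair_symm c p q a
    have s2 := w.swap_left q a c p
    have s2' := w.swap_right q a c p
    have s3 := w.swap_left a p q c
    linarith [w.pair_symm q a p c, w.swap_right q a p c]
  rw [this]
  simp
  ring

/-- Brings `𝔴(θ)` into the shape of the one-form defining `𝕋`, with `W(θ)` in place of `δW`. -/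
theorem ricciW_eq (hG : SmoothMetricOn G Ω) (hy : y ∈ Ω) (θ : Fin n → ℝ) (k : Fin n) :
    ricciW G y θ k = ∑ i, ∑ a, inv G y i a *
      weylOp G y (fun J => weylContr G (constForm θ) y ![J 0, J 1, a]) ![i, k] := by
  refine Finset.sum_congr rfl fun i _ => ?_
  have e : weylOp G y (wedge (Pi.single i 1) θ) =
      fun J => ∑ a, inv G y i a * weylContr G (constForm θ) y ![J 0, J 1, a] := by
    funext J
    rw [eta_two J, hG.weylOp_wedge_single hy]
    rfl
  rw [e, weylOp_sum]
  exact Finset.sum_congr rfl fun a _ => weylOp_const_mul _ _ _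

theorem divWeylContraction_eq (hG : SmoothMetricOn G Ω) (hy : y ∈ Ω) {θ : Tensor n 1} {r : ℝ}
    (h : ∀ i j k, divWeyl G y ![i, j, k] = r * weylContr G θ y ![i, j, k]) :
    divWeylContraction G y = r • ricciW G y fun k => θ y ![k] := by
  funext k
  simp only [Pi.smul_apply, hG.ricciW_eq hy, divWeylContraction, smul_eq_mul, Finset.mul_sum, h,
    weylOp_const_mul, weylContr_constForm]
  exact Finset.sum_congr rfl fun i _ => Finset.sum_congr rfl fun a _ => by ring

theorem weylContr_swap (hG : SmoothMetricOn G Ω) (hy : y ∈ Ω) (θ : Tensor n 1) (i j k : Fin n) :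
    weylContr G θ y ![j, i, k] = -weylContr G θ y ![i, j, k] := by
  simp only [weylContr_apply, ← Finset.sum_neg_distrib]
  refine Finset.sum_congr rfl fun l _ => Finset.sum_congr rfl fun m _ => ?_
  rw [(hG.isCurvatureLike_weyl hy).swap_left i j k l]; ring

theorem weylContr_cyclic (hG : SmoothMetricOn G Ω) (hy : y ∈ Ω) (θ : Tensor n 1) (i j k : Fin n) :
    weylContr G θ y ![i, j, k] + weylContr G θ y ![j, k, i] + weylContr G θ y ![k, i, j] = 0 := by
  simp only [weylContr_apply, ← Finset.sum_add_distrib]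
  refine Finset.sum_eq_zero fun l _ => Finset.sum_eq_zero fun m _ => ?_
  linear_combination inv G y l m * θ y ![m] * (hG.isCurvatureLike_weyl hy).cyclic i j k l

/-- `weylContr G θ` with all indices raised. -/
def _root_.ConfGeom.weylContrRaised (G : MetricComp n) (y : Coord n) (θ : Fin n → ℝ)
    (s r i : Fin n) : ℝ :=
  ∑ p, ∑ q, ∑ a, inv G y p s * inv G y q r * inv G y i a * weylContr G (constForm θ) y ![p, q, a]

theorem weylContrRaised_swap (hG : SmoothMetricOn G Ω) (hy : y ∈ Ω) (θ : Fin n → ℝ)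
    (s r i : Fin n) : weylContrRaised G y θ r s i = -weylContrRaised G y θ s r i := by
  simp only [weylContrRaised, ← Finset.sum_neg_distrib]
  rw [Finset.sum_comm]
  refine Finset.sum_congr rfl fun p _ => Finset.sum_congr rfl fun q _ =>
    Finset.sum_congr rfl fun a _ => ?_
  rw [hG.weylContr_swap hy _ p q a]; ring

/-- Collects the inverse metrics on `W(θ)`; the slots of the two factors are still permuted, which
`ricciW_pairing` repairs. -/
theorem ricciW_pairing_aux (hG : SmoothMetricOn G Ω) (hy : y ∈ Ω) (θ η : Fin n → ℝ) :
    η ⬝ᵥ (inv G y).mulVec (ricciW G y θ) = -∑ s, ∑ r, ∑ i,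
      weylContrRaised G y θ s r i * weylContr G (constForm η) y ![r, i, s] := by
  have w := hG.isCurvatureLike_weyl hy
  have e1 : ∀ k, ricciW G y θ k = ∑ s, ∑ r, ∑ i, weylContrRaised G y θ s r i *
      weyl G y ![r, i, k, s] := fun k => by
    have e0 : ∀ i a, inv G y i a *
        weylOp G y (fun J => weylContr G (constForm θ) y ![J 0, J 1, a]) ![i, k] =
        ∑ s, ∑ r, ∑ p, ∑ q, inv G y p s * inv G y q r * inv G y i a *
          weylContr G (constForm θ) y ![p, q, a] * weyl G y ![r, i, k, s] := fun i a => by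
      rw [weylOp_apply]
      simp only [Finset.mul_sum]
      rw [Finset.sum_congr rfl fun p _ => Finset.sum_comm, Finset.sum_comm]
      refine Finset.sum_congr rfl fun s _ => ?_
      rw [Finset.sum_congr rfl fun p _ => Finset.sum_comm, Finset.sum_comm]
      refine Finset.sum_congr rfl fun r _ => Finset.sum_congr rfl fun p _ =>
        Finset.sum_congr rfl fun q _ => ?_
      simp
      ring
    rw [hG.ricciW_eq hy]
    simp only [e0, weylContrRaised, Finset.sum_mul]
    rw [Finset.sum_congr rfl fun i _ => Finset.sum_comm, Finset.sum_comm]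
    refine Finset.sum_congr rfl fun s _ => ?_
    rw [Finset.sum_congr rfl fun i _ => Finset.sum_comm, Finset.sum_comm]
    refine Finset.sum_congr rfl fun r _ => Finset.sum_congr rfl fun i _ => ?_
    rw [Finset.sum_comm]
    refine Finset.sum_congr rfl fun p _ => ?_
    rw [Finset.sum_comm]
  have e2 : η ⬝ᵥ (inv G y).mulVec (ricciW G y θ) =
      ∑ k, ∑ m, η k * inv G y k m * ricciW G y θ m := by
    simp only [dotProduct, Matrix.mulVec, Finset.mul_sum, mul_assoc]
  rw [e2]
  simp only [e1, Finset.mul_sum, ← Finset.sum_neg_distrib, weylContr_apply]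
  rw [Finset.sum_congr rfl fun k _ => Finset.sum_comm, Finset.sum_comm]
  refine Finset.sum_congr rfl fun s _ => ?_
  rw [Finset.sum_congr rfl fun k _ => Finset.sum_comm, Finset.sum_comm]
  refine Finset.sum_congr rfl fun r _ => ?_
  rw [Finset.sum_congr rfl fun k _ => Finset.sum_comm, Finset.sum_comm]
  refine Finset.sum_congr rfl fun i _ => ?_
  rw [Finset.sum_comm]
  refine Finset.sum_congr rfl fun m _ => Finset.sum_congr rfl fun k _ => ?_
  rw [w.swap_right r i s m, hG.inv_symm hy k m]
  simp [constForm]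
  ring

/-- The factor `½` is the usual one from the first Bianchi identity: for tensors skew in the first
two slots and cyclic, the cyclically shifted pairing is `-½` times the straight one. -/
theorem ricciW_pairing (hG : SmoothMetricOn G Ω) (hy : y ∈ Ω) (θ η : Fin n → ℝ) :
    η ⬝ᵥ (inv G y).mulVec (ricciW G y θ) = 1 / 2 * ∑ s, ∑ r, ∑ i,
      weylContrRaised G y θ s r i * weylContr G (constForm η) y ![s, r, i] := by
  set X := weylContrRaised G y θ
  set Y := weylContr G (constForm η) y
  have h1 : ∑ s, ∑ r, ∑ i, X s r i * Y ![r, i, s] = -∑ s, ∑ r, ∑ i, X s r i * Y ![s, i, r] := by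
    rw [Finset.sum_comm]
    simp only [← Finset.sum_neg_distrib]
    refine Finset.sum_congr rfl fun s _ => Finset.sum_congr rfl fun r _ =>
      Finset.sum_congr rfl fun i _ => ?_
    have hx : X r s i = -X s r i := hG.weylContrRaised_swap hy θ s r i
    rw [hx]; ring
  have h2 : ∑ s, ∑ r, ∑ i, X s r i * Y ![r, i, s] - ∑ s, ∑ r, ∑ i, X s r i * Y ![s, i, r]
      + ∑ s, ∑ r, ∑ i, X s r i * Y ![s, r, i] = 0 := by
    simp only [← Finset.sum_add_distrib, ← Finset.sum_sub_distrib]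
    refine Finset.sum_eq_zero fun s _ => Finset.sum_eq_zero fun r _ =>
      Finset.sum_eq_zero fun i _ => ?_
    have c := hG.weylContr_cyclic hy (constForm η) s r i
    have d := hG.weylContr_swap hy (constForm η) s i r
    linear_combination X s r i * c + X s r i * (-d)
  rw [hG.ricciW_pairing_aux hy]
  linarith

/-- `weylContr G θ` as a vector. -/
def _root_.ConfGeom.weylContrVec (G : MetricComp n) (y : Coord n) (θ : Fin n → ℝ) :
    Fin n × Fin n × Fin n → ℝ :=
  fun p => weylContr G (constForm θ) y ![p.1, p.2.1, p.2.2]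

/-- Exhibits the pairing as a Gram form for the third Kronecker power of the inverse metric.
Symmetry of that form yields self-adjointness of `𝔴`, positive definiteness yields its kernel. -/
theorem ricciW_pairing_eq (hG : SmoothMetricOn G Ω) (hy : y ∈ Ω) (θ η : Fin n → ℝ) :
    η ⬝ᵥ (inv G y).mulVec (ricciW G y θ) = 1 / 2 * (weylContrVec G y η ⬝ᵥ
      (inv G y ⊗ₖ (inv G y ⊗ₖ inv G y)).mulVec (weylContrVec G y θ)) := by
  rw [hG.ricciW_pairing hy]
  congr 1
  simp only [dotProduct, Matrix.mulVec, Fintype.sum_prod_type, weylContrRaised, weylContrVec,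
    Matrix.kroneckerMap_apply]
  refine Finset.sum_congr rfl fun s _ => Finset.sum_congr rfl fun r _ =>
    Finset.sum_congr rfl fun i _ => ?_
  rw [mul_comm]
  congr 1
  refine Finset.sum_congr rfl fun p _ => Finset.sum_congr rfl fun q _ =>
    Finset.sum_congr rfl fun a _ => ?_
  rw [hG.inv_symm hy p s, hG.inv_symm hy q r]
  ring

theorem ricciWMatrix_selfAdjoint (hG : SmoothMetricOn G Ω) (hy : y ∈ Ω) :
    (ricciWMatrix G y).transpose * inv G y = inv G y * ricciWMatrix G y := by
  set K := inv G y ⊗ₖ (inv G y ⊗ₖ inv G y) with hK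
  have hKt : K.transpose = K := by
    ext p q
    simp only [hK, Matrix.transpose_apply, Matrix.kroneckerMap_apply]
    rw [hG.inv_symm hy q.1, hG.inv_symm hy q.2.1, hG.inv_symm hy q.2.2]
  have hs : ∀ θ η : Fin n → ℝ, η ⬝ᵥ (inv G y * ricciWMatrix G y).mulVec θ =
      θ ⬝ᵥ (inv G y * ricciWMatrix G y).mulVec η := fun θ η => by
    rw [← Matrix.mulVec_mulVec, ← Matrix.mulVec_mulVec, ricciWMatrix_mulVec, ricciWMatrix_mulVec,
      hG.ricciW_pairing_eq hy, hG.ricciW_pairing_eq hy, ← hK, Matrix.dotProduct_mulVec,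
      ← Matrix.mulVec_transpose, hKt, dotProduct_comm]
  have ht : (inv G y * ricciWMatrix G y).transpose = inv G y * ricciWMatrix G y := by
    ext a b
    have := hs (Pi.single a 1) (Pi.single b 1)
    simpa [Matrix.mulVec_single_one] using this
  rw [← ht, Matrix.transpose_mul, hG.inv_transpose hy]

theorem ricciW_eq_zero_iff (hG : SmoothMetricOn G Ω) (hy : y ∈ Ω) (θ : Fin n → ℝ) :
    ricciW G y θ = 0 ↔ weylContr G (constForm θ) y = 0 := by
  constructor
  · intro h
    have hpd : (inv G y ⊗ₖ (inv G y ⊗ₖ inv G y)).PosDef :=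
      (hG.inv_posDef hy).kronecker ((hG.inv_posDef hy).kronecker (hG.inv_posDef hy))
    have h0 := hG.ricciW_pairing_eq hy θ θ
    rw [h, Matrix.mulVec_zero, dotProduct_zero] at h0
    have h1 : weylContrVec G y θ = 0 := by
      by_contra hne
      have := hpd.dotProduct_mulVec_pos hne
      rw [star_trivial] at this
      linarith
    funext J
    rw [eta_three J]
    exact congrFun h1 (J 0, J 1, J 2)
  · intro h
    funext k
    rw [hG.ricciW_eq hy]
    simp only [h, Pi.zero_apply, weylOp_zero, mul_zero, Finset.sum_const_zero]

/-- Raising the index maps the kernel of `𝔴` isomorphically onto the fibre of `ℰ`, so constant rank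
of `ℰ` is constant rank of `𝔴`. -/
theorem finrank_ker_ricciWMatrix (hG : SmoothMetricOn G Ω) (hy : y ∈ Ω) :
    Module.finrank ℝ (ricciWMatrix G y).mulVecLin.ker = Module.finrank ℝ (weylNull G y) := by
  let e : (Fin n → ℝ) ≃ₗ[ℝ] (Fin n → ℝ) :=
    Matrix.toLin'OfInv (hG.mul_inv hy) (hG.inv_mul hy)
  have he : ∀ θ, e θ = (inv G y).mulVec θ := fun θ => rfl
  have key : ∀ θ : Fin n → ℝ, e θ ∈ weylNull G y ↔ θ ∈ (ricciWMatrix G y).mulVecLin.ker :=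
    fun θ => by
    rw [LinearMap.mem_ker, Matrix.mulVecLin_apply, ricciWMatrix_mulVec, hG.ricciW_eq_zero_iff hy,
      he]
    have c : ∀ j k l, ∑ i, (inv G y).mulVec θ i * weyl G y ![i, j, k, l] =
        weylContr G (constForm θ) y ![l, k, j] := fun j k l => by
      rw [weylContr_apply]
      refine Finset.sum_congr rfl fun i _ => ?_
      simp only [Matrix.mulVec, dotProduct, Finset.sum_mul]
      refine Finset.sum_congr rfl fun m _ => ?_
      rw [(hG.isCurvatureLike_weyl hy).reverse i j k l]
      simp [constForm]
      ring
    change (∀ j k l, ∑ i, (inv G y).mulVec θ i * weyl G y ![i, j, k, l] = 0) ↔ _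
    simp only [c]
    refine ⟨fun h => ?_, fun h j k l => by rw [h]; rfl⟩
    funext J
    rw [eta_three J]
    exact h _ _ _
  have hmap : (weylNull G y) = (ricciWMatrix G y).mulVecLin.ker.map (e : _ →ₗ[ℝ] _) := by
    ext v
    rw [Submodule.mem_map]
    constructor
    · intro hv
      refine ⟨e.symm v, (key _).1 (by rwa [e.apply_symm_apply]), e.apply_symm_apply v⟩
    · rintro ⟨θ, hθ, rfl⟩
      exact (key θ).2 hθ
  rw [hmap]
  exact (LinearEquiv.finrank_map_eq e _).symm

theorem smooth_weylOp (hG : SmoothMetricOn G Ω) (hy : y ∈ Ω) {b : Coord n → (Fin 2 → Fin n) → ℝ}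
    (hb : ∀ i j, ContDiffAt ℝ ∞ (fun z => b z ![i, j]) y) (J : Fin 2 → Fin n) :
    ContDiffAt ℝ ∞ (fun z => weylOp G z (b z) J) y :=
  ContDiffAt.sum fun i _ => ContDiffAt.sum fun j _ => (hb i j).mul <|
    ContDiffAt.sum fun a _ => ContDiffAt.sum fun c _ =>
      ((hG.smooth_inv hy i a).mul (hG.smooth_inv hy j c)).mul (hG.smooth_weyl hy c _ _ a)

theorem smooth_ricciWMatrix (hG : SmoothMetricOn G Ω) (hy : y ∈ Ω) :
    SmoothEntriesAt (ricciWMatrix G) y := fun k m => by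
  change ContDiffAt ℝ ∞ (fun z => ∑ i : Fin n,
    weylOp G z (weylOp G z (wedge (Pi.single i 1) (Pi.single m 1))) ![i, k]) y
  exact ContDiffAt.sum fun i _ => hG.smooth_weylOp hy
    (fun p q => hG.smooth_weylOp hy (fun _ _ => contDiffAt_const) ![p, q]) ![i, k]

theorem smooth_divWeyl (hG : SmoothMetricOn G Ω) (hy : y ∈ Ω) (i j k : Fin n) :
    ContDiffAt ℝ ∞ (fun z => divWeyl G z ![i, j, k]) y := by
  have c := fun h m l => hG.smooth_christoffel hy m h l
  have s := hG.smooth_weyl hy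
  simp only [divWeyl, divergence_three_four, covDeriv_four]
  exact ContDiffAt.sum fun a _ => ContDiffAt.sum fun b _ => (hG.smooth_inv hy a b).mul <|
    (((((s i j k b).pd a).sub (ContDiffAt.sum fun m _ => (c _ _ _).mul (s _ _ _ _))).sub
      (ContDiffAt.sum fun m _ => (c _ _ _).mul (s _ _ _ _))).sub
      (ContDiffAt.sum fun m _ => (c _ _ _).mul (s _ _ _ _))).sub
      (ContDiffAt.sum fun m _ => (c _ _ _).mul (s _ _ _ _))

theorem smooth_divWeylContraction (hG : SmoothMetricOn G Ω) (hy : y ∈ Ω) (k : Fin n) :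
    ContDiffAt ℝ ∞ (fun z => divWeylContraction G z k) y :=
  ContDiffAt.sum fun a _ => ContDiffAt.sum fun b _ => (hG.smooth_inv hy a b).mul <|
    hG.smooth_weylOp hy (b := fun z J => divWeyl G z ![J 0, J 1, b])
      (fun i j => hG.smooth_divWeyl hy i j b) ![a, k]

/-- Near a point where the rank of `weylNull` is constant, `tForm` is smooth, and it solves
`divWeyl = (n - 3) W(·,·,·,𝕋)` wherever this equation has a solution. -/
theorem tForm_regular (hn : 4 ≤ n) (hG : SmoothMetricOn G Ω) (hy : y ∈ Ω)
    (hr : ∀ᶠ z in 𝓝 y, Module.finrank ℝ (weylNull G z) = Module.finrank ℝ (weylNull G y)) :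
    (∀ k, ContDiffAt ℝ ∞ (fun z => tForm G z ![k]) y) ∧
    ∀ᶠ z in 𝓝 y, ∀ θ : Tensor n 1,
      (∀ i j k, divWeyl G z ![i, j, k] = ((n : ℝ) - 3) * weylContr G θ z ![i, j, k]) →
      weylContr G (tForm G) z = weylContr G θ z := by
  have hn' : (4 : ℝ) ≤ n := by exact_mod_cast hn
  have hn3 : (n : ℝ) - 3 ≠ 0 := by linarith
  have hΩ : ∀ᶠ z in 𝓝 y, z ∈ Ω := hG.mem_nhds hy
  obtain ⟨P, hP, hPe⟩ := exists_smooth_moorePenrose (hG.smooth_ricciWMatrix hy)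
    (hG.smooth_inv hy) (hΩ.mono fun z hz => hG.inv_posDef hz)
    (hΩ.mono fun z hz => hG.ricciWMatrix_selfAdjoint hz) (by
      filter_upwards [hΩ, hr] with z hz hz'
      rw [hG.finrank_ker_ricciWMatrix hz, hG.finrank_ker_ricciWMatrix hy, hz'])
  have ht : ∀ᶠ z in 𝓝 y, IsMoorePenrose (inv G z) (ricciWMatrix G z) (P z) ∧
      ∀ k, tForm G z ![k] = 1 / ((n : ℝ) - 3) * (P z).mulVec (divWeylContraction G z) k := by
    filter_upwards [hΩ, hPe] with z hz hz'
    refine ⟨hz', fun k => ?_⟩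
    simp only [tForm, moorePenrose_eq (hG.inv_posDef hz) hz']
    rfl
  constructor
  · intro k
    refine ContDiffAt.congr_of_eventuallyEq ?_ (ht.mono fun z hz => hz.2 k)
    change ContDiffAt ℝ ∞ (fun z => 1 / ((n : ℝ) - 3) *
      ∑ m, P z k m * divWeylContraction G z m) y
    exact contDiffAt_const.mul (ContDiffAt.sum fun m _ =>
      (hP k m).mul (hG.smooth_divWeylContraction hy m))
  · filter_upwards [hΩ, ht] with z hz ht θ hθ
    set t : Fin n → ℝ := fun k => tForm G z ![k] with htdef
    set v : Fin n → ℝ := fun k => θ z ![k] with hv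
    -- If `θ` solves the equation, the contraction of `δW` is `(n-3) 𝔴θ`, and the prefactor
    -- `1/(n-3)` cancels.
    have e : t = (P z).mulVec (ricciW G z v) := by
      funext k
      rw [htdef]
      simp only [ht.2, hG.divWeylContraction_eq hz hθ, Matrix.mulVec_smul, Pi.smul_apply,
        smul_eq_mul, ← hv]
      field_simp
    -- From `𝔴 𝔴^# 𝔴 = 𝔴`: the form `𝕋*` differs from `θ` by an element of the kernel of `𝔴`.
    have e1 : ricciW G z t = ricciW G z v := by
      rw [e, ← ricciWMatrix_mulVec, ← ricciWMatrix_mulVec, Matrix.mulVec_mulVec,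
        Matrix.mulVec_mulVec, ht.1.mul_mul_left]
    have e2 : ricciW G z (t + (-1 : ℝ) • v) = 0 := by
      rw [ricciW_add, ricciW_smul, e1, neg_one_smul, add_neg_cancel]
    have e3 := (hG.ricciW_eq_zero_iff hz _).1 e2
    funext J
    have e4 := congrFun e3 J
    have e5 : weylContr G (constForm (t + (-1 : ℝ) • v)) z J =
        weylContr G (tForm G) z J - weylContr G θ z J := by
      rw [← weylContr_sub]
      simp only [weylContr, constForm, Pi.add_apply, Pi.smul_apply, smul_eq_mul, htdef, hv]
      refine Finset.sum_congr rfl fun l _ => Finset.sum_congr rfl fun m _ => ?_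
      simp
      ring_nf
      simp
    rw [e5, Pi.zero_apply] at e4
    linarith

end SmoothMetricOn

end RicciW

/-! ### Conformal invariance in coordinates -/

section Invariance

variable {n : ℕ} {G : MetricComp n} {Ω : Set (Coord n)} {φ : Coord n → ℝ} {y : Coord n}

theorem covDeriv_one_add {θ η : Tensor n 1}
    (hθ : ∀ k, DifferentiableAt ℝ (fun z => θ z ![k]) y)
    (hη : ∀ k, DifferentiableAt ℝ (fun z => η z ![k]) y) (i k : Fin n) :
    covDeriv G (fun z K => θ z K + η z K) y ![i, k] =
      covDeriv G θ y ![i, k] + covDeriv G η y ![i, k] := by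
  simp only [covDeriv_one, pd_add i (hθ k) (hη k), mul_add, Finset.sum_add_distrib]
  ring

theorem covDeriv_one_const_mul {θ : Tensor n 1}
    (hθ : ∀ k, DifferentiableAt ℝ (fun z => θ z ![k]) y) (r : ℝ) (i k : Fin n) :
    covDeriv G (fun z K => r * θ z K) y ![i, k] = r * covDeriv G θ y ![i, k] := by
  simp only [covDeriv_one, pd_const_mul i r (hθ k), mul_left_comm _ r, ← Finset.mul_sum]
  ring

theorem covDeriv_zero {s : ℕ} (J : Fin (s + 1) → Fin n) :
    covDeriv G (fun _ _ => 0 : Tensor n s) y J = 0 := by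
  simp [covDeriv, pd_const]

theorem divergence_zero {s : ℕ} (r : Fin (s + 1)) (J : Fin s → Fin n) :
    divergence G r (fun _ _ => 0 : Tensor n (s + 1)) y J = 0 := by
  simp [divergence, covDeriv_zero]

theorem weylContr_const_mul (θ : Tensor n 1) (r : ℝ) (J : Fin 3 → Fin n) :
    weylContr G (fun z K => r * θ z K) y J = r * weylContr G θ y J := by
  simp only [weylContr, Finset.mul_sum]
  exact Finset.sum_congr rfl fun l _ => Finset.sum_congr rfl fun k _ => by ring

namespace SmoothMetricOn

theorem weylOp_eTensor (hn : 4 ≤ n) (hG : SmoothMetricOn G Ω) (hy : y ∈ Ω) (J : Fin 2 → Fin n) :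
    weylOp G y (eTensor G y) J = weylOp G y (ricci G y) J + ((n : ℝ) - 2) *
      (weylOp G y (covDeriv G (tForm G) y) J
        + weylOp G y (fun K => tForm G y ![K 0] * tForm G y ![K 1]) J) := by
  set r : ℝ := -(scalar G y / n) - ((n : ℝ) - 2) * (1 / (n : ℝ) *
    (trace G (covDeriv G (tForm G)) y + ∑ k, tForm G y ![k] * tVec G y k))
  have e : eTensor G y = fun K => ricci G y K + ((((n : ℝ) - 2) * covDeriv G (tForm G) y K
      + ((n : ℝ) - 2) * (tForm G y ![K 0] * tForm G y ![K 1])) + r * metricTensor G y K) := by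
    funext K
    simp only [eTensor, tracelessRicci, r]
    ring
  rw [e, weylOp_add, weylOp_add, weylOp_add, weylOp_const_mul, weylOp_const_mul, weylOp_const_mul,
    hG.weylOp_metric hn hy]
  ring

theorem sum_tVec_weyl (hG : SmoothMetricOn G Ω) (hy : y ∈ Ω) (b c : Fin n) :
    ∑ i, ∑ l, tVec G y i * tVec G y l * weyl G y ![i, b, c, l] =
      weylOp G y (fun K => tForm G y ![K 0] * tForm G y ![K 1]) ![b, c] := by
  rw [hG.weylOp_prod_left (fun k => tForm G y ![k]) (tForm G) hy]
  have e : ∀ i a, inv G y i a * (tForm G y ![i] * weylContr G (tForm G) y ![a, c, b]) =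
      ∑ l, tForm G y ![i] * inv G y i a * tVec G y l * weyl G y ![l, b, c, a] := fun i a => by
    simp only [weylContr_apply, tVec, Finset.mul_sum, Finset.sum_mul]
    refine Finset.sum_congr rfl fun l _ => Finset.sum_congr rfl fun m _ => ?_
    rw [(hG.isCurvatureLike_weyl hy).reverse l b c a]
    ring
  simp only [e]
  conv_lhs => rw [Finset.sum_comm]
  conv_rhs => rw [Finset.sum_comm]
  refine Finset.sum_congr rfl fun a _ => ?_
  rw [Finset.sum_comm]
  refine Finset.sum_congr rfl fun l _ => ?_
  conv_lhs => rw [tVec.eq_def G y a]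
  simp only [Finset.mul_sum, Finset.sum_mul]
  refine Finset.sum_congr rfl fun i _ => ?_
  rw [hG.inv_symm hy a i]
  ring

/-- Where `C_𝕋` vanishes, `B̂_𝕋` is a multiple of the transpose of `𝒲(E_𝕋)`. -/
theorem bHat_eq (hn : 4 ≤ n) (hG : SmoothMetricOn G Ω) (hy : y ∈ Ω)
    (hT : ∀ k, DifferentiableAt ℝ (fun z => tForm G z ![k]) y)
    (hC : ∀ᶠ z in 𝓝 y, ∀ i j k,
      divWeyl G z ![i, j, k] = ((n : ℝ) - 3) * weylContr G (tForm G) z ![i, j, k]) (b c : Fin n) :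
    bHat G y ![b, c] = ((n : ℝ) - 3) / ((n : ℝ) - 2) * weylOp G y (eTensor G y) ![c, b] := by
  have hn' : (4 : ℝ) ≤ n := by exact_mod_cast hn
  have hn2 : (n : ℝ) - 2 ≠ 0 := by linarith
  have hTT : weylOp G y (fun K => tForm G y ![K 0] * tForm G y ![K 1]) ![c, b] =
      weylOp G y (fun K => tForm G y ![K 0] * tForm G y ![K 1]) ![b, c] := by
    rw [← hG.weylOp_transpose hy]
    congr 1
    funext K
    simp [mul_comm]
  have hric : weylOp G y (ricci G y) ![b, c] = weylOp G y (ricci G y) ![c, b] := by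
    rw [← hG.weylOp_transpose hy]
    congr 1
    funext K
    rw [hG.ricci_symm hy, ← eta_two K]
  have ev : divWeyl G =ᶠ[𝓝 y] weylContr G (fun z K => ((n : ℝ) - 3) * tForm G z K) := by
    filter_upwards [hC] with z hz
    funext J
    rw [weylContr_const_mul, eta_three J, hz]
  have hT' : ∀ k, DifferentiableAt ℝ (fun z => ((n : ℝ) - 3) * tForm G z ![k]) y := fun k =>
    (hT k).const_mul _
  have ediv : divergence G 0 (divWeyl G) y ![b, c] = ((n : ℝ) - 3) ^ 2 *
      weylOp G y (fun K => tForm G y ![K 0] * tForm G y ![K 1]) ![b, c]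
      -- The equation enters twice: once under the divergence, and once to rewrite the `δW` that the
      -- divergence formula produces. Hence the square on `W(𝕋,·,·,𝕋)`; then `(n-3)² - (n-3)(n-4) =
      -- n-3` is the coefficient required by `E_𝕋`.
      + ((n : ℝ) - 3) * weylOp G y (covDeriv G (tForm G) y) ![c, b] := by
    rw [divergence_congr G 0 ev, hG.divergence_weylContr hy hT',
      hG.weylOp_prod_left (fun k => tForm G y ![k]) (tForm G) hy]
    congr 1
    · rw [Finset.sum_comm, Finset.mul_sum]
      refine Finset.sum_congr rfl fun k _ => ?_
      rw [Finset.mul_sum]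
      refine Finset.sum_congr rfl fun l _ => ?_
      rw [hC.self_of_nhds, hG.inv_symm hy l k]
      ring
    · rw [← weylOp_const_mul]
      congr 1
      funext K
      rw [eta_two K, covDeriv_one_const_mul hT]
  rw [hG.weylOp_eTensor hn hy, bHat, ediv]
  have := hG.sum_tVec_weyl hy b c
  simp only [Matrix.cons_val_zero, Matrix.cons_val_one] at this ⊢
  rw [this, hTT, hric]
  field_simp
  ring

theorem covDeriv_one_conf (hG : SmoothMetricOn G Ω) (hφ : ConfFactorOn φ Ω) (hy : y ∈ Ω)
    (θ : Tensor n 1) (i k : Fin n) : covDeriv (confMetric φ G) θ y ![i, k] =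
      covDeriv G θ y ![i, k] - halfDLog φ k y * θ y ![i] - halfDLog φ i y * θ y ![k]
        + (∑ m, halfGradLog φ G m y * θ y ![m]) * G y i k := by
  rw [covDeriv_one, covDeriv_one, hG.sum_christoffel_conf hφ hy i k fun m => θ y ![m]]
  ring

/-- The divergence of `W(ν) = 0` equals `𝒲(∇ν)` up to transposition plus `δW` contracted with `ν`.
The latter is a multiple of `𝒲(ν ⊗ θ)`, hence zero. -/
theorem weylOp_covDeriv_eq_zero (hG : SmoothMetricOn G Ω) (hy : y ∈ Ω) {ν θ : Tensor n 1} {r : ℝ}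
    (hd : ∀ k, DifferentiableAt ℝ (fun z => ν z ![k]) y)
    (hν : ∀ᶠ z in 𝓝 y, weylContr G ν z = 0)
    (hθ : ∀ i j k, divWeyl G y ![i, j, k] = r * weylContr G θ y ![i, j, k]) (J : Fin 2 → Fin n) :
    weylOp G y (covDeriv G ν y) J = 0 := by
  have h0 : divergence G 0 (weylContr G ν) y ![J 1, J 0] = 0 := by
    have ev : weylContr G ν =ᶠ[𝓝 y] (fun _ _ => 0) := hν
    rw [divergence_congr G 0 ev, divergence_zero]
  have h1 := hG.divergence_weylContr hy hd (J 1) (J 0)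
  have h2 : ∑ l, ∑ k, inv G y l k * (divWeyl G y ![l, J 0, J 1] * ν y ![k]) =
      r * weylOp G y (fun K => ν y ![K 0] * θ y ![K 1]) ![J 1, J 0] := by
    rw [hG.weylOp_prod_left (fun k => ν y ![k]) θ hy, Finset.sum_comm, Finset.mul_sum]
    refine Finset.sum_congr rfl fun k _ => ?_
    rw [Finset.mul_sum]
    refine Finset.sum_congr rfl fun l _ => ?_
    rw [hθ, hG.inv_symm hy l k]
    ring
  rw [h0, h2, hG.weylOp_prod_left_eq_zero hy (fun k => θ y ![k]) hν.self_of_nhds, mul_zero,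
    zero_add, ← eta_two J] at h1
  exact h1.symm

/-- The key pointwise computation for the invariance of `𝒲(E_𝕋)`. -/
theorem weylOp_eTensor_conf_aux (hn : 4 ≤ n) (hG : SmoothMetricOn G Ω) (hφ : ConfFactorOn φ Ω)
    (hy : y ∈ Ω) (hT : ∀ k, DifferentiableAt ℝ (fun z => tForm G z ![k]) y)
    (hT' : ∀ k, DifferentiableAt ℝ (fun z => tForm (confMetric φ G) z ![k]) y)
    (hC : ∀ᶠ z in 𝓝 y, ∀ i j k,
      divWeyl G z ![i, j, k] = ((n : ℝ) - 3) * weylContr G (tForm G) z ![i, j, k])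
    (hν : ∀ᶠ z in 𝓝 y, weylContr G (tForm (confMetric φ G)) z =
      weylContr G (fun z K => tForm G z K + dlogForm φ z K) z) (J : Fin 2 → Fin n) :
    weylOp (confMetric φ G) y (eTensor (confMetric φ G) y) J =
      (φ y)⁻¹ * weylOp G y (eTensor G y) J := by
  set T := tForm G with hTdef
  set T' := tForm (confMetric φ G) with hT'def
  set α : Tensor n 1 := dlogForm φ with hα
  have hαd : ∀ k, DifferentiableAt ℝ (fun z => α z ![k]) y := fun k =>
    (hφ.smooth_halfDLog hy k).differentiableAt (by simp)
  -- The defect of the transformation law `𝕋̄* = 𝕋* + α`; it need not vanish, but it lies in the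
  -- kernel.
  set ν : Tensor n 1 := fun z K => T' z K - (T z K + α z K) with hνdef
  have hνd : ∀ k, DifferentiableAt ℝ (fun z => ν z ![k]) y := fun k =>
    (hT' k).sub ((hT k).add (hαd k))
  have hν0 : ∀ᶠ z in 𝓝 y, weylContr G ν z = 0 := by
    filter_upwards [hν] with z hz
    funext J
    rw [hνdef, weylContr_sub, hz, sub_self, Pi.zero_apply]
  have hT'eq : T' = fun z K => T z K + α z K + ν z K := by
    funext z K
    simp only [hνdef]
    ring
  have hcov : ∀ i k, covDeriv G T' y ![i, k] =
      covDeriv G T y ![i, k] + covDeriv G α y ![i, k] + covDeriv G ν y ![i, k] := fun i k => by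
    rw [hT'eq, covDeriv_one_add (fun k => (hT k).add (hαd k)) hνd, covDeriv_one_add hT hαd]
  have hα' : ∀ i k, covDerivForm G (halfDLog φ) i k y = covDeriv G α y ![i, k] := fun i k => by
    rw [covDeriv_one]; rfl
  set t := ∑ a, ∑ b, inv G y a b * schoutenChange φ G y a b with ht
  -- Collects all multiples of `g`, which `𝒲` annihilates.
  set r : ℝ := ((n : ℝ) - 2) * (∑ m, halfGradLog φ G m y * T' y ![m])
    - ((n : ℝ) - 2) * (1 / 2 * halfDLogNormSq φ G y) - t with hr
  -- The `∇α` terms cancel, and `𝕋̄* ⊗ 𝕋̄* - α ⊗ 𝕋̄* - 𝕋̄* ⊗ α + α ⊗ α` completes to the square of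
  -- `𝕋* + ν`.
  have e : (fun K => ricci (confMetric φ G) y K + (((n : ℝ) - 2) * covDeriv (confMetric φ G) T' y K
        + ((n : ℝ) - 2) * (T' y ![K 0] * T' y ![K 1]))) =
      fun K => (ricci G y K + (((n : ℝ) - 2) * covDeriv G T y K
        + ((n : ℝ) - 2) * (T y ![K 0] * T y ![K 1])))
        + (((n : ℝ) - 2) * (covDeriv G ν y K
          + ((T y ![K 0] + ν y ![K 0]) * ν y ![K 1] + ν y ![K 0] * T y ![K 1]))
          + r * metricTensor G y K) := by
    funext K
    rw [eta_two K, hG.ricci_conf hφ hy, hG.covDeriv_one_conf hφ hy, hcov, ← ht]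
    have a : ∀ k, halfDLog φ k y = α y ![k] := fun k => rfl
    have b : ∀ k, T' y ![k] = T y ![k] + α y ![k] + ν y ![k] := fun k =>
      congrFun (congrFun hT'eq y) ![k]
    simp only [schoutenChange, Matrix.of_apply, hα', a, hr, b, metricTensor, Matrix.cons_val_zero,
      Matrix.cons_val_one]
    ring
  have s1 := hG.weylOp_conf hn hφ hy
  have lhs : weylOp (confMetric φ G) y (eTensor (confMetric φ G) y) J = (φ y)⁻¹ *
      weylOp G y (fun K => ricci (confMetric φ G) y K
        + (((n : ℝ) - 2) * covDeriv (confMetric φ G) T' y K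
        + ((n : ℝ) - 2) * (T' y ![K 0] * T' y ![K 1]))) J := by
    rw [(hG.conf hφ).weylOp_eTensor hn hy, s1, s1, s1, weylOp_add, weylOp_add, weylOp_const_mul,
      weylOp_const_mul]
    ring
  have z1 := hG.weylOp_covDeriv_eq_zero hy hνd hν0 hC.self_of_nhds J
  have z2 := hG.weylOp_prod_right_eq_zero hy (fun k => T y ![k] + ν y ![k]) hν0.self_of_nhds J
  have z3 := hG.weylOp_prod_left_eq_zero hy (fun k => T y ![k]) hν0.self_of_nhds J
  rw [lhs, e, weylOp_add, weylOp_add _ (fun K => r * metricTensor G y K), weylOp_const_mul,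
    weylOp_const_mul, weylOp_add (covDeriv G ν y), weylOp_add (fun K => (T y ![K 0] + ν y ![K 0])
      * ν y ![K 1]), z1, z2, z3, hG.weylOp_metric hn hy, hG.weylOp_eTensor hn hy, weylOp_add,
    weylOp_add, weylOp_const_mul, weylOp_const_mul]
  ring

theorem weylSymE_eq (J : Fin 2 → Fin n) (hG : SmoothMetricOn G Ω) (hy : y ∈ Ω) :
    weylSymE G y J = weylOp G y (eTensor G y) ![J 0, J 1]
      + weylOp G y (eTensor G y) ![J 1, J 0] := by
  have e : sym (eTensor G y) = fun K => eTensor G y K + eTensor G y ![K 1, K 0] := by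
    funext K
    rw [sym, ← eta_two K]
  rw [weylSymE, e, weylOp_add]
  conv_lhs => rw [eta_two J]
  rw [hG.weylOp_transpose hy]

/-- Conformal invariance of `B̂_𝕋` and `𝒲(sym E_𝕋)` near a regular point, in coordinates. -/
theorem conformal_invariance (hn : 4 ≤ n) (hG : SmoothMetricOn G Ω) (hφ : ConfFactorOn φ Ω)
    (hy : y ∈ Ω)
    (hr : ∀ᶠ z in 𝓝 y, Module.finrank ℝ (weylNull G z) = Module.finrank ℝ (weylNull G y))
    (hC : ∀ᶠ z in 𝓝 y, ∃ θ : Tensor n 1, ∀ i j k,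
      divWeyl G z ![i, j, k] = ((n : ℝ) - 3) * weylContr G θ z ![i, j, k]) :
    bHat (confMetric φ G) y = (φ y)⁻¹ • bHat G y ∧
      weylSymE (confMetric φ G) y = (φ y)⁻¹ • weylSymE G y := by
  have hΩ : ∀ᶠ z in 𝓝 y, z ∈ Ω := hG.mem_nhds hy
  have hG' := hG.conf hφ
  have hr' : ∀ᶠ z in 𝓝 y, Module.finrank ℝ (weylNull (confMetric φ G) z) =
      Module.finrank ℝ (weylNull (confMetric φ G) y) := by
    filter_upwards [hΩ, hr] with z hz hz'
    rw [hG.weylNull_conf hn hφ hz, hG.weylNull_conf hn hφ hy, hz']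
  obtain ⟨hT, hTe⟩ := hG.tForm_regular hn hy hr
  obtain ⟨hT', hTe'⟩ := hG'.tForm_regular hn hy hr'
  have dT := fun k => (hT k).differentiableAt (by simp)
  have dT' := fun k => (hT' k).differentiableAt (by simp)
  -- The given solutions may vary arbitrarily with the point; they are replaced by the smooth one.
  have hC1 : ∀ᶠ z in 𝓝 y, ∀ i j k,
      divWeyl G z ![i, j, k] = ((n : ℝ) - 3) * weylContr G (tForm G) z ![i, j, k] := by
    filter_upwards [hC, hTe] with z hz hz' i j k
    obtain ⟨θ, hθ⟩ := hz
    rw [hz' θ hθ, hθ]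
  -- `𝕋* + α` solves the equation of the new metric.
  have hC2 : ∀ᶠ z in 𝓝 y, ∀ i j k, divWeyl (confMetric φ G) z ![i, j, k] = ((n : ℝ) - 3) *
      weylContr (confMetric φ G) (fun z K => tForm G z K + dlogForm φ z K) z ![i, j, k] := by
    filter_upwards [hΩ, hC1] with z hz hz' i j k
    rw [hG.divWeyl_conf hn hφ hz, hz', hG.weylContr_conf hn hφ hz, weylContr_add]
    ring
  have hν : ∀ᶠ z in 𝓝 y, weylContr G (tForm (confMetric φ G)) z =
      weylContr G (fun z K => tForm G z K + dlogForm φ z K) z := by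
    filter_upwards [hΩ, hC2, hTe'] with z hz h1 h2
    rw [← hG.weylContr_conf hn hφ hz, ← hG.weylContr_conf hn hφ hz]
    exact h2 _ h1
  have hC3 : ∀ᶠ z in 𝓝 y, ∀ i j k, divWeyl (confMetric φ G) z ![i, j, k] = ((n : ℝ) - 3) *
      weylContr (confMetric φ G) (tForm (confMetric φ G)) z ![i, j, k] := by
    filter_upwards [hC2, hTe'] with z h1 h2 i j k
    rw [h2 _ h1, h1]
  have key := hG.weylOp_eTensor_conf_aux hn hφ hy dT dT' hC1 hν
  constructor
  · funext J
    rw [eta_two J, Pi.smul_apply, hG.bHat_eq hn hy dT hC1, hG'.bHat_eq hn hy dT' hC3, key,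
      smul_eq_mul]
    ring
  · funext J
    rw [Pi.smul_apply, weylSymE_eq J hG hy, weylSymE_eq J hG' hy, key, key, smul_eq_mul]
    ring

/-! ### Einstein metrics -/

/-- Here `𝔨 = f g` with `f` a constant multiple of `S`. The contracted Bianchi identity reads `n df
= df`, so `∇𝔨 = 0`. -/
theorem divWeyl_eq_zero (hn : 4 ≤ n) (hG : SmoothMetricOn G Ω)
    (hE : ∀ z ∈ Ω, tracelessRicci G z = 0) (hy : y ∈ Ω) (i j k : Fin n) :
    divWeyl G y ![i, j, k] = 0 := by
  have hn' : (4 : ℝ) ≤ n := by exact_mod_cast hn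
  set c : ℝ := 1 / ((n : ℝ) - 2) * (1 / n - 1 / (2 * ((n : ℝ) - 1))) with hc
  have hs : ∀ z ∈ Ω, ∀ a b, schouten G z ![a, b] = c * scalar G z * G z a b := fun z hz a b => by
    have h : ricci G z ![a, b] - scalar G z / n * G z a b = 0 :=
      congrFun (hE z hz) ![a, b]
    rw [schouten_apply, sub_eq_zero.1 h, hc]
    ring
  have ds : DifferentiableAt ℝ (fun z => c * scalar G z) y :=
    ((hG.smooth_scalar hy).differentiableAt (by simp)).const_mul c
  have hcov : ∀ h a b, covDeriv G (schouten G) y ![h, a, b] =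
      pd h (fun z => c * scalar G z) y * G y a b := fun h a b => by
    rw [covDeriv_two, pd_congr h (Filter.eventually_of_mem (hG.mem_nhds hy) fun z hz => hs z hz a b),
      pd_mul h ds ((hG.smooth y hy).diff a b), hG.pd_metric hy]
    simp only [hs y hy, mul_left_comm _ (c * scalar G y), ← Finset.mul_sum]
    ring
  obtain ⟨h1, h2⟩ := hG.contracted_bianchi hn hy
  have h0 : ∀ i, pd i (fun z => c * scalar G z) y = 0 := fun i => by
    have e := h1 i
    have e1 : ∑ a, ∑ b, inv G y a b * covDeriv G (schouten G) y ![i, a, b] =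
        pd i (fun z => c * scalar G z) y * n := by
      rw [← sum_inv_metric_self (hG.inv_mul hy) (hG.symm hy)]
      simp only [hcov, mul_left_comm _ (pd i _ _), ← Finset.mul_sum]
    have e2 : ∑ a, ∑ b, inv G y a b * covDeriv G (schouten G) y ![a, i, b] =
        pd i (fun z => c * scalar G z) y := by
      rw [← sum_inv_metric_right (hG.inv_mul hy) (hG.inv_symm hy)
        (fun a => pd a (fun z => c * scalar G z) y) i]
      refine Finset.sum_congr rfl fun a _ => Finset.sum_congr rfl fun b _ => ?_
      rw [hcov, hG.symm hy i b]
      ring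
    rw [e1, e2] at e
    have : pd i (fun z => c * scalar G z) y * ((n : ℝ) - 1) = 0 := by linarith
    rcases mul_eq_zero.1 this with h | h
    · exact h
    · linarith
  rw [h2]
  simp [dNabla, hcov, h0]

theorem tForm_eq_zero (hG : SmoothMetricOn G Ω) (hy : y ∈ Ω)
    (h : ∀ i j k, divWeyl G y ![i, j, k] = 0) (J : Fin 1 → Fin n) : tForm G y J = 0 := by
  have : divWeylContraction G y = 0 := by
    rw [hG.divWeylContraction_eq hy (θ := fun _ _ => 0) (r := 0) (by simpa using h), zero_smul]
  simp [tForm, this]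

theorem weylOp_eTensor_eq_zero (hn : 4 ≤ n) (hG : SmoothMetricOn G Ω)
    (hE : ∀ z ∈ Ω, tracelessRicci G z = 0) (hy : y ∈ Ω) (J : Fin 2 → Fin n) :
    weylOp G y (eTensor G y) J = 0 := by
  have ht : ∀ z ∈ Ω, tForm G z = fun _ => 0 := fun z hz =>
    funext (hG.tForm_eq_zero hz (hG.divWeyl_eq_zero hn hE hz))
  have hc : covDeriv G (tForm G) y = fun _ => 0 := by
    funext K
    have ev : tForm G =ᶠ[𝓝 y] fun _ _ => 0 := Filter.eventually_of_mem (hG.mem_nhds hy) ht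
    rw [covDeriv_congr G ev, covDeriv_zero]
  have hr : ricci G y = fun K => scalar G y / n * metricTensor G y K :=
    funext fun K => sub_eq_zero.1 (congrFun (hE y hy) K)
  rw [hG.weylOp_eTensor hn hy, hc, ht y hy, hr, weylOp_const_mul, hG.weylOp_metric hn hy]
  simp [weylOp_zero]

/-- Vanishing of `B̂_𝕋` and `𝒲(sym E_𝕋)` near a regular point of a conformally Einstein metric, in
coordinates. -/
theorem vanishing_of_conf_einstein (hn : 4 ≤ n) (hG : SmoothMetricOn G Ω) (hφ : ConfFactorOn φ Ω)
    (hy : y ∈ Ω)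
    (hr : ∀ᶠ z in 𝓝 y, Module.finrank ℝ (weylNull G z) = Module.finrank ℝ (weylNull G y))
    (hE : ∀ z ∈ Ω, tracelessRicci (confMetric φ G) z = 0) :
    bHat G y = 0 ∧ weylSymE G y = 0 := by
  have hn' : (4 : ℝ) ≤ n := by exact_mod_cast hn
  have hp := (hφ.pos y hy).ne'
  have hG' := hG.conf hφ
  have hΩ : ∀ᶠ z in 𝓝 y, z ∈ Ω := hG.mem_nhds hy
  have hC : ∀ᶠ z in 𝓝 y, ∃ θ : Tensor n 1, ∀ i j k,
      divWeyl G z ![i, j, k] = ((n : ℝ) - 3) * weylContr G θ z ![i, j, k] := by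
    filter_upwards [hΩ] with z hz
    -- The witness `-α` is read off from `0 = δW + (n-3) W(α)`, the vanishing of `δW` for the
    -- Einstein metric.
    refine ⟨fun z K => (-1) * dlogForm φ z K, fun i j k => ?_⟩
    have h := hG.divWeyl_conf hn hφ hz i j k
    rw [hG'.divWeyl_eq_zero hn hE hz] at h
    rw [weylContr_const_mul]
    linarith
  obtain ⟨h1, h2⟩ := hG.conformal_invariance hn hφ hy hr hC
  have hw := hG'.weylOp_eTensor_eq_zero hn hE hy
  have hb : bHat (confMetric φ G) y = 0 := by
    funext J
    have ev : ∀ z ∈ Ω, tForm (confMetric φ G) z = fun _ => 0 := fun z hz =>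
      funext (hG'.tForm_eq_zero hz (hG'.divWeyl_eq_zero hn hE hz))
    have hT : ∀ k, DifferentiableAt ℝ (fun z => tForm (confMetric φ G) z ![k]) y := fun k =>
      (differentiableAt_const (0 : ℝ)).congr_of_eventuallyEq
        (Filter.eventually_of_mem (hG.mem_nhds hy) fun z hz => congrFun (ev z hz) ![k])
    have hC' : ∀ᶠ z in 𝓝 y, ∀ i j k, divWeyl (confMetric φ G) z ![i, j, k] = ((n : ℝ) - 3) *
        weylContr (confMetric φ G) (tForm (confMetric φ G)) z ![i, j, k] := by
      -- Both sides vanish for the Einstein metric.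
      filter_upwards [hΩ] with z hz i j k
      rw [hG'.divWeyl_eq_zero hn hE hz]
      simp [weylContr_apply, ev z hz]
    rw [eta_two J, hG'.bHat_eq hn hy hT hC', hw, mul_zero, Pi.zero_apply]
  have hs : weylSymE (confMetric φ G) y = 0 := by
    funext J
    rw [weylSymE_eq J hG' hy, hw, hw, add_zero, Pi.zero_apply]
  rw [hb] at h1
  rw [hs] at h2
  exact ⟨(smul_eq_zero.1 h1.symm).resolve_left (inv_ne_zero hp),
    (smul_eq_zero.1 h2.symm).resolve_left (inv_ne_zero hp)⟩

end SmoothMetricOn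

end Invariance

/-- The contracted Bianchi identity turns `C_𝕋 = 0` into the divergence equation. -/
theorem divWeyl_of_cTensor (hn : 4 ≤ n) {G : MetricComp n} {Ω : Set (Coord n)} {y : Coord n}
    (hG : SmoothMetricOn G Ω) (hy : y ∈ Ω) (hC : cTensor G y = 0) (i j k : Fin n) :
    divWeyl G y ![i, j, k] = ((n : ℝ) - 3) * weylContr G (tForm G) y ![i, j, k] := by
  rw [(hG.contracted_bianchi hn hy).2]
  have h := congrFun hC ![i, j, k]
  have e : ∑ l, weyl G y ![i, j, k, l] * tVec G y l = weylContr G (tForm G) y ![i, j, k] := by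
    simp only [weylContr_apply, tVec, Finset.mul_sum]
    exact Finset.sum_congr rfl fun l _ => Finset.sum_congr rfl fun m _ => by ring
  have h' : dNabla G (schouten G) y ![i, j, k] - ∑ l, weyl G y ![i, j, k, l] * tVec G y l = 0 := h
  rw [e] at h'
  rw [sub_eq_zero.1 h']

/-! ### Components of a metric in a chart -/

section Charts

variable {n : ℕ} {M : Type*} [TopologicalSpace M] [ChartedSpace (Coord n) M]

theorem confFactorOn_of_contMDiffOn {e : OpenPartialHomeomorph M (Coord n)}
    (he : e ∈ IsManifold.maximalAtlas 𝓘(ℝ, Coord n) ∞ M) {U : Set M} {ψ : M → ℝ} (hU : IsOpen U)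
    (hψ : ContMDiffOn 𝓘(ℝ, Coord n) 𝓘(ℝ) ∞ ψ U) (hpos : ∀ p ∈ U, 0 < ψ p) :
    ConfFactorOn (fun z => ((ψ (e.symm z)) ^ 2)⁻¹) (e.target ∩ e.symm ⁻¹' U) where
  smooth y hy := by
    have h1 : ContMDiffAt 𝓘(ℝ, Coord n) 𝓘(ℝ) ∞ (fun z => ψ (e.symm z)) y :=
      (hψ.contMDiffAt (hU.mem_nhds hy.2)).comp y (contMDiffAt_symm_of_mem_maximalAtlas he hy.1)
    exact ((contMDiffAt_iff_contDiffAt.1 h1).pow 2).inv (pow_ne_zero 2 (hpos _ hy.2).ne')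
  pos y hy := by
    have := hpos _ hy.2
    positivity

variable [IsManifold 𝓘(ℝ, Coord n) ∞ M]

/-- A coordinate field is the tangent map of the inverse chart applied to a constant field. -/
theorem contMDiffAt_coordVec {e : OpenPartialHomeomorph M (Coord n)}
    (he : e ∈ IsManifold.maximalAtlas 𝓘(ℝ, Coord n) ∞ M) {y : Coord n} (hy : y ∈ e.target)
    (i : Fin n) :
    ContMDiffAt 𝓘(ℝ, Coord n) (𝓘(ℝ, Coord n).prod 𝓘(ℝ, Coord n)) ∞
      (fun z => (⟨e.symm z, coordVec e i z⟩ : TangentBundle 𝓘(ℝ, Coord n) M)) y := by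
  have : IsManifold 𝓘(ℝ, Coord n) 1 M := IsManifold.of_le (n := ∞) (by simp)
  have h1 := (contMDiffOn_symm_of_mem_maximalAtlas he).contMDiffOn_tangentMapWithin
    (m := ∞) (by simp) e.open_target.uniqueMDiffOn
  have h2 : ContMDiffAt 𝓘(ℝ, Coord n) 𝓘(ℝ, Coord n).tangent ∞
      (fun z : Coord n => (⟨z, (EuclideanSpace.single i (1 : ℝ) : Coord n)⟩ :
        TangentBundle 𝓘(ℝ, Coord n) (Coord n))) y :=
    contMDiffAt_vectorSpace_iff_contDiffAt.2 contDiffAt_const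
  have h3 : Bundle.TotalSpace.proj ⁻¹' e.target ∈
      𝓝 (⟨y, (EuclideanSpace.single i (1 : ℝ) : Coord n)⟩ :
        TangentBundle 𝓘(ℝ, Coord n) (Coord n)) :=
    (FiberBundle.continuous_proj (Coord n) _).continuousAt.preimage_mem_nhds
      (e.open_target.mem_nhds hy)
  have h4 := (h1.contMDiffAt h3).comp y h2
  refine h4.congr_of_eventuallyEq ?_
  filter_upwards [e.open_target.mem_nhds hy] with z hz
  simp only [Function.comp, tangentMapWithin, coordVec, mfderivWithin_of_isOpen e.open_target hz]

theorem contDiffAt_comp (g : Metric n M) {e : OpenPartialHomeomorph M (Coord n)}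
    (he : e ∈ IsManifold.maximalAtlas 𝓘(ℝ, Coord n) ∞ M) {y : Coord n} (hy : y ∈ e.target)
    (i j : Fin n) : ContDiffAt ℝ ∞ (fun z => comp g e z i j) y := by
  rw [← contMDiffAt_iff_contDiffAt]
  have hb : ContMDiffAt 𝓘(ℝ, Coord n) 𝓘(ℝ, Coord n) ∞ e.symm y :=
    contMDiffAt_symm_of_mem_maximalAtlas he hy
  have : ContMDiffAt 𝓘(ℝ, Coord n) (𝓘(ℝ, Coord n).prod 𝓘(ℝ, ℝ)) ∞
      (fun z => Bundle.TotalSpace.mk' ℝ (E := Bundle.Trivial M ℝ) (e.symm z)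
        (g.inner (e.symm z) (coordVec e i z) (coordVec e j z))) y := by
    apply ContMDiffAt.clm_bundle_apply₂ (F₁ := Coord n) (F₂ := Coord n)
    · exact g.contMDiff.contMDiffAt.comp y hb
    · exact contMDiffAt_coordVec he hy i
    · exact contMDiffAt_coordVec he hy j
  simp only [Bundle.contMDiffAt_totalSpace] at this
  exact this.2

/-- The derivative of an inverse chart is injective, so `g` pulls back to a positive definite form.
-/
theorem posDef_comp (g : Metric n M) {e : OpenPartialHomeomorph M (Coord n)}
    (he : e ∈ IsManifold.maximalAtlas 𝓘(ℝ, Coord n) ∞ M) {y : Coord n} (hy : y ∈ e.target) :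
    (comp g e y).PosDef := by
  refine Matrix.PosDef.of_dotProduct_mulVec_pos ?_ fun x hx => ?_
  · ext i j
    simp only [Matrix.conjTranspose_apply, comp, Matrix.of_apply, star_trivial]
    exact g.symm _ _ _
  · set v : Coord n := WithLp.toLp 2 x with hv
    have hv0 : v ≠ 0 := fun h => hx (by simpa [hv] using h)
    set L := mfderiv 𝓘(ℝ, Coord n) 𝓘(ℝ, Coord n) e.symm y with hL
    have hmd : e.MDifferentiable 𝓘(ℝ, Coord n) 𝓘(ℝ, Coord n) :=
      ⟨(contMDiffOn_of_mem_maximalAtlas he).mdifferentiableOn (by simp),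
        (contMDiffOn_symm_of_mem_maximalAtlas he).mdifferentiableOn (by simp)⟩
    have hinj : Function.Injective L := hmd.symm.mfderiv_injective hy
    have hsum : L v = ∑ i, x i • coordVec e i y := by
      have : v = ∑ i, x i • (EuclideanSpace.single i (1 : ℝ) : Coord n) := by
        ext k
        simp [hv, Pi.single_apply]
      rw [this]
      exact (map_sum L _ _).trans (Finset.sum_congr rfl fun i _ => map_smul L _ _)
    have hne : L v ≠ 0 := fun h => hv0 (hinj (h.trans (map_zero L).symm))
    have hpos := g.pos _ _ hne
    have heq : g.inner (e.symm y) (L v) (L v) = star x ⬝ᵥ (comp g e y).mulVec x := by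
      rw [hsum]
      simp only [map_sum, map_smul, FunLike.coe_sum, Finset.sum_apply, FunLike.coe_smul,
        Pi.smul_apply, smul_eq_mul, dotProduct, Matrix.mulVec, comp, Matrix.of_apply, star_trivial,
        Finset.mul_sum]
      rw [Finset.sum_comm]
      exact Finset.sum_congr rfl fun i _ => Finset.sum_congr rfl fun j _ => by ring
    rw [← heq]
    exact hpos

theorem smoothMetricOn_comp (g : Metric n M) {e : OpenPartialHomeomorph M (Coord n)}
    (he : e ∈ IsManifold.maximalAtlas 𝓘(ℝ, Coord n) ∞ M) {Ω : Set (Coord n)} (hΩ : IsOpen Ω)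
    (hsub : Ω ⊆ e.target) : SmoothMetricOn (comp g e) Ω where
  isOpen := hΩ
  smooth _ hy i j := contDiffAt_comp g he (hsub hy) i j
  posDef _ hy := posDef_comp g he (hsub hy)

end Charts

end ConfGeom

end

/-! ### The theorem on the manifold. -/

theorem mainTheorem6 {n : ℕ} (hn : 4 ≤ n) {M : Type*} [TopologicalSpace M]
    [ChartedSpace (ConfGeom.Coord n) M] [IsManifold 𝓘(ℝ, ConfGeom.Coord n) ∞ M]
    (g : ConfGeom.Metric n M) :
    (ConfGeom.CVanishes g →
      ConfGeom.ConformallyInvariantAt ConfGeom.bHat 1 g ∧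
        ConfGeom.ConformallyInvariantAt ConfGeom.weylSymE 1 g) ∧
    (ConfGeom.IsConformallyEinstein g →
      ConfGeom.VanishesOnRegular ConfGeom.bHat g ∧
        ConfGeom.VanishesOnRegular ConfGeom.weylSymE g) := by
  -- All coordinate statements are applied on the part of the chart's image lying over `U`.
  have hset : ∀ {U : Set M} {e : OpenPartialHomeomorph M (ConfGeom.Coord n)} {p : M}, IsOpen U →
      e ∈ IsManifold.maximalAtlas 𝓘(ℝ, ConfGeom.Coord n) ∞ M → p ∈ U → p ∈ e.source →
      ConfGeom.SmoothMetricOn (ConfGeom.comp g e) (e.target ∩ e.symm ⁻¹' U) ∧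
        e p ∈ e.target ∩ e.symm ⁻¹' U := by
    intro U e p hU he hp hpe
    refine ⟨ConfGeom.smoothMetricOn_comp g he (e.isOpen_inter_preimage_symm hU)
      Set.inter_subset_left, e.map_source hpe, ?_⟩
    rw [Set.mem_preimage, e.left_inv hpe]
    exact hp
  constructor
  · intro hC
    have key : ∀ (U : Set M) (ψ : M → ℝ), IsOpen U →
        ContMDiffOn 𝓘(ℝ, ConfGeom.Coord n) 𝓘(ℝ) ∞ ψ U → (∀ p ∈ U, 0 < ψ p) →
        ∀ e ∈ IsManifold.maximalAtlas 𝓘(ℝ, ConfGeom.Coord n) ∞ M,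
        ∀ p ∈ U ∩ ConfGeom.regularPart g e,
        ConfGeom.bHat (ConfGeom.confComp ψ g e) (e p) =
          ψ p ^ (2 * (1 : ℤ)) • ConfGeom.bHat (ConfGeom.comp g e) (e p) ∧
        ConfGeom.weylSymE (ConfGeom.confComp ψ g e) (e p) =
          ψ p ^ (2 * (1 : ℤ)) • ConfGeom.weylSymE (ConfGeom.comp g e) (e p) := by
      rintro U ψ hU hψ hpos e he p ⟨hpU, hpe, hr⟩
      obtain ⟨hG, hy⟩ := hset hU he hpU hpe
      have hφ := ConfGeom.confFactorOn_of_contMDiffOn he hU hψ hpos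
      have hw : ((((ψ (e.symm (e p))) ^ 2)⁻¹)⁻¹ : ℝ) = ψ p ^ (2 * (1 : ℤ)) := by
        rw [e.left_inv hpe, inv_inv, mul_one]
        norm_cast
      rw [← hw]
      refine hG.conformal_invariance hn hφ hy hr ?_
      -- Regularity is an open condition, so `C_𝕋 = 0` is available at all points near `p`, as is
      -- needed in order to differentiate the divergence equation.
      filter_upwards [eventually_eventually_nhds.2 hr, hG.mem_nhds hy, hr] with z hz hzΩ hz1
      have hreg : e.symm z ∈ ConfGeom.regularPart g e := by
        refine ⟨e.map_target hzΩ.1, ?_⟩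
        rw [e.right_inv hzΩ.1]
        filter_upwards [hz] with w hw
        rw [hw, hz1]
      have hc := hC e he _ hreg
      rw [e.right_inv hzΩ.1] at hc
      exact ⟨_, ConfGeom.divWeyl_of_cTensor hn hG hzΩ hc⟩
    exact ⟨fun U ψ hU hψ hpos e he p hp => (key U ψ hU hψ hpos e he p hp).1,
      fun U ψ hU hψ hpos e he p hp => (key U ψ hU hψ hpos e he p hp).2⟩
  · intro hE
    have key : ∀ e ∈ IsManifold.maximalAtlas 𝓘(ℝ, ConfGeom.Coord n) ∞ M,
        ∀ p ∈ ConfGeom.regularPart g e,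
        ConfGeom.bHat (ConfGeom.comp g e) (e p) = 0 ∧
        ConfGeom.weylSymE (ConfGeom.comp g e) (e p) = 0 := by
      rintro e he p ⟨hpe, hr⟩
      obtain ⟨U, ψ, hU, hpU, hψ, hpos, hein⟩ := hE p
      obtain ⟨hG, hy⟩ := hset hU he hpU hpe
      have hφ := ConfGeom.confFactorOn_of_contMDiffOn he hU hψ hpos
      refine hG.vanishing_of_conf_einstein hn hφ hy hr fun z hz => ?_
      have := hein e he (e.symm z) ⟨hz.2, e.map_target hz.1⟩
      rw [e.right_inv hz.1] at this
      exact this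
    exact ⟨fun e he p hp => (key e he p hp).1, fun e he p hp => (key e he p hp).2⟩
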